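/- **Setting.** Let $F\subset\mathbb R^d$ be a connected p.c.f. self-similar set: $F=\bigcup_{i=1}^N F_i(F)$ is compact and connected, the $F_i$ are contracting similitudes with pairwise distinct fixed points $q_i$, and the symbolic post critical set (all proper shifts of addresses of points of $\mathcal C$) is finite, where $\mathcal C=\bigcup_{i\ne j}F_i(F)\cap F_j(F)$. Let $\mathcal P=\{x\in F: F_w(x)\in\mathcal C\text{ for some non-empty word }w\}$, and assume that every $p\in\mathcal P$ has the form $p=F_w(q_i)$ with a (possibly empty) word $w$ and $q_i\in\mathcal P$, and that $q_i\notin\mathcal C$ for all $i$. Let $0<\alpha<1$ and $G_i=\alpha(F_i-q_i)+q_i$; $G_w$ denotes the composition along a word $w$. For $p\in\mathcal P$ choose a representation $p=F_w(q_i)$, $q_i\in\mathcal P$, and put $b(p)=G_w(q_i)$; the choices are assumed compatible, i.e. for each $p\in\mathcal P$ there are $j$ and $p'\in\mathcal P$ with $F_j(p')=p$ and $b(p)=G_j(b(p'))$. (So $b(p)=p$ if $p$ is a fixed point.) Let $V_0=b(\mathcal P)$. For each pair $\ell=(i,p)$ with $p\in F$, $c_\ell:=F_i(p)\in\mathcal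 C$, let $z_\ell=G_i(b(p))$ and let $e_\ell$ be the segment from $z_\ell$ to $c_\ell$, with $\xi_\ell(t)=tc_\ell+(1-t)z_\ell$; $L$ is the finite set of these $\ell$. The stretched fractal $K$ is the non-empty compact set with $K=\bigcup_iG_i(K)\cup\bigcup_{\ell\in L}e_\ell$. Assume that its pieces are attached only as prescribed: the sets $G_i(K)$ are pairwise disjoint; $e_{\ell}\cap G_j(K)\subset\{z_\ell\}$ if $j=i$ is the first entry of $\ell=(i,p)$, and $e_\ell\cap G_j(K)=\emptyset$ otherwise; and $e_\ell\cap e_{\ell'}\subset\{c_\ell\}\cap\{c_{\ell'}\}$ for $\ell\neq\ell'$. **Harmonic structures.** Let $E_0$ be the set of all $2$-element subsets of $V_0$, $r_0:E_0\to(0,\infty]$ and $Q(u)=\sum_{\{x,y\}\in E_0}r_0(x,y)^{-1}(u(x)-u(y))^2$ (with $1/\infty=0$). For $0<\lambda<1$ and $\rho:L\to(0,\infty)$, $(r_0,\lambda,\rho)$ is a harmonic structure if $V_0$ is connected through edges of finite resistance $r_0$ and, for all $g:V_0\to\mathbb R$, $$Q(g)=\inf_{u|_{V_0}=g}\Big(\lambda^{-1}\sum_{i}Q(u\circ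 G_i)+\sum_{\ell\in L}\rho_\ell^{-1}(u(c_\ell)-u(z_\ell))^2\Big).$$ A sequence $\mathcal R=(\lambda_k,\rho^k)_{k\ge1}$ such that all $(r_0,\lambda_k,\rho^k)$ are harmonic structures is regular if $\lambda_k\le\lambda^*$ for all $k$ with some $\lambda^*<1$, and $\sup_{k,\ell}\rho^k_\ell<\infty$. With $\delta_n=\lambda_1\cdots\lambda_n$ ($\delta_0=1$) let $$\mathcal E_{\mathcal R,n}(u)=\frac1{\delta_n}\sum_{|w|=n}Q(u\circ G_w)+\sum_{k=0}^{n-1}\frac1{\delta_k}\sum_{|w|=k}\sum_{\ell\in L}\frac1{\rho^{k+1}_\ell}\int_0^1\Big(\frac{d(u\circ G_w\circ\xi_\ell)}{dt}\Big)^2dt,$$ $\mathcal E_{\mathcal R}(u)=\lim_n\mathcal E_{\mathcal R,n}(u)$, let $\mathcal D_{\mathcal R}=\mathcal F_{\mathcal R}$ be the set of $u\in C(K)$ with $u\circ G_w\circ\xi_\ell\in H^1[0,1]$ for all words $w$ and all $\ell\in L$ for which this limit is finite, and let $\mathcal E_{\mathcal R}(u,v)$ be defined by polarization. Let $\mathcal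 D^0_{\mathcal R}=\{u\in\mathcal D_{\mathcal R}:u|_{V_0}=0\}$. **Measures.** Let $\mu_\Sigma$ be the Borel probability measure with $\mu_\Sigma=\sum_i\frac1N\,\mu_\Sigma\circ G_i^{-1}$. Let $0<\beta<1/N$, $a_\ell>0$ with $\sum_{\ell\in L}a_\ell=1-\beta N$, and let $\mu_I$ be the sum over all words $w$ (including the empty one) and $\ell\in L$ of $\beta^{|w|}a_\ell$ times the normalized one-dimensional Lebesgue measure on $G_w(e_\ell)$. For $\eta\in(0,1]$ let $\mu_\eta=\eta\mu_I+(1-\eta)\mu_\Sigma$. **Lemma.** For every regular sequence $\mathcal R$ of harmonic structures and every such $\mu_\eta$, $(\mathcal E_{\mathcal R},\mathcal D_{\mathcal R})$ is a regular Dirichlet form on $L^2(K,\mu_\eta)$, and $(\mathcal E_{\mathcal R}|_{\mathcal D^0_{\mathcal R}\times\mathcal D^0_{\mathcal R}},\mathcal D^0_{\mathcal R})$ is a regular Dirichlet form on $L^2(K\setminus V_0,\mu_\eta|_{K\setminus V_0})$. -/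

import Mathlib

open Filter Topology MeasureTheory Set
open scoped ENNReal

noncomputable section

namespace StretchedFractal

/-! ### Regular Dirichlet forms -/

/-- `E` with domain `D` is a regular Dirichlet form on the real space `L²(X, μ)`, in the sense of
Fukushima, Oshima and Takeda: `X` is locally compact, `μ` is finite on compact sets and has full
support, `D` is dense, `E` is symmetric, non-negative, closed (`D` is complete for
`E₁(f, f) = E(f, f) + ‖f‖²`) and Markovian (the unit contraction operates), and `D ∩ C_c(X)` is
dense both in `D` for `E₁` and in `C_c(X)` for the uniform norm. -/
structure IsRegularDirichletForm {X : Type*} [TopologicalSpace X] [MeasurableSpace X]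
    (μ : Measure X) (D : Submodule ℝ (Lp ℝ 2 μ)) (E : D →ₗ[ℝ] D →ₗ[ℝ] ℝ) : Prop where
  locallyCompact : LocallyCompactSpace X
  finiteOnCompacts : IsFiniteMeasureOnCompacts μ
  fullSupport : μ.IsOpenPosMeasure
  dense : Dense (D : Set (Lp ℝ 2 μ))
  symm : ∀ f g : D, E f g = E g f
  nonneg : ∀ f : D, 0 ≤ E f f
  closed : ∀ f : ℕ → D,
    (∀ ε > (0 : ℝ), ∃ M, ∀ m ≥ M, ∀ n ≥ M,
      E (f m - f n) (f m - f n) + ‖((f m - f n : D) : Lp ℝ 2 μ)‖ ^ 2 < ε) →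
    ∃ g : D, Tendsto (fun n => E (f n - g) (f n - g) + ‖((f n - g : D) : Lp ℝ 2 μ)‖ ^ 2)
      atTop (𝓝 0)
  markov : ∀ f : D, ∃ g : D,
    ((g : Lp ℝ 2 μ) : X → ℝ) =ᵐ[μ] (fun x => min (max (((f : Lp ℝ 2 μ) : X → ℝ) x) 0) 1) ∧
      E g g ≤ E f f
  core_dense : ∀ f : D, ∀ ε > (0 : ℝ), ∃ φ : X → ℝ, Continuous φ ∧ HasCompactSupport φ ∧
    ∃ g : D, ((g : Lp ℝ 2 μ) : X → ℝ) =ᵐ[μ] φ ∧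
      E (f - g) (f - g) + ‖((f - g : D) : Lp ℝ 2 μ)‖ ^ 2 < ε
  core_uniform : ∀ φ : X → ℝ, Continuous φ → HasCompactSupport φ → ∀ ε > (0 : ℝ),
    ∃ ψ : X → ℝ, Continuous ψ ∧ HasCompactSupport ψ ∧
      (∃ g : D, ((g : Lp ℝ 2 μ) : X → ℝ) =ᵐ[μ] ψ) ∧ ∀ x, |φ x - ψ x| < ε

/-- A class `𝓕` of functions (only their restrictions to the subset `X` matter), with a form `e`
on it, is a regular Dirichlet form on `L²(X, μ|_X)`: the `L²`-classes of the restrictions to `X` of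
the elements of `𝓕` form a subspace `D`, `e` gives a well-defined bilinear form on `D`, and the
resulting pair is a regular Dirichlet form. -/
def IsRegularDirichletFormOn {Y : Type*} [TopologicalSpace Y] [MeasurableSpace Y]
    (X : Set Y) (μ : Measure Y) (𝓕 : Set (Y → ℝ)) (e : (Y → ℝ) → (Y → ℝ) → ℝ) : Prop :=
  (∀ u ∈ 𝓕, MemLp (fun x : X => u x) 2 (μ.comap Subtype.val)) ∧
  ∃ (D : Submodule ℝ (Lp ℝ 2 (μ.comap (Subtype.val : X → Y)))) (E : D →ₗ[ℝ] D →ₗ[ℝ] ℝ),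
    (∀ f : Lp ℝ 2 (μ.comap (Subtype.val : X → Y)), f ∈ D ↔
      ∃ u ∈ 𝓕, (f : X → ℝ) =ᵐ[μ.comap Subtype.val] (fun x : X => u x)) ∧
    (∀ f g : D, ∀ u ∈ 𝓕, ∀ v ∈ 𝓕,
      ((f : Lp ℝ 2 (μ.comap (Subtype.val : X → Y))) : X → ℝ)
        =ᵐ[μ.comap Subtype.val] (fun x : X => u x) →
      ((g : Lp ℝ 2 (μ.comap (Subtype.val : X → Y))) : X → ℝ)
        =ᵐ[μ.comap Subtype.val] (fun x : X => v x) →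
      E f g = e u v) ∧
    IsRegularDirichletForm (μ.comap (Subtype.val : X → Y)) D E

/-! ### Self-similar sets -/

/-- `f_w = f_{w₁} ∘ ⋯ ∘ f_{wₙ}`, the identity for the empty word. -/
def wordMap {X : Type*} {N : ℕ} (f : Fin N → X → X) : List (Fin N) → X → X
  | [] => id
  | i :: w => f i ∘ wordMap f w

/-- A connected self-similar set in `ℝ^d`, the attractor of `N` contracting similitudes with
pairwise distinct fixed points. -/
structure SelfSimilarSet (d N : ℕ) where
  /-- the similitudes `F_i` -/
  map : Fin N → EuclideanSpace ℝ (Fin d) → EuclideanSpace ℝ (Fin d)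
  /-- the fixed points `q_i` -/
  fix : Fin N → EuclideanSpace ℝ (Fin d)
  /-- the attractor `F` -/
  carrier : Set (EuclideanSpace ℝ (Fin d))
  similitude : ∀ i, ∃ r : ℝ, 0 < r ∧ r < 1 ∧ ∀ x y, dist (map i x) (map i y) = r * dist x y
  map_fix : ∀ i, map i (fix i) = fix i
  fix_injective : Function.Injective fix
  isCompact : IsCompact carrier
  isConnected : IsConnected carrier
  carrier_eq : carrier = ⋃ i, map i '' carrier

namespace SelfSimilarSet

variable {d N : ℕ}

/-- The critical set `𝒞`, the points where two different `1`-cells meet. -/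
def crit (S : SelfSimilarSet d N) : Set (EuclideanSpace ℝ (Fin d)) :=
  {x | ∃ i j, i ≠ j ∧ x ∈ S.map i '' S.carrier ∧ x ∈ S.map j '' S.carrier}

/-- The post critical set `𝒫`. -/
def postCrit (S : SelfSimilarSet d N) : Set (EuclideanSpace ℝ (Fin d)) :=
  {x | x ∈ S.carrier ∧ ∃ w : List (Fin N), w ≠ [] ∧ wordMap S.map w x ∈ S.crit}

/-- The infinite word `ω` is an address of the point `x`. -/
def Codes (S : SelfSimilarSet d N) (ω : ℕ → Fin N) (x : EuclideanSpace ℝ (Fin d)) : Prop :=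
  ∀ n : ℕ, x ∈ wordMap S.map (List.ofFn fun k : Fin n => ω k) '' S.carrier

/-- The symbolic post critical set: all proper shifts of the addresses of critical points. -/
def symbolicPostCrit (S : SelfSimilarSet d N) : Set (ℕ → Fin N) :=
  {τ | ∃ ω, ∃ x ∈ S.crit, S.Codes ω x ∧ ∃ m : ℕ, 1 ≤ m ∧ τ = fun k => ω (k + m)}

/-- `F` is post critically finite and can be stretched: each post critical point is an image
`F_w(q_i)` of a post critical fixed point, and no fixed point is critical. -/
structure Stretchable (S : SelfSimilarSet d N) : Prop where
  pcf : S.symbolicPostCrit.Finite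
  cond1 : ∀ p ∈ S.postCrit, ∃ (w : List (Fin N)) (i : Fin N),
    S.fix i ∈ S.postCrit ∧ p = wordMap S.map w (S.fix i)
  cond2 : ∀ i, S.fix i ∉ S.crit

/-! ### The stretched fractal -/

/-- `G_i = α (F_i - q_i) + q_i`. -/
def stretch (S : SelfSimilarSet d N) (α : ℝ) (i : Fin N) (x : EuclideanSpace ℝ (Fin d)) :
    EuclideanSpace ℝ (Fin d) :=
  α • (S.map i x - S.fix i) + S.fix i

/-- A choice, for each post critical point `p`, of a representation `p = F_w(q_i)` with a post
critical fixed point `q_i`, recorded through the corresponding point `b p = G_w(q_i)` of the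
stretched fractal. The choice is compatible with the cell structure: if `p` lies in the `j`-th
`1`-cell chosen for it, `p = F_j(p')`, then `b p = G_j(b p')`. (If `p` is itself a fixed point, then
`b p = p`.) -/
def IsBoundaryChoice (S : SelfSimilarSet d N) (α : ℝ)
    (b : EuclideanSpace ℝ (Fin d) → EuclideanSpace ℝ (Fin d)) : Prop :=
  ∀ p ∈ S.postCrit,
    (∃ (w : List (Fin N)) (i : Fin N), S.fix i ∈ S.postCrit ∧
      p = wordMap S.map w (S.fix i) ∧ b p = wordMap (S.stretch α) w (S.fix i)) ∧
    (∃ j, ∃ p' ∈ S.postCrit, S.map j p' = p ∧ b p = S.stretch α j (b p'))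

/-- The index set of the connecting lines: the pairs `(i, p)` with `p ∈ F` and `c = F_i(p) ∈ 𝒞`.
For a critical point `c` there are exactly `ρ(c)` of them with `F_i(p) = c`, one for each `1`-cell
that contains `c`, and `p` is then post critical. -/
def lines (S : SelfSimilarSet d N) : Set (Fin N × EuclideanSpace ℝ (Fin d)) :=
  {l | l.2 ∈ S.carrier ∧ S.map l.1 l.2 ∈ S.crit}

/-- The end point `c ∈ 𝒞` of a connecting line. -/
def critEnd (S : SelfSimilarSet d N) (l : Fin N × EuclideanSpace ℝ (Fin d)) :
    EuclideanSpace ℝ (Fin d) := S.map l.1 l.2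

/-- The other end point of a connecting line, the point that is stretched away from `c`: if
`b p = G_w(q)`, so that `c = F_i(F_w(q))`, it is `G_i(G_w(q))`. -/
def cellEnd (S : SelfSimilarSet d N) (α : ℝ)
    (b : EuclideanSpace ℝ (Fin d) → EuclideanSpace ℝ (Fin d))
    (l : Fin N × EuclideanSpace ℝ (Fin d)) : EuclideanSpace ℝ (Fin d) :=
  S.stretch α l.1 (b l.2)

/-- The affine parametrization `ξ : t ↦ t c + (1 - t) G_i(G_w(q))` of a connecting line. -/
def lineCurve (S : SelfSimilarSet d N) (α : ℝ)
    (b : EuclideanSpace ℝ (Fin d) → EuclideanSpace ℝ (Fin d))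
    (l : Fin N × EuclideanSpace ℝ (Fin d)) (t : ℝ) : EuclideanSpace ℝ (Fin d) :=
  t • S.critEnd l + (1 - t) • S.cellEnd α b l

/-- The connecting line `e_{c,l}`. -/
def line (S : SelfSimilarSet d N) (α : ℝ)
    (b : EuclideanSpace ℝ (Fin d) → EuclideanSpace ℝ (Fin d))
    (l : Fin N × EuclideanSpace ℝ (Fin d)) : Set (EuclideanSpace ℝ (Fin d)) :=
  S.lineCurve α b l '' Icc (0 : ℝ) 1

/-- `K` is the stretched fractal: the compact solution of
`K = ⋃ G_i(K) ∪ ⋃ e_{c,l}` (which is unique). -/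
structure IsStretchedFractal (S : SelfSimilarSet d N) (α : ℝ)
    (b : EuclideanSpace ℝ (Fin d) → EuclideanSpace ℝ (Fin d))
    (K : Set (EuclideanSpace ℝ (Fin d))) : Prop where
  isCompact : IsCompact K
  nonempty : K.Nonempty
  eq : K = (⋃ i, S.stretch α i '' K) ∪ ⋃ l ∈ S.lines, S.line α b l

/-- The pieces of the stretched fractal are attached to one another only as prescribed: the
`1`-cells are pairwise disjoint, a connecting line meets the `1`-cells at most in its own end point
in its own `1`-cell, and two different connecting lines meet at most in a common critical point. -/
structure IsSeparated (S : SelfSimilarSet d N) (α : ℝ)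
    (b : EuclideanSpace ℝ (Fin d) → EuclideanSpace ℝ (Fin d))
    (K : Set (EuclideanSpace ℝ (Fin d))) : Prop where
  cell_cell : ∀ i j, i ≠ j → Disjoint (S.stretch α i '' K) (S.stretch α j '' K)
  line_cell : ∀ l ∈ S.lines, ∀ j, ∀ x ∈ S.line α b l, x ∈ S.stretch α j '' K →
    j = l.1 ∧ x = S.cellEnd α b l
  line_line : ∀ l ∈ S.lines, ∀ l' ∈ S.lines, l ≠ l' → ∀ x ∈ S.line α b l, x ∈ S.line α b l' →
    x = S.critEnd l ∧ x = S.critEnd l'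

/-- The vertex set `V₀` of the initial graph. -/
def vertices (S : SelfSimilarSet d N)
    (b : EuclideanSpace ℝ (Fin d) → EuclideanSpace ℝ (Fin d)) : Set (EuclideanSpace ℝ (Fin d)) :=
  b '' S.postCrit

/-- The edge set `E₀` of the initial graph, the complete graph on `V₀`. -/
def edges (S : SelfSimilarSet d N)
    (b : EuclideanSpace ℝ (Fin d) → EuclideanSpace ℝ (Fin d)) :
    Set (Sym2 (EuclideanSpace ℝ (Fin d))) :=
  {e | ¬ e.IsDiag ∧ ∀ x ∈ e, x ∈ S.vertices b}

/-! ### Harmonic structures -/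

/-- `(u(x) - u(y))²` for an edge `{x, y}`. -/
def edgeSq {X : Type*} (u : X → ℝ) : Sym2 X → ℝ≥0∞ :=
  Sym2.lift ⟨fun x y => ENNReal.ofReal ((u x - u y) ^ 2), fun x y => by
    change ENNReal.ofReal _ = ENNReal.ofReal _
    congr 1
    ring⟩

/-- `Q^Σ_{r₀}(u) = ∑_{{x,y} ∈ E₀} (u(x) - u(y))² / r₀(x,y)`, where `1/∞ = 0`. -/
def cellForm (S : SelfSimilarSet d N)
    (b : EuclideanSpace ℝ (Fin d) → EuclideanSpace ℝ (Fin d))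
    (r₀ : Sym2 (EuclideanSpace ℝ (Fin d)) → ℝ≥0∞) (u : EuclideanSpace ℝ (Fin d) → ℝ) : ℝ≥0∞ :=
  ∑' e : S.edges b, (r₀ e)⁻¹ * edgeSq u e

/-- `Q^I_ρ(u)`, the sum of `(u(x) - u(y))² / ρ_{{x,y}}` over the connecting edges `{x,y} ∈ E₁^I`. -/
def connectForm (S : SelfSimilarSet d N) (α : ℝ)
    (b : EuclideanSpace ℝ (Fin d) → EuclideanSpace ℝ (Fin d))
    (ρ : Fin N × EuclideanSpace ℝ (Fin d) → ℝ) (u : EuclideanSpace ℝ (Fin d) → ℝ) : ℝ≥0∞ :=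
  ∑' l : S.lines, (ENNReal.ofReal (ρ l))⁻¹ *
    ENNReal.ofReal ((u (S.critEnd l) - u (S.cellEnd α b l)) ^ 2)

/-- The energy of the network `(V₁, E₁, r₁)`: resistances `λ r₀(e)` on the edges `G_i(e)`, `e ∈ E₀`,
and `ρ` on the connecting edges. -/
def form₁ (S : SelfSimilarSet d N) (α : ℝ)
    (b : EuclideanSpace ℝ (Fin d) → EuclideanSpace ℝ (Fin d))
    (r₀ : Sym2 (EuclideanSpace ℝ (Fin d)) → ℝ≥0∞) (lam : ℝ)
    (ρ : Fin N × EuclideanSpace ℝ (Fin d) → ℝ) (u : EuclideanSpace ℝ (Fin d) → ℝ) : ℝ≥0∞ :=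
  (∑ i, (ENNReal.ofReal lam)⁻¹ * S.cellForm b r₀ (u ∘ S.stretch α i)) + S.connectForm α b ρ u

/-- `(r₀, λ, ρ)` is a harmonic structure: `r₀ ∈ (0, ∞]`, `0 < λ < 1`, `ρ ∈ (0, ∞)`, the network
`(V₀, E₀, r₀)` is connected through edges of finite resistance, and the trace of the energy of
`(V₁, E₁, r₁)` on `V₀` is the energy of `(V₀, E₀, r₀)`. (All forms depend on the values at the
vertices only, so functions on the vertices are written as functions on `ℝ^d`.) -/
structure IsHarmonicStructure (S : SelfSimilarSet d N) (α : ℝ)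
    (b : EuclideanSpace ℝ (Fin d) → EuclideanSpace ℝ (Fin d))
    (r₀ : Sym2 (EuclideanSpace ℝ (Fin d)) → ℝ≥0∞) (lam : ℝ)
    (ρ : Fin N × EuclideanSpace ℝ (Fin d) → ℝ) : Prop where
  r₀_pos : ∀ e ∈ S.edges b, 0 < r₀ e
  lam_pos : 0 < lam
  lam_lt_one : lam < 1
  ρ_pos : ∀ l ∈ S.lines, 0 < ρ l
  connected : ∀ x ∈ S.vertices b, ∀ y ∈ S.vertices b,
    Relation.ReflTransGen (fun p p' => s(p, p') ∈ S.edges b ∧ r₀ s(p, p') < ∞) x y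
  trace : ∀ g : EuclideanSpace ℝ (Fin d) → ℝ,
    (⨅ (u : EuclideanSpace ℝ (Fin d) → ℝ) (_ : EqOn u g (S.vertices b)),
      S.form₁ α b r₀ lam ρ u) = S.cellForm b r₀ g

/-- A regular sequence of harmonic structures with fixed `r₀`; `lam k`, `ρ k` stand for
`λ_{k+1}`, `ρ^{k+1}`. -/
structure IsRegularSequence (S : SelfSimilarSet d N) (α : ℝ)
    (b : EuclideanSpace ℝ (Fin d) → EuclideanSpace ℝ (Fin d))
    (r₀ : Sym2 (EuclideanSpace ℝ (Fin d)) → ℝ≥0∞) (lam : ℕ → ℝ)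
    (ρ : ℕ → Fin N × EuclideanSpace ℝ (Fin d) → ℝ) : Prop where
  harmonic : ∀ k, S.IsHarmonicStructure α b r₀ (lam k) (ρ k)
  lam_bound : ∃ lamStar < (1 : ℝ), ∀ k, lam k ≤ lamStar
  ρ_bound : ∃ ρStar : ℝ, ∀ k, ∀ l ∈ S.lines, ρ k l ≤ ρStar

/-! ### The limit form -/

/-- `∫₀¹ (g')²`. -/
def dirichletEnergy (g : ℝ → ℝ) : ℝ≥0∞ :=
  ∫⁻ t in Icc (0 : ℝ) 1, ENNReal.ofReal (deriv g t ^ 2)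

/-- The continuous function `g` belongs to `H¹[0,1]`: it is absolutely continuous on `[0,1]` with
square integrable derivative. -/
def IsH1 (g : ℝ → ℝ) : Prop :=
  AbsolutelyContinuousOnInterval g 0 1 ∧ dirichletEnergy g < ∞

/-- `𝒟_ρ(u)`, the sum over the connecting lines of their Dirichlet energies divided by `ρ`. -/
def lineForm (S : SelfSimilarSet d N) (α : ℝ)
    (b : EuclideanSpace ℝ (Fin d) → EuclideanSpace ℝ (Fin d))
    (ρ : Fin N × EuclideanSpace ℝ (Fin d) → ℝ) (u : EuclideanSpace ℝ (Fin d) → ℝ) : ℝ≥0∞ :=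
  ∑' l : S.lines, (ENNReal.ofReal (ρ l))⁻¹ * dirichletEnergy (u ∘ S.lineCurve α b l)

/-- `∑_{w ∈ 𝒜ⁿ} Φ(u ∘ G_w)`. -/
def cellSum (S : SelfSimilarSet d N) (α : ℝ) (n : ℕ)
    (Φ : (EuclideanSpace ℝ (Fin d) → ℝ) → ℝ≥0∞) (u : EuclideanSpace ℝ (Fin d) → ℝ) : ℝ≥0∞ :=
  ∑ w : Fin n → Fin N, Φ (u ∘ wordMap (S.stretch α) (List.ofFn w))

/-- `δₙ = λ₁ ⋯ λₙ`. -/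
def scale (lam : ℕ → ℝ) (n : ℕ) : ℝ := ∏ k ∈ Finset.range n, lam k

/-- `ℰ_{ℛ,n}(u)`, the sum of the fractal part `δₙ⁻¹ ∑_{|w| = n} Q^Σ_{r₀}(u ∘ G_w)` and of the line
part `∑_{k < n} δ_k⁻¹ ∑_{|w| = k} 𝒟_{ρ^{k+1}}(u ∘ G_w)`. -/
def approxEnergy (S : SelfSimilarSet d N) (α : ℝ)
    (b : EuclideanSpace ℝ (Fin d) → EuclideanSpace ℝ (Fin d))
    (r₀ : Sym2 (EuclideanSpace ℝ (Fin d)) → ℝ≥0∞) (lam : ℕ → ℝ)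
    (ρ : ℕ → Fin N × EuclideanSpace ℝ (Fin d) → ℝ) (n : ℕ)
    (u : EuclideanSpace ℝ (Fin d) → ℝ) : ℝ≥0∞ :=
  (ENNReal.ofReal (scale lam n))⁻¹ * S.cellSum α n (S.cellForm b r₀) u +
    ∑ k ∈ Finset.range n,
      (ENNReal.ofReal (scale lam k))⁻¹ * S.cellSum α k (S.lineForm α b (ρ k)) u

/-- `ℰ_ℛ(u) = lim ℰ_{ℛ,n}(u)`. -/
def energy (S : SelfSimilarSet d N) (α : ℝ)
    (b : EuclideanSpace ℝ (Fin d) → EuclideanSpace ℝ (Fin d))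
    (r₀ : Sym2 (EuclideanSpace ℝ (Fin d)) → ℝ≥0∞) (lam : ℕ → ℝ)
    (ρ : ℕ → Fin N × EuclideanSpace ℝ (Fin d) → ℝ)
    (u : EuclideanSpace ℝ (Fin d) → ℝ) : ℝ≥0∞ :=
  limUnder atTop fun n => S.approxEnergy α b r₀ lam ρ n u

/-- The domain `ℱ_ℛ`: the continuous functions on `K` that belong to `H¹` on each line
`e^w_{c,l} = G_w(e_{c,l})` and have finite limit energy. (Only the values on `K` matter: a function
on `K` is represented by any of its extensions to `ℝ^d`.) -/
def domain (S : SelfSimilarSet d N) (α : ℝ)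
    (b : EuclideanSpace ℝ (Fin d) → EuclideanSpace ℝ (Fin d))
    (K : Set (EuclideanSpace ℝ (Fin d)))
    (r₀ : Sym2 (EuclideanSpace ℝ (Fin d)) → ℝ≥0∞) (lam : ℕ → ℝ)
    (ρ : ℕ → Fin N × EuclideanSpace ℝ (Fin d) → ℝ) : Set (EuclideanSpace ℝ (Fin d) → ℝ) :=
  {u | ContinuousOn u K ∧
    (∀ l ∈ S.lines, ∀ w : List (Fin N),
      IsH1 (u ∘ wordMap (S.stretch α) w ∘ S.lineCurve α b l)) ∧
    ∃ a < ∞, Tendsto (fun n => S.approxEnergy α b r₀ lam ρ n u) atTop (𝓝 a)}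

/-- The domain `𝒟⁰_ℛ` of the form with zero boundary values on `V₀`. -/
def domain₀ (S : SelfSimilarSet d N) (α : ℝ)
    (b : EuclideanSpace ℝ (Fin d) → EuclideanSpace ℝ (Fin d))
    (K : Set (EuclideanSpace ℝ (Fin d)))
    (r₀ : Sym2 (EuclideanSpace ℝ (Fin d)) → ℝ≥0∞) (lam : ℕ → ℝ)
    (ρ : ℕ → Fin N × EuclideanSpace ℝ (Fin d) → ℝ) : Set (EuclideanSpace ℝ (Fin d) → ℝ) :=
  {u | u ∈ S.domain α b K r₀ lam ρ ∧ ∀ x ∈ S.vertices b, u x = 0}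

/-- The bilinear form `ℰ_ℛ(u, v)`, by polarization. -/
def energyForm (S : SelfSimilarSet d N) (α : ℝ)
    (b : EuclideanSpace ℝ (Fin d) → EuclideanSpace ℝ (Fin d))
    (r₀ : Sym2 (EuclideanSpace ℝ (Fin d)) → ℝ≥0∞) (lam : ℕ → ℝ)
    (ρ : ℕ → Fin N × EuclideanSpace ℝ (Fin d) → ℝ)
    (u v : EuclideanSpace ℝ (Fin d) → ℝ) : ℝ :=
  ((S.energy α b r₀ lam ρ (u + v)).toReal - (S.energy α b r₀ lam ρ (u - v)).toReal) / 4

/-! ### Measures -/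

/-- The normalized self-similar measure `μ_Σ` with equal weights `1/N`. -/
structure IsFractalMeasure (S : SelfSimilarSet d N) (α : ℝ)
    (ν : Measure (EuclideanSpace ℝ (Fin d))) : Prop where
  prob : IsProbabilityMeasure ν
  selfSimilar : ν = ∑ i, (N : ℝ≥0∞)⁻¹ • ν.map (S.stretch α i)

/-- The line measure `μ_I`: on each line `e^w_{c,l} = G_w(e_{c,l})` it is the normalized
one-dimensional Lebesgue measure (the image of Lebesgue measure on `[0,1]` under the affine
parametrization) times `β^{|w|} a_{c,l}`. -/
def lineMeasure (S : SelfSimilarSet d N) (α : ℝ)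
    (b : EuclideanSpace ℝ (Fin d) → EuclideanSpace ℝ (Fin d))
    (β : ℝ) (a : Fin N × EuclideanSpace ℝ (Fin d) → ℝ) : Measure (EuclideanSpace ℝ (Fin d)) :=
  Measure.sum fun p : List (Fin N) × S.lines =>
    ENNReal.ofReal (β ^ p.1.length * a p.2) •
      (volume.restrict (Icc (0 : ℝ) 1)).map (wordMap (S.stretch α) p.1 ∘ S.lineCurve α b p.2)

/-- Admissible weights for the line measure: `a_{c,l} > 0`, `0 < β < 1/N`, and
`∑ a_{c,l} = 1 - β N`, so that the line measure has total mass `1`. -/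
structure IsLineWeight (S : SelfSimilarSet d N) (β : ℝ)
    (a : Fin N × EuclideanSpace ℝ (Fin d) → ℝ) : Prop where
  β_pos : 0 < β
  β_lt : β < 1 / (N : ℝ)
  a_pos : ∀ l ∈ S.lines, 0 < a l
  sum_a : ∑' l : S.lines, ENNReal.ofReal (a l) = ENNReal.ofReal (1 - β * N)

/-- `μ_η = η μ_I + (1 - η) μ_Σ`. -/
def mixedMeasure (S : SelfSimilarSet d N) (α : ℝ)
    (b : EuclideanSpace ℝ (Fin d) → EuclideanSpace ℝ (Fin d))
    (β : ℝ) (a : Fin N × EuclideanSpace ℝ (Fin d) → ℝ)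
    (ν : Measure (EuclideanSpace ℝ (Fin d))) (η : ℝ) : Measure (EuclideanSpace ℝ (Fin d)) :=
  ENNReal.ofReal η • S.lineMeasure α b β a + ENNReal.ofReal (1 - η) • ν

end SelfSimilarSet

end StretchedFractal

end

/-! The approximating energies increase with the level. The trace condition bounds `Q(u)` by the
energy of `u` on the first network, and Cauchy-Schwarz bounds `(u(c) - u(z))²` by the Dirichlet
energy of the line. The recursion `approxEnergy_succ`, which trades a sequence of harmonic
structures for its shift, carries this to all levels (`approxEnergy_le_succ`). Hence the limit
exists in `[0, ∞]` for every continuous function that is `H¹` on the lines, and identities and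
inequalities of the approximations pass to it.

The decisive estimate is `(u(x) - u(y))² ≤ C ℰ(u)` on `K` (`exists_osc_bound`). Since `F` is
connected, the 1-cells are chained through critical points, so the first network has bounded
resistances, with a bound that serves all structures of the sequence. A 1-cell carries at most `λ*
ℰ(u)` for its own energy, so the contributions of successive levels decay like powers of `√λ*` and
can be summed; continuity of `u` disposes of the remainder. Consequently a Cauchy sequence for `ℰ₁`
converges uniformly on `K`. The limit stays in the domain because each approximating energy passes
to the limit along the sequence and the energy is their supremum (`domain_complete`).

If `φ` and `id - φ` are both monotone, the increments of `φ ∘ u` and `u - φ ∘ u` have the same sign,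
so `ℰ(φ ∘ u) + ℰ(u - φ ∘ u) ≤ ℰ(u)`. With the unit contraction this is the Markov property. With
truncation to `[-δ, δ]` it gives the core: `u - clamp δ ∘ u` vanishes where `|u| ≤ δ`, so it has
compact support off `V₀` when `u` vanishes there, and the energy of the discarded part tends to zero
with `δ` (`tendsto_energy_sub_clamp`).

Uniform density in `C(K)` comes from functions constant on all `n`-cells and `C¹` on the lines
outside them: their approximating energies are stationary from level `n` on, and the separation of
the pieces permits the gluing (`exists_glue`). Full support holds because the lines are dense in `K`
and `η > 0`. These facts are collected in `IsResistanceEnergy`, from which both assertions follow by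
one argument for a closed set `Z ⊆ K` of zeros, with `Z = ∅` and `Z = V₀`. -/

noncomputable section

namespace StretchedFractal

/-! ### Quadratic functionals on a subspace -/

/-- `q` is a quadratic form on the subspace `V`, expressed through equations that are linear
in `q`. -/
structure IsQuadOn {E : Type*} [AddCommGroup E] [Module ℝ E] (V : Submodule ℝ E) (q : E → ℝ) :
    Prop where
  neg : ∀ u ∈ V, q (-u) = q u
  double : ∀ u ∈ V, q (u + u) = 4 * q u
  add : ∀ u ∈ V, ∀ v ∈ V, ∀ w ∈ V,
    q (u + v + w) - q (u + v - w) = (q (u + w) - q (u - w)) + (q (v + w) - q (v - w))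
  smul : ∀ c : ℝ, ∀ u ∈ V, ∀ w ∈ V, q (c • u + w) - q (c • u - w) = c * (q (u + w) - q (u - w))

namespace IsQuadOn

variable {E E' : Type*} [AddCommGroup E] [Module ℝ E] [AddCommGroup E'] [Module ℝ E']
  {V : Submodule ℝ E} {V' : Submodule ℝ E'} {q q' : E → ℝ}

theorem map_zero (h : IsQuadOn V q) : q 0 = 0 := by
  have := h.double 0 V.zero_mem
  rw [add_zero] at this
  linarith

theorem sum_add {p : E → ℝ} (h : IsQuadOn V q) (h' : IsQuadOn V p) :
    IsQuadOn V (fun u => q u + p u) where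
  neg u hu := by rw [h.neg u hu, h'.neg u hu]
  double u hu := by rw [h.double u hu, h'.double u hu]; ring
  add u hu v hv w hw := by linarith [h.add u hu v hv w hw, h'.add u hu v hv w hw]
  smul c u hu w hw := by linarith [h.smul c u hu w hw, h'.smul c u hu w hw]

theorem const_mul (h : IsQuadOn V q) (a : ℝ) : IsQuadOn V (fun u => a * q u) where
  neg u hu := by rw [h.neg u hu]
  double u hu := by rw [h.double u hu]; ring
  add u hu v hv w hw := by
    have := h.add u hu v hv w hw
    rw [← mul_sub, ← mul_sub, ← mul_sub, ← mul_add, this]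
  smul c u hu w hw := by
    have := h.smul c u hu w hw
    rw [← mul_sub, ← mul_sub, this]; ring

theorem zero : IsQuadOn V (fun _ => 0) := by
  constructor <;> intros <;> simp

theorem finset_sum {ι : Type*} (s : Finset ι) {p : ι → E → ℝ} (h : ∀ i ∈ s, IsQuadOn V (p i)) :
    IsQuadOn V (fun u => ∑ i ∈ s, p i u) := by
  classical
  induction s using Finset.induction_on with
  | empty => simpa using zero
  | insert a s ha ih =>
    have h1 := (h a (Finset.mem_insert_self a s)).sum_add
      (ih fun i hi => h i (Finset.mem_insert_of_mem hi))
    simpa only [Finset.sum_insert ha] using h1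

theorem comp {p : E' → ℝ} (h : IsQuadOn V' p) (A : E →ₗ[ℝ] E') (hA : ∀ u ∈ V, A u ∈ V') :
    IsQuadOn V (fun u => p (A u)) where
  neg u hu := by rw [map_neg, h.neg _ (hA u hu)]
  double u hu := by rw [map_add, h.double _ (hA u hu)]
  add u hu v hv w hw := by
    simpa only [map_add, map_sub] using h.add _ (hA u hu) _ (hA v hv) _ (hA w hw)
  smul c u hu w hw := by
    simpa only [map_add, map_sub, map_smul] using h.smul c _ (hA u hu) _ (hA w hw)

theorem congr (h : IsQuadOn V q) (hq : ∀ u ∈ V, q' u = q u) : IsQuadOn V q' where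
  neg u hu := by rw [hq _ (V.neg_mem hu), hq _ hu, h.neg u hu]
  double u hu := by rw [hq _ (V.add_mem hu hu), hq _ hu, h.double u hu]
  add u hu v hv w hw := by
    rw [hq _ (V.add_mem (V.add_mem hu hv) hw), hq _ (V.sub_mem (V.add_mem hu hv) hw),
      hq _ (V.add_mem hu hw), hq _ (V.sub_mem hu hw), hq _ (V.add_mem hv hw),
      hq _ (V.sub_mem hv hw), h.add u hu v hv w hw]
  smul c u hu w hw := by
    rw [hq _ (V.add_mem (V.smul_mem c hu) hw), hq _ (V.sub_mem (V.smul_mem c hu) hw),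
      hq _ (V.add_mem hu hw), hq _ (V.sub_mem hu hw), h.smul c u hu w hw]

theorem mono (h : IsQuadOn V q) {W : Submodule ℝ E} (hW : W ≤ V) : IsQuadOn W q where
  neg u hu := h.neg u (hW hu)
  double u hu := h.double u (hW hu)
  add u hu v hv w hw := h.add u (hW hu) v (hW hv) w (hW hw)
  smul c u hu w hw := h.smul c u (hW hu) w (hW hw)

/-- Every defining equation is linear in the functional, so it survives pointwise limits. This is
what transfers bilinearity from the approximating energies to their limit. -/
theorem of_tendsto {p : ℕ → E → ℝ} (h : ∀ n, IsQuadOn V (p n))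
    (hq : ∀ u ∈ V, Tendsto (fun n => p n u) atTop (𝓝 (q u))) : IsQuadOn V q where
  neg u hu := tendsto_nhds_unique (hq _ (V.neg_mem hu))
    (by simpa only [(h _).neg u hu] using hq u hu)
  double u hu := tendsto_nhds_unique (hq _ (V.add_mem hu hu))
    (by simpa only [(h _).double u hu] using (hq u hu).const_mul 4)
  add u hu v hv w hw := by
    refine tendsto_nhds_unique ((hq _ (V.add_mem (V.add_mem hu hv) hw)).sub
      (hq _ (V.sub_mem (V.add_mem hu hv) hw))) ?_
    simp only [(h _).add u hu v hv w hw]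
    exact ((hq _ (V.add_mem hu hw)).sub (hq _ (V.sub_mem hu hw))).add
      ((hq _ (V.add_mem hv hw)).sub (hq _ (V.sub_mem hv hw)))
  smul c u hu w hw := by
    refine tendsto_nhds_unique ((hq _ (V.add_mem (V.smul_mem c hu) hw)).sub
      (hq _ (V.sub_mem (V.smul_mem c hu) hw))) ?_
    simp only [(h _).smul c u hu w hw]
    exact ((hq _ (V.add_mem hu hw)).sub (hq _ (V.sub_mem hu hw))).const_mul c

theorem of_norm_sq {H : Type*} [NormedAddCommGroup H] [InnerProductSpace ℝ H] (T : V →ₗ[ℝ] H)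
    (hT : ∀ u (hu : u ∈ V), q u = ‖T ⟨u, hu⟩‖ ^ 2) : IsQuadOn V q where
  neg u hu := by
    have e : T ⟨-u, V.neg_mem hu⟩ = -T ⟨u, hu⟩ := by rw [← map_neg]; rfl
    rw [hT _ (V.neg_mem hu), hT _ hu, e, norm_neg]
  double u hu := by
    have e : T ⟨u + u, V.add_mem hu hu⟩ = (2 : ℝ) • T ⟨u, hu⟩ := by
      rw [two_smul, ← map_add]; rfl
    rw [hT _ (V.add_mem hu hu), hT _ hu, e, norm_smul, mul_pow]
    norm_num
  add u hu v hv w hw := by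
    have e1 : T ⟨u + v + w, V.add_mem (V.add_mem hu hv) hw⟩
        = T ⟨u, hu⟩ + T ⟨v, hv⟩ + T ⟨w, hw⟩ := by rw [← map_add, ← map_add]; rfl
    have e2 : T ⟨u + v - w, V.sub_mem (V.add_mem hu hv) hw⟩
        = T ⟨u, hu⟩ + T ⟨v, hv⟩ - T ⟨w, hw⟩ := by rw [← map_add, ← map_sub]; rfl
    have e3 : T ⟨u + w, V.add_mem hu hw⟩ = T ⟨u, hu⟩ + T ⟨w, hw⟩ := by rw [← map_add]; rfl
    have e4 : T ⟨u - w, V.sub_mem hu hw⟩ = T ⟨u, hu⟩ - T ⟨w, hw⟩ := by rw [← map_sub]; rfl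
    have e5 : T ⟨v + w, V.add_mem hv hw⟩ = T ⟨v, hv⟩ + T ⟨w, hw⟩ := by rw [← map_add]; rfl
    have e6 : T ⟨v - w, V.sub_mem hv hw⟩ = T ⟨v, hv⟩ - T ⟨w, hw⟩ := by rw [← map_sub]; rfl
    rw [hT _ (V.add_mem (V.add_mem hu hv) hw), hT _ (V.sub_mem (V.add_mem hu hv) hw),
      hT _ (V.add_mem hu hw), hT _ (V.sub_mem hu hw), hT _ (V.add_mem hv hw),
      hT _ (V.sub_mem hv hw), e1, e2, e3, e4, e5, e6]
    simp only [norm_add_sq_real, norm_sub_sq_real, inner_add_left]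
    ring
  smul c u hu w hw := by
    have e1 : T ⟨c • u + w, V.add_mem (V.smul_mem c hu) hw⟩ = c • T ⟨u, hu⟩ + T ⟨w, hw⟩ := by
      rw [← map_smul, ← map_add]; rfl
    have e2 : T ⟨c • u - w, V.sub_mem (V.smul_mem c hu) hw⟩ = c • T ⟨u, hu⟩ - T ⟨w, hw⟩ := by
      rw [← map_smul, ← map_sub]; rfl
    have e3 : T ⟨u + w, V.add_mem hu hw⟩ = T ⟨u, hu⟩ + T ⟨w, hw⟩ := by rw [← map_add]; rfl
    have e4 : T ⟨u - w, V.sub_mem hu hw⟩ = T ⟨u, hu⟩ - T ⟨w, hw⟩ := by rw [← map_sub]; rfl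
    rw [hT _ (V.add_mem (V.smul_mem c hu) hw), hT _ (V.sub_mem (V.smul_mem c hu) hw),
      hT _ (V.add_mem hu hw), hT _ (V.sub_mem hu hw), e1, e2, e3, e4]
    simp only [norm_add_sq_real, norm_sub_sq_real, inner_smul_left]
    simp only [conj_trivial]
    ring

theorem of_sq (L : E →ₗ[ℝ] ℝ) : IsQuadOn V (fun u => L u ^ 2) where
  neg u _ := by simp
  double u _ := by simp only [map_add]; ring
  add u _ v _ w _ := by simp only [map_add, map_sub]; ring
  smul c u _ w _ := by simp only [map_add, map_sub, map_smul, smul_eq_mul]; ring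

/-- The polarization of a quadratic form. -/
def polar (q : E → ℝ) (u v : E) : ℝ := (q (u + v) - q (u - v)) / 4

theorem polar_self (h : IsQuadOn V q) {u : E} (hu : u ∈ V) : polar q u u = q u := by
  rw [polar, sub_self, h.map_zero, h.double u hu]; ring

theorem polar_comm (h : IsQuadOn V q) {u v : E} (hu : u ∈ V) (hv : v ∈ V) :
    polar q u v = polar q v u := by
  rw [polar, polar, add_comm, ← neg_sub v u, h.neg _ (V.sub_mem hv hu)]

theorem polar_add (h : IsQuadOn V q) {u v w : E} (hu : u ∈ V) (hv : v ∈ V) (hw : w ∈ V) :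
    polar q (u + v) w = polar q u w + polar q v w := by
  rw [polar, h.add u hu v hv w hw, polar, polar]; ring

theorem polar_smul (h : IsQuadOn V q) (c : ℝ) {u w : E} (hu : u ∈ V) (hw : w ∈ V) :
    polar q (c • u) w = c * polar q u w := by
  rw [polar, h.smul c u hu w hw, polar]; ring

theorem map_smul_sq (h : IsQuadOn V q) (c : ℝ) {u : E} (hu : u ∈ V) :
    q (c • u) = c ^ 2 * q u := by
  have hc := V.smul_mem c hu
  rw [← h.polar_self hc, h.polar_smul c hu hc, h.polar_comm hu hc, h.polar_smul c hu hu,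
    h.polar_self hu]
  ring

theorem map_add_eq (h : IsQuadOn V q) {u v : E} (hu : u ∈ V) (hv : v ∈ V) :
    q (u + v) = q u + q v + 2 * polar q u v := by
  have huv := V.add_mem hu hv
  rw [← h.polar_self huv, h.polar_add hu hv huv, h.polar_comm hu huv, h.polar_comm hv huv,
    h.polar_add hu hv hu, h.polar_add hu hv hv, h.polar_comm hv hu, h.polar_self hu,
    h.polar_self hv]
  ring

theorem map_sub_eq (h : IsQuadOn V q) {u v : E} (hu : u ∈ V) (hv : v ∈ V) :
    q (u - v) = q u + q v - 2 * polar q u v := by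
  have h1 := h.map_add_eq hu hv
  have h2 : 4 * polar q u v = q (u + v) - q (u - v) := by rw [polar]; ring
  linarith

/-- Parallelogram law with the non-negative term `q (u - v)` dropped. -/
theorem map_add_le (h : IsQuadOn V q) (h0 : ∀ u ∈ V, 0 ≤ q u) {u v : E} (hu : u ∈ V)
    (hv : v ∈ V) : q (u + v) ≤ 2 * q u + 2 * q v := by
  linarith [h.map_add_eq hu hv, h.map_sub_eq hu hv, h0 _ (V.sub_mem hu hv)]

end IsQuadOn

namespace SelfSimilarSet

/-! ### Functions on the unit interval with finite Dirichlet energy -/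

/-- Lebesgue measure on the unit interval. -/
abbrev unitVolume : Measure ℝ := volume.restrict (Icc (0 : ℝ) 1)

theorem uIcc_zero_one : uIcc (0 : ℝ) 1 = Icc 0 1 := uIcc_of_le zero_le_one

/-- The two-sided derivative at 0 and 1 depends on values outside the interval; discarding these two
points makes the Dirichlet energy a function of the restriction to `[0,1]`. -/
theorem ae_unitVolume_mem_Ioo : ∀ᵐ t ∂unitVolume, t ∈ Ioo (0 : ℝ) 1 := by
  have h : ∀ᵐ t ∂(volume.restrict (Ioo (0 : ℝ) 1)), t ∈ Ioo (0 : ℝ) 1 :=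
    ae_restrict_mem measurableSet_Ioo
  rwa [Measure.restrict_congr_set Ioo_ae_eq_Icc] at h

theorem deriv_eq_of_eqOn_Icc {f g : ℝ → ℝ} (h : EqOn f g (Icc 0 1)) {t : ℝ}
    (ht : t ∈ Ioo (0 : ℝ) 1) : deriv f t = deriv g t := by
  apply Filter.EventuallyEq.deriv_eq
  filter_upwards [Icc_mem_nhds ht.1 ht.2] with s hs using h hs

theorem dirichletEnergy_congr {f g : ℝ → ℝ} (h : EqOn f g (Icc 0 1)) :
    dirichletEnergy f = dirichletEnergy g := by
  apply lintegral_congr_ae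
  filter_upwards [ae_unitVolume_mem_Ioo] with t ht
  rw [deriv_eq_of_eqOn_Icc h ht]

theorem absolutelyContinuousOnInterval_congr {f g : ℝ → ℝ} (h : EqOn f g (Icc 0 1))
    (hf : AbsolutelyContinuousOnInterval f 0 1) : AbsolutelyContinuousOnInterval g 0 1 := by
  rw [absolutelyContinuousOnInterval_iff] at hf ⊢
  intro ε hε
  obtain ⟨δ, hδ, H⟩ := hf ε hε
  refine ⟨δ, hδ, fun E hE hs => ?_⟩
  convert H E hE hs using 1
  refine Finset.sum_congr rfl fun i hi => ?_
  have := hE.1 i hi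
  rw [uIcc_zero_one] at this
  rw [h this.1, h this.2]

theorem IsH1.congr {f g : ℝ → ℝ} (hf : IsH1 f) (h : EqOn f g (Icc 0 1)) : IsH1 g :=
  ⟨absolutelyContinuousOnInterval_congr h hf.1, dirichletEnergy_congr h ▸ hf.2⟩

theorem IsH1.ae_differentiableAt {f : ℝ → ℝ} (hf : IsH1 f) :
    ∀ᵐ t ∂unitVolume, DifferentiableAt ℝ f t := by
  have := hf.1.ae_differentiableAt
  rw [uIcc_zero_one] at this
  exact (ae_restrict_iff' measurableSet_Icc).2 this

theorem dirichletEnergy_eq_enorm (f : ℝ → ℝ) :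
    dirichletEnergy f = eLpNorm (deriv f) 2 unitVolume ^ 2 := by
  have h2 : (2 : ℝ≥0∞) = ((2 : NNReal) : ℝ≥0∞) := rfl
  have h := eLpNorm_nnreal_pow_eq_lintegral (f := deriv f) (μ := unitVolume) (p := 2) two_ne_zero
  have h' : eLpNorm (deriv f) 2 unitVolume ^ 2 = ∫⁻ t, ‖deriv f t‖ₑ ^ (2 : ℝ) ∂unitVolume := by
    rw [h2, ← ENNReal.rpow_natCast]
    exact h
  rw [h', dirichletEnergy]
  refine lintegral_congr fun t => ?_
  rw [← sq_abs, ENNReal.ofReal_pow (abs_nonneg _), ← Real.enorm_eq_ofReal_abs]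
  norm_cast

theorem IsH1.memLp {f : ℝ → ℝ} (hf : IsH1 f) : MemLp (deriv f) 2 unitVolume := by
  refine ⟨(measurable_deriv f).aestronglyMeasurable, ?_⟩
  have := hf.2
  rw [dirichletEnergy_eq_enorm] at this
  by_contra h
  rw [not_lt, top_le_iff] at h
  simp [h] at this

theorem isH1_of_memLp {f : ℝ → ℝ} (hf : AbsolutelyContinuousOnInterval f 0 1)
    (h : MemLp (deriv f) 2 unitVolume) : IsH1 f := by
  refine ⟨hf, ?_⟩
  rw [dirichletEnergy_eq_enorm]
  exact ENNReal.pow_lt_top h.2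

theorem IsH1.ae_deriv_add {f g : ℝ → ℝ} (hf : IsH1 f) (hg : IsH1 g) :
    deriv (f + g) =ᵐ[unitVolume] deriv f + deriv g := by
  filter_upwards [hf.ae_differentiableAt, hg.ae_differentiableAt] with t h1 h2
  exact deriv_add h1 h2

theorem ae_deriv_smul (c : ℝ) (f : ℝ → ℝ) : deriv (c • f) = c • deriv f := by
  ext t
  exact deriv_const_mul_field c

theorem IsH1.add {f g : ℝ → ℝ} (hf : IsH1 f) (hg : IsH1 g) : IsH1 (f + g) :=
  isH1_of_memLp (hf.1.add hg.1) ((hf.memLp.add hg.memLp).ae_eq (hf.ae_deriv_add hg).symm)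

theorem IsH1.smul (c : ℝ) {f : ℝ → ℝ} (hf : IsH1 f) : IsH1 (c • f) :=
  isH1_of_memLp (hf.1.const_smul c) (by rw [ae_deriv_smul]; exact hf.memLp.const_smul c)

theorem isH1_of_contDiff {f : ℝ → ℝ} (hf : ContDiff ℝ 1 f) : IsH1 f := by
  refine isH1_of_memLp (ContDiffOn.absolutelyContinuousOnInterval hf.contDiffOn) ?_
  have hc : Continuous (deriv f) := hf.continuous_deriv le_rfl
  obtain ⟨C, hC⟩ := isCompact_Icc.exists_bound_of_continuousOn (s := Icc (0 : ℝ) 1) hc.continuousOn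
  exact MemLp.of_bound hc.aestronglyMeasurable C
    ((ae_restrict_iff' measurableSet_Icc).2 (Eventually.of_forall hC))

/-- The space of functions that belong to `H¹[0,1]`. -/
def h1Space : Submodule ℝ (ℝ → ℝ) where
  carrier := {f | IsH1 f}
  add_mem' := IsH1.add
  zero_mem' := isH1_of_contDiff contDiff_const
  smul_mem' c _ hf := IsH1.smul c hf

/-- The derivative as an element of `L²[0,1]`. -/
def derivLp : h1Space →ₗ[ℝ] Lp ℝ 2 unitVolume where
  toFun f := (IsH1.memLp f.2).toLp
  map_add' f g := by
    rw [← MemLp.toLp_add]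
    exact MemLp.toLp_congr _ _ (IsH1.ae_deriv_add f.2 g.2)
  map_smul' c f := by
    rw [RingHom.id_apply, ← MemLp.toLp_const_smul]
    exact MemLp.toLp_congr _ _ (by
      change deriv (c • (f : ℝ → ℝ)) =ᵐ[_] _
      rw [ae_deriv_smul])

theorem dirichletEnergy_toReal {f : ℝ → ℝ} (hf : f ∈ h1Space) :
    (dirichletEnergy f).toReal = ‖derivLp ⟨f, hf⟩‖ ^ 2 := by
  rw [dirichletEnergy_eq_enorm, ENNReal.toReal_pow]
  congr 1
  exact (Lp.norm_toLp _ (IsH1.memLp hf)).symm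

theorem isQuadOn_dirichletEnergy : IsQuadOn h1Space fun f => (dirichletEnergy f).toReal :=
  .of_norm_sq derivLp fun _ hf => dirichletEnergy_toReal hf

theorem IsH1.sub {f g : ℝ → ℝ} (hf : IsH1 f) (hg : IsH1 g) : IsH1 (f - g) :=
  h1Space.sub_mem hf hg

theorem IsH1.sub_eq_integral {f : ℝ → ℝ} (hf : IsH1 f) {s t : ℝ} (hs : s ∈ Icc (0 : ℝ) 1)
    (ht : t ∈ Icc (0 : ℝ) 1) : f t - f s = ∫ x in s..t, deriv f x := by
  refine ((hf.1.mono ?_).integral_deriv_eq_sub).symm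
  rw [uIcc_zero_one]
  exact uIcc_subset_Icc hs ht

/-- The integral against `1_{(s,t]}` is bounded by the `L²`-norm. -/
theorem abs_intervalIntegral_le_norm {h : ℝ → ℝ} (hh : MemLp h 2 unitVolume) {s t : ℝ}
    (hs : s ∈ Icc (0 : ℝ) 1) (ht : t ∈ Icc (0 : ℝ) 1) :
    |∫ x in s..t, h x| ≤ (eLpNorm h 2 unitVolume).toReal := by
  have hsub : uIoc s t ⊆ Icc 0 1 := uIoc_subset_uIcc.trans (uIcc_subset_Icc hs ht)
  have h1 : Integrable h unitVolume := hh.integrable (by norm_num)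
  -- On a probability space the `L¹`-norm is at most the `L²`-norm.
  have hvol : IsProbabilityMeasure unitVolume := ⟨by simp⟩
  calc |∫ x in s..t, h x| ≤ ∫ x in uIoc s t, |h x| :=
        (Real.norm_eq_abs _).symm.trans_le intervalIntegral.norm_integral_le_integral_norm_uIoc
    _ ≤ ∫ x in Icc 0 1, |h x| :=
        setIntegral_mono_set h1.abs (Eventually.of_forall fun _ => abs_nonneg _)
          (Eventually.of_forall hsub)
    _ = (eLpNorm h 1 unitVolume).toReal := by
        rw [eLpNorm_one_eq_lintegral_enorm]
        exact integral_norm_eq_lintegral_enorm h1.1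
    _ ≤ (eLpNorm h 2 unitVolume).toReal :=
        ENNReal.toReal_mono hh.2.ne
          (eLpNorm_le_eLpNorm_of_exponent_le one_le_two hh.1)

/-- The fundamental theorem of calculus and Cauchy-Schwarz: the unit interval has resistance 1. This
compares a line with the corresponding edge of the network. -/
theorem IsH1.sq_sub_le {f : ℝ → ℝ} (hf : IsH1 f) {s t : ℝ} (hs : s ∈ Icc (0 : ℝ) 1)
    (ht : t ∈ Icc (0 : ℝ) 1) : ENNReal.ofReal ((f t - f s) ^ 2) ≤ dirichletEnergy f := by
  rw [hf.sub_eq_integral hs ht, dirichletEnergy_eq_enorm, ← sq_abs]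
  refine ENNReal.ofReal_le_of_le_toReal ?_
  rw [ENNReal.toReal_pow]
  gcongr
  exact abs_intervalIntegral_le_norm hf.memLp hs ht

/-- A normal contraction that is monotone together with its complement. -/
structure IsMonotoneContraction (φ : ℝ → ℝ) : Prop where
  mono : Monotone φ
  mono_sub : Monotone fun x => x - φ x

namespace IsMonotoneContraction

variable {φ : ℝ → ℝ}

theorem abs_sub_le (h : IsMonotoneContraction φ) (x y : ℝ) : |φ x - φ y| ≤ |x - y| := by
  rcases le_total x y with hxy | hxy
  · have h1 := h.mono hxy
    have h2 := h.mono_sub hxy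
    simp only at h2
    rw [abs_of_nonpos (by linarith), abs_of_nonpos (by linarith)]
    linarith
  · have h1 := h.mono hxy
    have h2 := h.mono_sub hxy
    simp only at h2
    rw [abs_of_nonneg (by linarith), abs_of_nonneg (by linarith)]
    linarith

theorem continuous (h : IsMonotoneContraction φ) : Continuous φ :=
  (LipschitzWith.of_dist_le_mul (K := 1) fun x y => by
    simpa [Real.dist_eq] using h.abs_sub_le x y).continuous

/-- The cross term in the square of an increment, split along `φ` and `id - φ`. Its sign turns a
mere contraction inequality into one that also keeps the energy of the complement. -/
theorem mul_nonneg (h : IsMonotoneContraction φ) (x y : ℝ) :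
    0 ≤ (φ x - φ y) * ((x - φ x) - (y - φ y)) := by
  rcases le_total x y with hxy | hxy
  · have h1 := h.mono hxy
    have h2 := h.mono_sub hxy
    simp only at h2
    exact mul_nonneg_of_nonpos_of_nonpos (by linarith) (by linarith)
  · have h1 := h.mono hxy
    have h2 := h.mono_sub hxy
    simp only at h2
    exact _root_.mul_nonneg (by linarith) (by linarith)

theorem sq_add_sq_le (h : IsMonotoneContraction φ) (x y : ℝ) :
    (φ x - φ y) ^ 2 + ((x - φ x) - (y - φ y)) ^ 2 ≤ (x - y) ^ 2 := by
  nlinarith [h.mul_nonneg x y]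

theorem absolutelyContinuousOnInterval (h : IsMonotoneContraction φ) {f : ℝ → ℝ} {a b : ℝ}
    (hf : AbsolutelyContinuousOnInterval f a b) :
    AbsolutelyContinuousOnInterval (φ ∘ f) a b := by
  rw [absolutelyContinuousOnInterval_iff] at hf ⊢
  intro ε hε
  obtain ⟨δ, hδ, H⟩ := hf ε hε
  refine ⟨δ, hδ, fun E hE hs => lt_of_le_of_lt (Finset.sum_le_sum fun i _ => ?_) (H E hE hs)⟩
  exact h.abs_sub_le _ _

/-- `φ` need not be differentiable, so there is no chain rule; instead the sign of the cross term is
passed to the limit in the difference quotients. -/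
theorem sq_deriv_add_le (h : IsMonotoneContraction φ) {f : ℝ → ℝ} {t : ℝ}
    (hf : DifferentiableAt ℝ f t) (hg : DifferentiableAt ℝ (φ ∘ f) t) :
    deriv (φ ∘ f) t ^ 2 + deriv (f - φ ∘ f) t ^ 2 ≤ deriv f t ^ 2 := by
  have h1 : HasDerivAt (f - φ ∘ f) (deriv f t - deriv (φ ∘ f) t) t :=
    hf.hasDerivAt.sub hg.hasDerivAt
  rw [h1.deriv]
  have h2 := hasDerivAt_iff_tendsto_slope.1 h1
  have h3 := hasDerivAt_iff_tendsto_slope.1 hg.hasDerivAt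
  have h4 : 0 ≤ deriv (φ ∘ f) t * (deriv f t - deriv (φ ∘ f) t) := by
    refine ge_of_tendsto (h3.mul h2) (Eventually.of_forall fun s => ?_)
    simp only [slope_def_field, Function.comp_apply, Pi.sub_apply]
    rw [div_mul_div_comm]
    exact div_nonneg (h.mul_nonneg _ _) (mul_self_nonneg _)
  nlinarith [h4]

theorem dirichletEnergy_add_le (h : IsMonotoneContraction φ) {f : ℝ → ℝ} (hf : IsH1 f) :
    dirichletEnergy (φ ∘ f) + dirichletEnergy (f - φ ∘ f) ≤ dirichletEnergy f := by
  have hac := h.absolutelyContinuousOnInterval hf.1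
  have hd : ∀ᵐ t ∂unitVolume, DifferentiableAt ℝ (φ ∘ f) t := by
    have := hac.ae_differentiableAt
    rw [uIcc_zero_one] at this
    exact (ae_restrict_iff' measurableSet_Icc).2 this
  rw [dirichletEnergy, dirichletEnergy, dirichletEnergy, ← lintegral_add_left (by fun_prop)]
  refine lintegral_mono_ae ?_
  filter_upwards [hf.ae_differentiableAt, hd] with t h1 h2
  rw [← ENNReal.ofReal_add (sq_nonneg _) (sq_nonneg _)]
  exact ENNReal.ofReal_le_ofReal (h.sq_deriv_add_le h1 h2)

theorem isH1 (h : IsMonotoneContraction φ) {f : ℝ → ℝ} (hf : IsH1 f) : IsH1 (φ ∘ f) :=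
  ⟨h.absolutelyContinuousOnInterval hf.1,
    (le_self_add.trans (h.dirichletEnergy_add_le hf)).trans_lt hf.2⟩

end IsMonotoneContraction

/-- No order between `a` and `b` is needed: for `a > b` the map is the constant `b`. -/
theorem isMonotoneContraction_clamp (a b : ℝ) :
    IsMonotoneContraction fun x => min (max x a) b where
  mono x y hxy := by dsimp only; gcongr
  mono_sub x y hxy := by
    dsimp only
    rcases max_cases x a with ⟨h1, _⟩ | ⟨h1, _⟩ <;> rcases max_cases y a with ⟨h2, _⟩ | ⟨h2, _⟩ <;>
    rw [h1, h2] <;>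
    rcases min_cases x b with ⟨h3, _⟩ | ⟨h3, _⟩ <;> rcases min_cases y b with ⟨h4, _⟩ | ⟨h4, _⟩ <;>
    rcases min_cases a b with ⟨h5, _⟩ | ⟨h5, _⟩ <;>
    simp only [h3, h4, h5] <;> linarith

/-- Completeness: pointwise limits of sequences that are Cauchy for the Dirichlet energy. -/
theorem isH1_of_cauchy {g : ℕ → ℝ → ℝ} {f : ℝ → ℝ} (hg : ∀ n, IsH1 (g n))
    (hlim : ∀ t ∈ Icc (0 : ℝ) 1, Tendsto (fun n => g n t) atTop (𝓝 (f t)))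
    (hC : ∀ ε > (0 : ℝ), ∃ M, ∀ m ≥ M, ∀ n ≥ M,
      dirichletEnergy (g m - g n) ≤ ENNReal.ofReal ε) :
    IsH1 f ∧ ∀ k : ℝ → ℝ, IsH1 k →
      Tendsto (fun n => dirichletEnergy (g n - k)) atTop (𝓝 (dirichletEnergy (f - k))) := by
  set T : ℕ → Lp ℝ 2 unitVolume := fun n => derivLp ⟨g n, hg n⟩ with hT
  have hTd : ∀ m n, ‖T m - T n‖ ^ 2 = (dirichletEnergy (g m - g n)).toReal := fun m n => by
    rw [dirichletEnergy_toReal (h1Space.sub_mem (hg m) (hg n)), hT]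
    simp only
    rw [← map_sub]; rfl
  have hcau : CauchySeq T := by
    rw [Metric.cauchySeq_iff]
    intro ε hε
    obtain ⟨M, hM⟩ := hC ((ε / 2) ^ 2) (by positivity)
    refine ⟨M, fun m hm n hn => ?_⟩
    have := ENNReal.toReal_mono ENNReal.ofReal_ne_top (hM m hm n hn)
    rw [← hTd, ENNReal.toReal_ofReal (by positivity)] at this
    have := abs_le_of_sq_le_sq' this (by positivity)
    rw [dist_eq_norm]
    linarith [this.2]
  -- The `L²`-limit of the derivatives is the candidate for the derivative of `f`.
  obtain ⟨h, hh⟩ := cauchySeq_tendsto_of_complete hcau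
  have hmem : MemLp h 2 unitVolume := Lp.memLp h
  have hint : Integrable h unitVolume := hmem.integrable (by norm_num)
  have hII : IntervalIntegrable h volume 0 1 := by
    rw [intervalIntegrable_iff_integrableOn_Icc_of_le zero_le_one]; exact hint
  have hIIs : ∀ t ∈ Icc (0 : ℝ) 1, IntervalIntegrable h volume 0 t := fun t ht =>
    hII.mono_set (by rw [uIcc_zero_one, uIcc_of_le ht.1]; exact Icc_subset_Icc_right ht.2)
  -- The increments of `g n` converge both pointwise and, through their integral representation, to
  -- the integral of `h`.
  have hf : ∀ t ∈ Icc (0 : ℝ) 1, f t = f 0 + ∫ x in (0 : ℝ)..t, h x := by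
    intro t ht
    have h0 : (0 : ℝ) ∈ Icc (0 : ℝ) 1 := ⟨le_rfl, zero_le_one⟩
    have h1 : Tendsto (fun n => g n t - g n 0) atTop (𝓝 (∫ x in (0 : ℝ)..t, h x)) := by
      rw [tendsto_iff_norm_sub_tendsto_zero]
      have h2 : Tendsto (fun n => ‖T n - h‖) atTop (𝓝 0) :=
        tendsto_iff_norm_sub_tendsto_zero.1 hh
      refine squeeze_zero (fun _ => norm_nonneg _) (fun n => ?_) h2
      have hIIn : IntervalIntegrable (deriv (g n)) volume 0 t :=
        (hg n).1.intervalIntegrable_deriv.mono_set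
          (by rw [uIcc_zero_one, uIcc_of_le ht.1]; exact Icc_subset_Icc_right ht.2)
      rw [(hg n).sub_eq_integral h0 ht, ← intervalIntegral.integral_sub hIIn (hIIs t ht),
        Real.norm_eq_abs]
      refine (abs_intervalIntegral_le_norm ((hg n).memLp.sub hmem) h0 ht).trans_eq ?_
      rw [Lp.norm_def]
      congr 1
      refine eLpNorm_congr_ae ?_
      filter_upwards [Lp.coeFn_sub (T n) h, (hg n).memLp.coeFn_toLp] with x hx1 hx2
      rw [hx1, Pi.sub_apply, Pi.sub_apply, ← hx2]
      rfl
    have h3 := tendsto_nhds_unique h1 ((hlim t ht).sub (hlim 0 h0))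
    linarith
  have hac : AbsolutelyContinuousOnInterval f 0 1 := by
    have h1 := hII.absolutelyContinuousOnInterval_intervalIntegral (c := 0) left_mem_uIcc
    have h2 : AbsolutelyContinuousOnInterval (fun _ : ℝ => f 0) 0 1 :=
      (isH1_of_contDiff contDiff_const).1
    exact absolutelyContinuousOnInterval_congr (fun t ht => (hf t ht).symm) (h2.add h1)
  have hderiv : deriv f =ᵐ[unitVolume] h := by
    have h1 := hII.ae_hasDerivAt_integral
    rw [uIcc_zero_one] at h1
    filter_upwards [(ae_restrict_iff' measurableSet_Icc).2 h1, ae_unitVolume_mem_Ioo] with t h2 ht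
    rw [deriv_eq_of_eqOn_Icc (fun t ht => hf t ht) ht]
    exact ((h2 0 ⟨le_rfl, zero_le_one⟩).const_add (f 0)).deriv
  have hfH : IsH1 f := isH1_of_memLp hac (hmem.ae_eq hderiv.symm)
  refine ⟨hfH, fun k hk => ?_⟩
  have hTf : derivLp ⟨f, hfH⟩ = h := by
    rw [← Lp.toLp_coeFn h hmem]
    exact MemLp.toLp_congr hfH.memLp _ hderiv
  -- With energies written as squared `L²`-distances, the asserted convergence is continuity of the
  -- norm.
  have key : ∀ φ (hφ : IsH1 φ), dirichletEnergy (φ - k)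
      = ENNReal.ofReal (‖derivLp ⟨φ, hφ⟩ - derivLp ⟨k, hk⟩‖ ^ 2) := fun φ hφ => by
    rw [← ENNReal.ofReal_toReal (hφ.sub hk).2.ne, dirichletEnergy_toReal (hφ.sub hk), ← map_sub]
    rfl
  simp_rw [fun n => key (g n) (hg n), key f hfH, hTf]
  exact ENNReal.tendsto_ofReal ((hh.sub_const _).norm.pow 2)

/-- Cutting off the values of `f` near `0` does not change much of the Dirichlet energy. -/
theorem tendsto_dirichletEnergy_sub_clamp {f : ℝ → ℝ} (hf : IsH1 f) {ε : ℕ → ℝ}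
    (hε : ∀ n, 0 < ε n) (hlim : Tendsto ε atTop (𝓝 0)) :
    Tendsto (fun n => dirichletEnergy (f - (fun x => min (max x (-ε n)) (ε n)) ∘ f)) atTop
      (𝓝 (dirichletEnergy f)) := by
  have hφ : ∀ n, IsMonotoneContraction fun x => min (max x (-ε n)) (ε n) := fun n =>
    isMonotoneContraction_clamp _ _
  -- The squared derivative of `f` dominates, by the contraction inequality; pointwise convergence
  -- is checked separately on and off the zeros of `f`.
  refine tendsto_lintegral_of_dominated_convergence
    (fun t => ENNReal.ofReal (deriv f t ^ 2)) (fun n => by fun_prop) ?_ hf.2.ne ?_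
  · intro n
    have h1 := ((hφ n).isH1 hf).ae_differentiableAt
    filter_upwards [hf.ae_differentiableAt, h1] with t h2 h3
    refine ENNReal.ofReal_le_ofReal ?_
    linarith [(hφ n).sq_deriv_add_le h2 h3, sq_nonneg (deriv ((fun x => min (max x (-ε n)) (ε n)) ∘ f) t)]
  · have hall : ∀ᵐ t ∂unitVolume, ∀ n,
        DifferentiableAt ℝ ((fun x => min (max x (-ε n)) (ε n)) ∘ f) t :=
      ae_all_iff.2 fun n => ((hφ n).isH1 hf).ae_differentiableAt
    -- Zeros of `f` isolated from the right are countable, hence negligible. At any other zero where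
    -- `f` is differentiable the derivative must vanish.
    have hiso : ∀ᵐ t ∂unitVolume, ¬ (t ∈ {x ∈ {x | f x = 0} | 𝓝[{x | f x = 0} ∩ Ioi x] x = ⊥}) := by
      refine ae_restrict_of_ae ?_
      have := (countable_setOfPred_isolated_right_within (s := {x | f x = 0})).ae_notMem volume
      exact this
    filter_upwards [hf.ae_differentiableAt, hall, hiso] with t hd hda hi
    by_cases h0 : f t = 0
    · have hd0 : deriv f t = 0 := by
        by_contra hne
        apply hi
        refine ⟨h0, ?_⟩
        have h1 := hd.hasDerivAt.eventually_ne (c := 0) hne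
        have h2 : ∀ᶠ z in 𝓝[{x | f x = 0} ∩ Ioi t] t, f z ≠ 0 :=
          h1.filter_mono (nhdsWithin_mono _ fun z hz => (ne_of_gt hz.2 : z ≠ t))
        have h3 : ∀ᶠ z in 𝓝[{x | f x = 0} ∩ Ioi t] t, f z = 0 := by
          filter_upwards [self_mem_nhdsWithin] with z hz using hz.1
        exact Filter.eventually_false_iff_eq_bot.1 (by
          filter_upwards [h2, h3] with z hz hz' using hz hz')
      refine tendsto_const_nhds.congr fun n => ?_
      have h4 := (hφ n).sq_deriv_add_le hd (hda n)
      rw [hd0] at h4 ⊢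
      have h5 : deriv (f - (fun x => min (max x (-ε n)) (ε n)) ∘ f) t ^ 2 = 0 := by
        nlinarith [sq_nonneg (deriv ((fun x => min (max x (-ε n)) (ε n)) ∘ f) t),
          sq_nonneg (deriv (f - (fun x => min (max x (-ε n)) (ε n)) ∘ f) t)]
      rw [h5]; simp
    -- Once `ε n < |f t|`, the truncated function is constant near `t` and the derivative of the
    -- difference equals that of `f`.
    · refine tendsto_const_nhds.congr' ?_
      have hpos : 0 < |f t| := abs_pos.2 h0
      filter_upwards [hlim.eventually (gt_mem_nhds hpos)] with n hn
      congr 2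
      have h6 : ∀ᶠ s in 𝓝 t, ε n < |f s| :=
        hd.continuousAt.abs.eventually (lt_mem_nhds hn)
      have hz : deriv ((fun x => min (max x (-ε n)) (ε n)) ∘ f) t = 0 := by
        rcases lt_or_gt_of_ne h0 with hneg | hpos'
        · have h7 : (fun x => min (max x (-ε n)) (ε n)) ∘ f =ᶠ[𝓝 t] fun _ => -ε n := by
            filter_upwards [h6, hd.continuousAt.eventually (gt_mem_nhds hneg)] with s hs1 hs2
            rw [abs_of_neg hs2] at hs1
            have := hε n
            simp only [Function.comp_apply]
            rw [max_eq_right (by linarith), min_eq_left (by linarith)]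
          rw [h7.deriv_eq, deriv_const]
        · have h7 : (fun x => min (max x (-ε n)) (ε n)) ∘ f =ᶠ[𝓝 t] fun _ => ε n := by
            filter_upwards [h6, hd.continuousAt.eventually (lt_mem_nhds hpos')] with s hs1 hs2
            rw [abs_of_pos hs2] at hs1
            have := hε n
            simp only [Function.comp_apply]
            rw [max_eq_left (by linarith), min_eq_right (by linarith)]
          rw [h7.deriv_eq, deriv_const]
      rw [(hd.hasDerivAt.sub (hda n).hasDerivAt).deriv, hz, sub_zero]

end SelfSimilarSet

/-! ### Regular Dirichlet forms from quadratic forms with a resistance estimate -/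

/-- The truncation of real numbers to `[-δ, δ]`. -/
def clamp (δ : ℝ) (x : ℝ) : ℝ := min (max x (-δ)) δ

theorem isMonotoneContraction_clamp_symm (δ : ℝ) :
    SelfSimilarSet.IsMonotoneContraction (clamp δ) :=
  SelfSimilarSet.isMonotoneContraction_clamp (-δ) δ

theorem abs_clamp_le {δ : ℝ} (hδ : 0 ≤ δ) (x : ℝ) : |clamp δ x| ≤ δ := by
  rw [abs_le, clamp]
  exact ⟨le_min (le_max_right _ _) (by linarith), min_le_right _ _⟩

theorem clamp_of_abs_le {δ x : ℝ} (h : |x| ≤ δ) : clamp δ x = x := by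
  rw [abs_le] at h
  rw [clamp, max_eq_left h.1, min_eq_left h.2]

/-- `q` is a quadratic form on a space `W` of continuous functions on `K` on which monotone
contractions operate, with a resistance estimate, complete, and with `W` uniformly dense. -/
structure IsResistanceEnergy {Y : Type*} [MetricSpace Y] (K : Set Y) (W : Submodule ℝ (Y → ℝ))
    (q : (Y → ℝ) → ℝ) : Prop where
  continuousOn : ∀ u ∈ W, ContinuousOn u K
  congr : ∀ u ∈ W, ∀ v, EqOn u v K → v ∈ W ∧ q v = q u
  quad : IsQuadOn W q
  nonneg : ∀ u ∈ W, 0 ≤ q u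
  contraction : ∀ φ, SelfSimilarSet.IsMonotoneContraction φ → ∀ u ∈ W,
    φ ∘ u ∈ W ∧ q (φ ∘ u) + q (u - φ ∘ u) ≤ q u
  osc : ∃ C : ℝ, 0 ≤ C ∧ ∀ u ∈ W, ∀ x ∈ K, ∀ y ∈ K, (u x - u y) ^ 2 ≤ C * q u
  complete : ∀ u : ℕ → Y → ℝ, (∀ n, u n ∈ W) → ∀ v, TendstoUniformlyOn u v atTop K →
    (∀ ε > (0 : ℝ), ∃ M, ∀ m ≥ M, ∀ n ≥ M, q (u m - u n) < ε) →
    v ∈ W ∧ Tendsto (fun n => q (u n - v)) atTop (𝓝 0)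
  clamp : ∀ u ∈ W, Tendsto (fun n : ℕ => q (u - clamp (1 / ((n : ℝ) + 1)) ∘ u)) atTop (𝓝 (q u))
  dense : ∀ φ, ContinuousOn φ K → ∀ ε > (0 : ℝ), ∃ u ∈ W, ∀ x ∈ K, |u x - φ x| < ε

/-- The elements of `W` that vanish on `Z`. -/
def vanishingOn {Y : Type*} (W : Submodule ℝ (Y → ℝ)) (Z : Set Y) : Submodule ℝ (Y → ℝ) where
  carrier := {u | u ∈ W ∧ ∀ x ∈ Z, u x = 0}
  add_mem' := fun ⟨h1, h2⟩ ⟨h3, h4⟩ =>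
    ⟨W.add_mem h1 h3, fun x hx => by rw [Pi.add_apply, h2 x hx, h4 x hx, add_zero]⟩
  zero_mem' := ⟨W.zero_mem, fun _ _ => rfl⟩
  smul_mem' c _ := fun ⟨h1, h2⟩ =>
    ⟨W.smul_mem c h1, fun x hx => by rw [Pi.smul_apply, h2 x hx, smul_zero]⟩

/-- Restriction to `X` as a map to `L²`. -/
def restrictLp {Y : Type*} [MeasurableSpace Y] {X : Set Y} {m : Measure X}
    {V : Submodule ℝ (Y → ℝ)} (hV : ∀ u ∈ V, MemLp (fun x : X => u x) 2 m) :
    V →ₗ[ℝ] Lp ℝ 2 m where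
  toFun u := (hV u u.2).toLp
  map_add' u v := by rw [← MemLp.toLp_add]; rfl
  map_smul' c u := by rw [RingHom.id_apply, ← MemLp.toLp_const_smul]; rfl

namespace IsResistanceEnergy

variable {Y : Type*} [MetricSpace Y] {K : Set Y} {W : Submodule ℝ (Y → ℝ)} {q : (Y → ℝ) → ℝ}

theorem polar_congr (h : IsResistanceEnergy K W q) {u u' v v' : Y → ℝ} (hu : u ∈ W) (hv : v ∈ W)
    (huu' : EqOn u u' K) (hvv' : EqOn v v' K) :
    IsQuadOn.polar q u v = IsQuadOn.polar q u' v' := by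
  have h1 : EqOn (u + v) (u' + v') K := fun x hx => by
    rw [Pi.add_apply, Pi.add_apply, huu' hx, hvv' hx]
  have h2 : EqOn (u - v) (u' - v') K := fun x hx => by
    rw [Pi.sub_apply, Pi.sub_apply, huu' hx, hvv' hx]
  rw [IsQuadOn.polar, IsQuadOn.polar, (h.congr _ (W.add_mem hu hv) _ h1).2,
    (h.congr _ (W.sub_mem hu hv) _ h2).2]

/-- Truncation removes a neighbourhood of `Z` from the support. -/
theorem cutoff (h : IsResistanceEnergy K W q) (hK : IsCompact K) {Z : Set Y} {u : Y → ℝ}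
    (hu : u ∈ W) {δ : ℝ} (hZ : ∀ z ∈ Z, |u z| < δ) :
    u - StretchedFractal.clamp δ ∘ u ∈ vanishingOn W Z ∧
      HasCompactSupport fun x : (K \ Z : Set Y) => (u - StretchedFractal.clamp δ ∘ u) x := by
  refine ⟨⟨W.sub_mem hu (h.contraction _ (isMonotoneContraction_clamp_symm δ) u hu).1,
    fun z hz => ?_⟩, ?_⟩
  · rw [Pi.sub_apply, Function.comp_apply, clamp_of_abs_le (hZ z hz).le, sub_self]
  -- The difference vanishes where `|u| < δ`, so it lives on this compact set, which avoids `Z`.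
  · set A : Set Y := K ∩ u ⁻¹' {t | δ ≤ |t|} with hA
    have hAc : IsCompact A :=
      hK.of_isClosed_subset ((h.continuousOn u hu).preimage_isClosed_of_isClosed hK.isClosed
        (isClosed_le continuous_const continuous_abs)) inter_subset_left
    have hAX : A ⊆ K \ Z := fun x hx => ⟨hx.1, fun hxZ => (not_lt.2 hx.2) (hZ x hxZ)⟩
    have hc : IsCompact ((↑) ⁻¹' A : Set (K \ Z : Set Y)) := by
      rw [Subtype.isCompact_iff, Subtype.image_preimage_coe, inter_eq_right.2 hAX]
      exact hAc
    refine HasCompactSupport.intro hc fun x hx => ?_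
    have h1 : |u x| < δ := by
      by_contra h2
      exact hx ⟨x.2.1, not_lt.1 h2⟩
    rw [Pi.sub_apply, Function.comp_apply, clamp_of_abs_le h1.le, sub_self]

theorem continuous_restrict (h : IsResistanceEnergy K W q) {Z : Set Y} {u : Y → ℝ} (hu : u ∈ W) :
    Continuous fun x : (K \ Z : Set Y) => u x :=
  continuousOn_iff_continuous_domRestrict.1 ((h.continuousOn u hu).mono sdiff_subset)

/-- Every element of `C_c(K \ Z)` is a uniform limit of compactly supported elements of the
domain. -/
theorem core_uniform (h : IsResistanceEnergy K W q) (hK : IsCompact K) {Z : Set Y}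
    (hZ : IsClosed Z) (hZK : Z ⊆ K) {φ : (K \ Z : Set Y) → ℝ} (hφ : Continuous φ) (hφc : HasCompactSupport φ)
    {ε : ℝ} (hε : 0 < ε) :
    ∃ w ∈ vanishingOn W Z, HasCompactSupport (fun x : (K \ Z : Set Y) => w x) ∧
      ∀ x : (K \ Z : Set Y), |φ x - w x| < ε := by
  classical
  -- Extension by zero. It is continuous at points of `Z` because the support of `φ` is compact,
  -- hence closed in `Y`, and misses `Z`.
  set ψ : Y → ℝ := fun y => if hy : y ∈ K \ Z then φ ⟨y, hy⟩ else 0 with hψ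
  have hψX : ∀ x : (K \ Z : Set Y), ψ x = φ x := fun x => by simp only [hψ, dif_pos x.2]
  have hψZ : ∀ z ∈ Z, ψ z = 0 := fun z hz => dif_neg fun hy => hy.2 hz
  have hψc : ContinuousOn ψ K := by
    intro x hx
    by_cases hxZ : x ∈ Z
    · set T : Set Y := (↑) '' tsupport φ
      have hT : IsClosed T := (hφc.image continuous_subtype_val).isClosed
      have hxT : x ∉ T := by
        rintro ⟨y, -, rfl⟩
        exact y.2.2 hxZ
      have h1 : ψ =ᶠ[𝓝[K] x] fun _ => 0 := by
        refine Filter.Eventually.filter_mono nhdsWithin_le_nhds ?_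
        filter_upwards [hT.isOpen_compl.mem_nhds hxT] with y hy
        by_cases hyX : y ∈ K \ Z
        · rw [hψX ⟨y, hyX⟩]
          by_contra h2
          exact hy ⟨⟨y, hyX⟩, subset_closure h2, rfl⟩
        · exact dif_neg hyX
      exact (continuousWithinAt_const.congr_of_eventuallyEq h1 (hψZ x hxZ))
    · have h1 : ContinuousOn ψ (K \ Z) := by
        rw [continuousOn_iff_continuous_domRestrict]
        exact hφ.congr fun x => (hψX x).symm
      have h2 := h1 x ⟨hx, hxZ⟩
      rwa [ContinuousWithinAt, sdiff_eq, nhdsWithin_inter_of_mem'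
        (mem_nhdsWithin_of_mem_nhds (hZ.isOpen_compl.mem_nhds hxZ))] at h2
  obtain ⟨u, hu, huψ⟩ := h.dense ψ hψc (ε / 2) (half_pos hε)
  -- The approximant is below `ε / 2` on `Z`, so truncation at that height applies; it costs another
  -- `ε / 2`.
  have hcut := h.cutoff hK hu (δ := ε / 2) (Z := Z) fun z hz => by
    simpa [hψZ z hz] using huψ z (hZK hz)
  refine ⟨_, hcut.1, hcut.2, fun x => ?_⟩
  have h1 := huψ x x.2.1
  have h2 := abs_clamp_le (half_pos hε).le (u x)
  rw [hψX] at h1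
  rw [Pi.sub_apply, Function.comp_apply]
  rw [abs_lt] at h1 ⊢
  rw [abs_le] at h2
  constructor <;> linarith

variable [MeasurableSpace Y]

/-- A measure of full support separates continuous functions, and on `Z` both functions vanish. This
makes the form well defined on `L²`-classes. -/
theorem eqOn_of_ae_eq (h : IsResistanceEnergy K W q) {Z : Set Y}
    {m : Measure (K \ Z : Set Y)} [m.IsOpenPosMeasure] {u v : Y → ℝ}
    (hu : u ∈ vanishingOn W Z) (hv : v ∈ vanishingOn W Z)
    (huv : (fun x : (K \ Z : Set Y) => u x) =ᵐ[m] fun x => v x) : EqOn u v K := by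
  have h1 := (Continuous.ae_eq_iff_eq m (h.continuous_restrict hu.1)
    (h.continuous_restrict hv.1)).1 huv
  intro x hx
  by_cases hxZ : x ∈ Z
  · rw [hu.2 x hxZ, hv.2 x hxZ]
  · exact congrFun h1 ⟨x, hx, hxZ⟩

variable [BorelSpace Y]

theorem memLp (h : IsResistanceEnergy K W q) (hK : IsCompact K) {Z : Set Y}
    {m : Measure (K \ Z : Set Y)} [IsFiniteMeasure m] {u : Y → ℝ} (hu : u ∈ W) :
    MemLp (fun x : (K \ Z : Set Y) => u x) 2 m := by
  obtain ⟨C, hC⟩ := hK.exists_bound_of_continuousOn (h.continuousOn u hu)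
  exact MemLp.of_bound (h.continuous_restrict hu).measurable.aestronglyMeasurable C
    (Eventually.of_forall fun x => hC x x.2.1)

/-- The supremum norm is controlled by the energy and the `L²`-norm. -/
theorem exists_sq_le (h : IsResistanceEnergy K W q) (hK : IsCompact K) {Z : Set Y}
    (hZK : Z ⊆ K) {m : Measure (K \ Z : Set Y)} [IsFiniteMeasure m] [m.IsOpenPosMeasure] :
    ∃ C : ℝ, 0 ≤ C ∧ ∀ u (hu : u ∈ vanishingOn W Z), ∀ x ∈ K,
      u x ^ 2 ≤ C * (q u + ‖(h.memLp (m := m) hK hu.1).toLp‖ ^ 2) := by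
  obtain ⟨C, hC0, hC⟩ := h.osc
  -- If `Z` has a point, the oscillation estimate against that zero of `u` suffices. Otherwise the
  -- estimate is averaged over the space, and the `L²`-norm controls the mean.
  rcases Z.eq_empty_or_nonempty with hZ | ⟨z, hz⟩
  · rcases K.eq_empty_or_nonempty with hKe | ⟨x₀, hx₀⟩
    · exact ⟨0, le_rfl, fun u hu x hx => by simp [hKe] at hx⟩
    have hne : Nonempty (K \ Z : Set Y) := ⟨⟨x₀, hx₀, by simp [hZ]⟩⟩
    set M : ℝ := m.real univ with hM
    have hMpos : 0 < M := by
      rw [hM, measureReal_def]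
      exact ENNReal.toReal_pos (isOpen_univ.measure_pos m univ_nonempty).ne' (measure_ne_top _ _)
    refine ⟨max (2 * C) (2 / M), by positivity, fun u hu x hx => ?_⟩
    have hmem := h.memLp (m := m) hK hu.1
    have hnorm : ‖hmem.toLp‖ ^ 2 = ∫ y : (K \ Z : Set Y), u y ^ 2 ∂m := by
      rw [← real_inner_self_eq_norm_sq, L2.inner_def]
      refine integral_congr_ae ?_
      filter_upwards [hmem.coeFn_toLp] with y hy
      rw [hy]
      simp [sq]
    have hint : Integrable (fun y : (K \ Z : Set Y) => u y ^ 2) m := hmem.integrable_sq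
    have h1 : ∫ _y : (K \ Z : Set Y), u x ^ 2 ∂m
        ≤ ∫ y : (K \ Z : Set Y), (2 * (C * q u) + 2 * u y ^ 2) ∂m := by
      refine integral_mono (integrable_const _) ((integrable_const _).add (hint.const_mul 2))
        fun y => ?_
      have := hC u hu.1 x hx y y.2.1
      dsimp only
      -- `2 (u x - u y)² + 2 (u y)² - (u x)² = (u x - 2 u y)²`.
      nlinarith [sq_nonneg (u x - 2 * u y)]
    rw [integral_add (integrable_const _) (hint.const_mul 2), integral_const, integral_const,
      integral_const_mul, ← hnorm, ← hM, smul_eq_mul, smul_eq_mul] at h1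
    have h2 : u x ^ 2 ≤ 2 * C * q u + 2 / M * ‖hmem.toLp‖ ^ 2 := by
      rw [← mul_le_mul_iff_right₀ hMpos]
      refine h1.trans_eq ?_
      field_simp
    have hq := h.nonneg u hu.1
    calc u x ^ 2 ≤ 2 * C * q u + 2 / M * ‖hmem.toLp‖ ^ 2 := h2
      _ ≤ max (2 * C) (2 / M) * q u + max (2 * C) (2 / M) * ‖hmem.toLp‖ ^ 2 := by
          gcongr
          · exact le_max_left _ _
          · exact le_max_right _ _
      _ = _ := by ring
  · refine ⟨C, hC0, fun u hu x hx => ?_⟩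
    have h1 := hC u hu.1 x hx z (hZK hz)
    rw [hu.2 z hz, sub_zero] at h1
    exact h1.trans (by gcongr; exact le_add_of_nonneg_right (sq_nonneg _))

/-- Functions vanishing on `Z` embed into `L²(K \ Z)` up to equality on `K`, so the polarized energy
is transported to classes. Closedness rests on the bound of the supremum norm, the core on
truncation near zero. -/
theorem isRegularDirichletFormOn [LocallyCompactSpace Y] [SecondCountableTopology Y]
    (h : IsResistanceEnergy K W q) (hK : IsCompact K) {Z : Set Y} (hZ : IsClosed Z) (hZK : Z ⊆ K)
    {μ : Measure Y} [IsFiniteMeasure μ]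
    (hμ : ∀ U : Set Y, IsOpen U → (U ∩ K).Nonempty → 0 < μ (U ∩ K)) :
    IsRegularDirichletFormOn (K \ Z) μ {u | u ∈ W ∧ ∀ x ∈ Z, u x = 0} (IsQuadOn.polar q) := by
  have hX : MeasurableSet (K \ Z) := hK.measurableSet.diff hZ.measurableSet
  set m : Measure (K \ Z : Set Y) := μ.comap Subtype.val with hm
  have hmfin : IsFiniteMeasure m := ⟨by
    rw [hm, comap_subtype_coe_apply hX]; exact measure_lt_top _ _⟩
  have hmpos : m.IsOpenPosMeasure := ⟨fun U hU hne => by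
    obtain ⟨O, hO, rfl⟩ := isOpen_induced_iff.1 hU
    obtain ⟨x, hx⟩ := hne
    rw [hm, comap_subtype_coe_apply hX, Subtype.image_preimage_coe]
    have h1 := hμ (O ∩ Zᶜ) (hO.inter hZ.isOpen_compl) ⟨x, ⟨hx, x.2.2⟩, x.2.1⟩
    refine (h1.trans_le (measure_mono ?_)).ne'
    rintro y ⟨⟨h2, h3⟩, h4⟩
    exact ⟨⟨h4, h3⟩, h2⟩⟩
  have hlc : LocallyCompactSpace (K \ Z : Set Y) :=
    (hK.isClosed.isLocallyClosed.inter hZ.isOpen_compl.isLocallyClosed).locallyCompactSpace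
  set V := vanishingOn W Z with hV
  have hmem : ∀ u ∈ V, MemLp (fun x : (K \ Z : Set Y) => u x) 2 m := fun u hu => h.memLp hK hu.1
  set R : V →ₗ[ℝ] Lp ℝ 2 m := restrictLp hmem with hR
  have hRae : ∀ u : V, R u =ᵐ[m] fun x : (K \ Z : Set Y) => (u : Y → ℝ) x := fun u =>
    (hmem u u.2).coeFn_toLp
  set D : Submodule ℝ (Lp ℝ 2 m) := LinearMap.range R with hD
  have hrep : ∀ f : D, ∃ u : V, R u = f := fun f => f.2
  -- An arbitrary choice of representatives; it need not be linear, but representatives agree on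
  -- `K`, where the energy sees them, and this yields bilinearity.
  choose s hs using hrep
  have hsae : ∀ f : D, (f : Lp ℝ 2 m) =ᵐ[m] fun x : (K \ Z : Set Y) => (s f : Y → ℝ) x := fun f => by
    rw [← hs f]; exact hRae _
  have huniq : ∀ u v : V, R u = R v → EqOn (u : Y → ℝ) v K := fun u v huv =>
    h.eqOn_of_ae_eq (m := m) u.2 v.2 ((hRae u).symm.trans (huv ▸ hRae v))
  have hpol : ∀ f g : D, ∀ u v : V, R u = f → R v = g →
      IsQuadOn.polar q (s f) (s g) = IsQuadOn.polar q u v := fun f g u v hu hv =>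
    h.polar_congr (s f).2.1 (s g).2.1 (huniq _ _ ((hs f).trans hu.symm))
      (huniq _ _ ((hs g).trans hv.symm))
  have hsymm : ∀ f g : D, IsQuadOn.polar q (s f) (s g) = IsQuadOn.polar q (s g) (s f) :=
    fun f g => h.quad.polar_comm (s f).2.1 (s g).2.1
  have hadd : ∀ f f' g : D, IsQuadOn.polar q (s (f + f')) (s g)
      = IsQuadOn.polar q (s f) (s g) + IsQuadOn.polar q (s f') (s g) := fun f f' g => by
    rw [hpol (f + f') g (s f + s f') (s g) (by rw [map_add, hs, hs]; rfl) (hs g)]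
    exact h.quad.polar_add (s f).2.1 (s f').2.1 (s g).2.1
  have hsmul : ∀ (c : ℝ) (f g : D), IsQuadOn.polar q (s (c • f)) (s g)
      = c * IsQuadOn.polar q (s f) (s g) := fun c f g => by
    rw [hpol (c • f) g (c • s f) (s g) (by rw [map_smul, hs]; rfl) (hs g)]
    exact h.quad.polar_smul c (s f).2.1 (s g).2.1
  set E : D →ₗ[ℝ] D →ₗ[ℝ] ℝ := LinearMap.mk₂ ℝ (fun f g => IsQuadOn.polar q (s f) (s g)) hadd hsmul
    (fun f g g' => by rw [hsymm, hadd, hsymm g, hsymm g'])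
    (fun c f g => by rw [hsymm, hsmul, hsymm g]; rfl) with hE
  have hEq : ∀ (f : D) (u : V), R u = f → E f f = q u := fun f u hu => by
    change IsQuadOn.polar q (s f) (s f) = q u
    rw [hpol f f u u hu hu, h.quad.polar_self u.2.1]
  have hEsub : ∀ f g : D, E (f - g) (f - g) = q ((s f : Y → ℝ) - s g) := fun f g =>
    hEq (f - g) (s f - s g) (by rw [map_sub, hs, hs]; rfl)
  have hRmem : ∀ u : V, R u ∈ D := fun u => ⟨u, rfl⟩
  have hEsub' : ∀ (f : D) (u : V), E (f - ⟨R u, hRmem u⟩) (f - ⟨R u, hRmem u⟩)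
      = q ((s f : Y → ℝ) - u) := fun f u =>
    hEq _ (s f - u) (by rw [map_sub, hs]; rfl)
  have hnsub' : ∀ (f : D) (u : V), ((f - ⟨R u, hRmem u⟩ : D) : Lp ℝ 2 m) = R (s f - u) :=
    fun f u => by rw [map_sub, hs]; rfl
  -- The square root of the total mass, the constant comparing the `L²`-norm with the supremum norm.
  -- It may be zero, whence `M + 1` in the denominators below.
  set M : ℝ := measureUnivNNReal m ^ ((2 : ℝ≥0∞).toReal⁻¹) with hM
  have hM0 : 0 ≤ M := by positivity
  have hnorm : ∀ (f : Lp ℝ 2 m) (c : ℝ), 0 ≤ c → (∀ᵐ x ∂m, |f x| ≤ c) → ‖f‖ ≤ M * c :=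
    fun f c hc hf => Lp.norm_le_of_ae_bound hc hf
  have hnormR : ∀ (u : V) (c : ℝ), 0 ≤ c → (∀ x ∈ K, |(u : Y → ℝ) x| ≤ c) → ‖R u‖ ≤ M * c :=
    fun u c hc hu => hnorm _ c hc (by
      filter_upwards [hRae u] with x hx
      rw [hx]; exact hu x x.2.1)
  have hcore : ∀ φ : (K \ Z : Set Y) → ℝ, Continuous φ → HasCompactSupport φ → ∀ ε > (0 : ℝ),
      ∃ ψ : (K \ Z : Set Y) → ℝ, Continuous ψ ∧ HasCompactSupport ψ ∧
      (∃ g : D, ((g : Lp ℝ 2 m) : (K \ Z : Set Y) → ℝ) =ᵐ[m] ψ) ∧ ∀ x, |φ x - ψ x| < ε := by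
    intro φ hφ hφc ε hε
    obtain ⟨w, hw, hwc, hφw⟩ := h.core_uniform hK hZ hZK hφ hφc hε
    exact ⟨_, h.continuous_restrict hw.1, hwc, ⟨⟨R ⟨w, hw⟩, hRmem _⟩, hRae _⟩, hφw⟩
  refine ⟨fun u hu => hmem u hu, D, E, ?_, ?_, ?_⟩
  · intro f
    constructor
    · rintro ⟨u, rfl⟩
      exact ⟨u, u.2, hRae u⟩
    · rintro ⟨u, hu, hfu⟩
      exact ⟨⟨u, hu⟩, Lp.ext ((hRae ⟨u, hu⟩).trans hfu.symm)⟩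
  · intro f g u hu v hv hfu hgv
    exact hpol f g ⟨u, hu⟩ ⟨v, hv⟩ (Lp.ext ((hRae ⟨u, hu⟩).trans hfu.symm))
      (Lp.ext ((hRae ⟨v, hv⟩).trans hgv.symm))
  refine
    { locallyCompact := hlc
      finiteOnCompacts := inferInstance
      fullSupport := hmpos
      dense := ?_
      symm := hsymm
      nonneg := fun f => by rw [hEq f (s f) (hs f)]; exact h.nonneg _ (s f).2.1
      closed := ?_
      markov := ?_
      core_dense := ?_
      core_uniform := hcore }
  -- Compactly supported continuous functions are dense in `L²`, and the domain approximates them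
  -- uniformly, hence in `L²` since `m` is finite.
  · rw [Metric.dense_iff]
    intro f ε hε
    obtain ⟨φ, hφc, hφ, hφcont, hφmem⟩ := (Lp.memLp f).exists_hasCompactSupport_eLpNorm_sub_le
      (by norm_num) (ENNReal.ofReal_pos.2 (half_pos hε)).ne'
    obtain ⟨ψ, hψ, hψc, ⟨g, hg⟩, hφψ⟩ := hcore φ hφcont hφc (ε / (4 * (M + 1))) (by positivity)
    refine ⟨g, ?_, g.2⟩
    rw [Metric.mem_ball, dist_comm, dist_eq_norm]
    have h1 : ‖f - hφmem.toLp‖ ≤ ε / 2 := by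
      rw [Lp.norm_def]
      refine ENNReal.toReal_le_of_le_ofReal (half_pos hε).le ?_
      refine le_of_eq_of_le (eLpNorm_congr_ae ?_) hφ
      filter_upwards [Lp.coeFn_sub f hφmem.toLp, hφmem.coeFn_toLp] with x hx1 hx2
      rw [hx1, Pi.sub_apply, Pi.sub_apply, hx2]
    have h2 : ‖hφmem.toLp - (g : Lp ℝ 2 m)‖ ≤ M * (ε / (4 * (M + 1))) := by
      refine hnorm _ _ (by positivity) ?_
      filter_upwards [Lp.coeFn_sub hφmem.toLp (g : Lp ℝ 2 m), hφmem.coeFn_toLp, hg]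
        with x hx1 hx2 hx3
      rw [hx1, Pi.sub_apply, hx2, hx3]
      exact (hφψ x).le
    have h3 : M * (ε / (4 * (M + 1))) < ε / 2 := by
      rw [mul_div_assoc', div_lt_div_iff₀ (by positivity) (by norm_num)]
      nlinarith
    calc ‖f - (g : Lp ℝ 2 m)‖ ≤ ‖f - hφmem.toLp‖ + ‖hφmem.toLp - (g : Lp ℝ 2 m)‖ :=
          norm_sub_le_norm_sub_add_norm_sub _ _ _
      _ < ε := by linarith
  · intro f hf
    obtain ⟨C, hC0, hC⟩ := h.exists_sq_le hK hZK (m := m)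
    have hsup : ∀ i j, ∀ x ∈ K, ((s (f i) : Y → ℝ) x - (s (f j) : Y → ℝ) x) ^ 2
        ≤ C * (E (f i - f j) (f i - f j) + ‖((f i - f j : D) : Lp ℝ 2 m)‖ ^ 2) := by
      intro i j x hx
      have h1 := hC _ (s (f i) - s (f j)).2 x hx
      have h2 : ((f i - f j : D) : Lp ℝ 2 m) = R (s (f i) - s (f j)) := by
        rw [map_sub, hs, hs]; rfl
      rw [hEsub, h2]
      exact h1
    -- The supremum bound turns a Cauchy sequence for `E₁` into a uniform one; `C + 1` keeps the
    -- denominator positive.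
    have hucau : UniformCauchySeqOn (fun n => (s (f n) : Y → ℝ)) atTop K := by
      rw [Metric.uniformCauchySeqOn_iff]
      intro ε hε
      obtain ⟨M', hM'⟩ := hf (ε ^ 2 / (C + 1)) (by positivity)
      refine ⟨M', fun i hi j hj x hx => ?_⟩
      have h1 := hsup i j x hx
      have h2 := hM' i hi j hj
      have h3 : ((s (f i) : Y → ℝ) x - (s (f j) : Y → ℝ) x) ^ 2 < ε ^ 2 := by
        rw [lt_div_iff₀ (by positivity)] at h2
        have h4 : 0 ≤ E (f i - f j) (f i - f j) + ‖((f i - f j : D) : Lp ℝ 2 m)‖ ^ 2 :=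
          add_nonneg (by rw [hEsub]; exact h.nonneg _ (W.sub_mem (s (f i)).2.1 (s (f j)).2.1))
            (sq_nonneg _)
        by_cases h5 : E (f i - f j) (f i - f j) + ‖((f i - f j : D) : Lp ℝ 2 m)‖ ^ 2 = 0
        · rw [h5, mul_zero] at h1
          exact h1.trans_lt (by positivity)
        · have h6 := lt_of_le_of_ne h4 (Ne.symm h5)
          nlinarith
      rw [Real.dist_eq]
      exact abs_lt_of_sq_lt_sq h3 hε.le
    have hpt : ∀ x, ∃ y, x ∈ K → Tendsto (fun n => (s (f n) : Y → ℝ) x) atTop (𝓝 y) := by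
      intro x
      by_cases hx : x ∈ K
      · obtain ⟨y, hy⟩ := cauchySeq_tendsto_of_complete (hucau.cauchySeq hx)
        exact ⟨y, fun _ => hy⟩
      · exact ⟨0, fun h' => absurd h' hx⟩
    choose v hv using hpt
    have hunif : TendstoUniformlyOn (fun n => (s (f n) : Y → ℝ)) v atTop K :=
      hucau.tendstoUniformlyOn_of_tendsto hv
    obtain ⟨hvW, hvlim⟩ := h.complete (fun n => (s (f n) : Y → ℝ)) (fun n => (s (f n)).2.1) v hunif
      (fun ε hε => by
        obtain ⟨M', hM'⟩ := hf ε hε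
        refine ⟨M', fun i hi j hj => ?_⟩
        rw [← hEsub]
        linarith [hM' i hi j hj, sq_nonneg ‖((f i - f j : D) : Lp ℝ 2 m)‖])
    have hvV : v ∈ V := ⟨hvW, fun z hz => tendsto_nhds_unique (hv z (hZK hz))
      (tendsto_const_nhds.congr fun n => ((s (f n)).2.2 z hz).symm)⟩
    refine ⟨⟨R ⟨v, hvV⟩, hRmem _⟩, ?_⟩
    have hL2 : Tendsto (fun n => ‖((f n - ⟨R ⟨v, hvV⟩, hRmem _⟩ : D) : Lp ℝ 2 m)‖) atTop (𝓝 0) := by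
      rw [Metric.tendsto_atTop]
      intro ε hε
      obtain ⟨M', hM'⟩ := eventually_atTop.1 (Metric.tendstoUniformlyOn_iff.1 hunif
        (ε / (2 * (M + 1))) (by positivity))
      refine ⟨M', fun n hn => ?_⟩
      rw [dist_zero_right, norm_norm, hnsub']
      have h1 : ‖R (s (f n) - ⟨v, hvV⟩)‖ ≤ M * (ε / (2 * (M + 1))) := by
        refine hnormR _ _ (by positivity) fun x hx => ?_
        have := hM' n hn x hx
        rw [dist_comm, Real.dist_eq] at this
        exact this.le
      refine h1.trans_lt ?_
      rw [mul_div_assoc', div_lt_iff₀ (by positivity)]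
      nlinarith
    have := (hvlim.congr fun n => (hEsub' (f n) ⟨v, hvV⟩).symm).add (hL2.pow 2)
    simpa using this
  · intro f
    -- The unit contraction fixes 0, so the zero values on `Z` are preserved.
    have hφ := SelfSimilarSet.isMonotoneContraction_clamp 0 1
    obtain ⟨h1, h2⟩ := h.contraction _ hφ (s f) (s f).2.1
    have h3 : (fun x : ℝ => min (max x 0) 1) ∘ (s f : Y → ℝ) ∈ V :=
      ⟨h1, fun z hz => by simp [(s f).2.2 z hz]⟩
    refine ⟨⟨R ⟨_, h3⟩, hRmem _⟩, ?_, ?_⟩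
    · filter_upwards [hRae ⟨_, h3⟩, hsae f] with x hx1 hx2
      rw [hx1, hx2]; rfl
    · rw [hEq _ ⟨_, h3⟩ rfl, hEq f (s f) (hs f)]
      linarith [h.nonneg _ (W.sub_mem (s f).2.1 h1)]
  · intro f ε hε
    set δ : ℕ → ℝ := fun n => 1 / ((n : ℝ) + 1) with hδ
    have hδpos : ∀ n, 0 < δ n := fun n => by positivity
    have hδlim : Tendsto δ atTop (𝓝 0) := tendsto_one_div_add_atTop_nhds_zero_nat
    -- The error of the approximation is the truncated function: its energy is at most `q u - q (u -
    -- clamp δ ∘ u)` and its absolute value at most `δ`.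
    have h1 : Tendsto (fun n => (q (s f)
        - q ((s f : Y → ℝ) - StretchedFractal.clamp (δ n) ∘ (s f : Y → ℝ)))
        + (M * δ n) ^ 2) atTop (𝓝 0) := by
      have := ((tendsto_const_nhds (x := q (s f))).sub (h.clamp (s f) (s f).2.1)).add
        ((hδlim.const_mul M).pow 2)
      rw [sub_self, mul_zero, zero_pow two_ne_zero, add_zero] at this
      exact this
    obtain ⟨n, hn⟩ := (h1.eventually (gt_mem_nhds hε)).exists
    have hcut := h.cutoff hK (s f).2.1 (δ := δ n) (Z := Z) fun z hz => by
      rw [(s f).2.2 z hz, abs_zero]; exact hδpos n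
    obtain ⟨h2, h3⟩ := h.contraction _ (isMonotoneContraction_clamp_symm (δ n)) (s f) (s f).2.1
    have h4 : (s f : Y → ℝ) - ((s f : Y → ℝ) - StretchedFractal.clamp (δ n) ∘ (s f : Y → ℝ))
        = StretchedFractal.clamp (δ n) ∘ (s f : Y → ℝ) := sub_sub_cancel _ _
    refine ⟨_, h.continuous_restrict hcut.1.1, hcut.2, ⟨R ⟨_, hcut.1⟩, hRmem _⟩, hRae _, ?_⟩
    rw [hEsub', hnsub']
    have h5 : ‖R (s f - ⟨_, hcut.1⟩)‖ ≤ M * δ n := hnormR _ _ (hδpos n).le fun x hx => by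
      change |((s f : Y → ℝ) - ((s f : Y → ℝ) - StretchedFractal.clamp (δ n) ∘ (s f : Y → ℝ))) x| ≤ _
      rw [h4]
      exact abs_clamp_le (hδpos n).le _
    have h6 : ‖R (s f - ⟨_, hcut.1⟩)‖ ^ 2 ≤ (M * δ n) ^ 2 := by gcongr
    change q ((s f : Y → ℝ) - ((s f : Y → ℝ) - StretchedFractal.clamp (δ n) ∘ (s f : Y → ℝ))) + _ < ε
    rw [h4]
    linarith

end IsResistanceEnergy

namespace SelfSimilarSet

/-! ### Geometry of the stretched fractal -/

/-! ### Compositions along words. -/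

section Words

variable {X : Type*} {N : ℕ}

theorem wordMap_cons (f : Fin N → X → X) (i : Fin N) (w : List (Fin N)) (x : X) :
    wordMap f (i :: w) x = f i (wordMap f w x) := rfl

theorem wordMap_mem {f : Fin N → X → X} {A : Set X} (h : ∀ i, ∀ x ∈ A, f i x ∈ A)
    (w : List (Fin N)) : ∀ x ∈ A, wordMap f w x ∈ A := by
  induction w with
  | nil => exact fun x hx => hx
  | cons i w ih => exact fun x hx => h i _ (ih x hx)

theorem continuous_wordMap [TopologicalSpace X] {f : Fin N → X → X} (h : ∀ i, Continuous (f i))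
    (w : List (Fin N)) : Continuous (wordMap f w) := by
  induction w with
  | nil => exact continuous_id
  | cons i w ih => exact (h i).comp ih

theorem dist_wordMap_le [PseudoMetricSpace X] {f : Fin N → X → X} {r : ℝ} (hr : 0 ≤ r)
    (h : ∀ i x y, dist (f i x) (f i y) ≤ r * dist x y) (w : List (Fin N)) (x y : X) :
    dist (wordMap f w x) (wordMap f w y) ≤ r ^ w.length * dist x y := by
  induction w with
  | nil => simp [wordMap]
  | cons i w ih =>
    calc dist (f i (wordMap f w x)) (f i (wordMap f w y))
        ≤ r * dist (wordMap f w x) (wordMap f w y) := h _ _ _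
      _ ≤ r * (r ^ w.length * dist x y) := by gcongr
      _ = r ^ (i :: w).length * dist x y := by rw [List.length_cons]; ring

end Words

variable {d N : ℕ}

/-! ### Addresses, finiteness of the post critical set, and the individual maps. -/

section Basic

variable (S : SelfSimilarSet d N)

theorem nonempty_index (S : SelfSimilarSet d N) : Nonempty (Fin N) := by
  obtain ⟨x, hx⟩ := S.isConnected.nonempty
  rw [S.carrier_eq] at hx
  obtain ⟨i, -⟩ := mem_iUnion.1 hx
  exact ⟨i⟩

theorem map_mem (i : Fin N) {x : EuclideanSpace ℝ (Fin d)} (hx : x ∈ S.carrier) :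
    S.map i x ∈ S.carrier := by
  rw [S.carrier_eq]
  exact mem_iUnion.2 ⟨i, x, hx, rfl⟩

theorem map_injective (i : Fin N) : Function.Injective (S.map i) := by
  obtain ⟨r, hr, -, h⟩ := S.similitude i
  intro x y hxy
  have h1 := h x y
  rw [hxy, dist_self] at h1
  exact dist_eq_zero.1 ((mul_eq_zero.1 h1.symm).resolve_left hr.ne')

theorem exists_ratio : ∃ r : ℝ, 0 ≤ r ∧ r < 1 ∧
    ∀ i x y, dist (S.map i x) (S.map i y) ≤ r * dist x y := by
  have := S.nonempty_index
  choose r hr0 hr1 hr using S.similitude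
  obtain ⟨j, hj⟩ := Finite.exists_max r
  exact ⟨r j, (hr0 j).le, hr1 j, fun i x y => by
    rw [hr]; exact mul_le_mul_of_nonneg_right (hj i) dist_nonneg⟩

theorem continuous_map (i : Fin N) : Continuous (S.map i) := by
  obtain ⟨r, hr, -, h⟩ := S.similitude i
  exact (LipschitzWith.of_dist_le_mul (K := ⟨r, hr.le⟩) fun x y => (h x y).le).continuous

theorem exists_codes {x : EuclideanSpace ℝ (Fin d)} (hx : x ∈ S.carrier) :
    ∃ ω, S.Codes ω x := by
  have h1 : ∀ y : S.carrier, ∃ p : Fin N × S.carrier, S.map p.1 p.2 = y := fun y => by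
    obtain ⟨i, z, hz, hzy⟩ := mem_iUnion.1 (S.carrier_eq.subset y.2)
    exact ⟨(i, ⟨z, hz⟩), hzy⟩
  choose p hp using h1
  -- Successive preimages of `x` under the chosen maps; the letters chosen on the way form the
  -- address.
  let y : ℕ → S.carrier := fun n => Nat.rec ⟨x, hx⟩ (fun _ z => (p z).2) n
  have hy : ∀ n m, ((y m).1 =
      wordMap S.map (List.ofFn fun k : Fin n => (p (y (m + k))).1)
        (y (m + n)).1) := by
    intro n
    induction n with
    | zero => intro m; rfl
    | succ n ih =>
      intro m
      rw [List.ofFn_succ, wordMap_cons]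
      have h2 := ih (m + 1)
      have h3 : (y m).1 = S.map (p (y m)).1 (y (m + 1)) := (hp (y m)).symm
      rw [h3, h2]
      have e : ∀ k, m + 1 + k = m + (k + 1) := fun k => by omega
      simp only [e, Fin.val_zero, Fin.val_succ, add_zero]
  refine ⟨fun n => (p (y n)).1, fun n => ⟨(y n).1, (y n).2, ?_⟩⟩
  have := hy n 0
  simp only [Nat.zero_add] at this
  exact this.symm

theorem codes_cons {ω : ℕ → Fin N} {x : EuclideanSpace ℝ (Fin d)} (h : S.Codes ω x) (i : Fin N) :
    S.Codes (fun n => Nat.casesOn n i ω) (S.map i x) := by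
  intro n
  cases n with
  | zero =>
    obtain ⟨z, hz, hzx⟩ := h 0
    refine ⟨S.map i x, S.map_mem i ?_, rfl⟩
    rw [← hzx]; exact hz
  | succ n =>
    obtain ⟨z, hz, hzx⟩ := h n
    refine ⟨z, hz, ?_⟩
    rw [List.ofFn_succ, wordMap_cons]
    change S.map i (wordMap S.map (List.ofFn fun k : Fin n => ω k) z) = S.map i x
    rw [hzx]

/-- Prefixing `w` to an address of `x` gives an address of `F_w(x)`. An address of a post critical
point is therefore a proper shift of an address of a critical point. -/
theorem codes_wordMap {ω : ℕ → Fin N} {x : EuclideanSpace ℝ (Fin d)} (h : S.Codes ω x)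
    (w : List (Fin N)) :
    ∃ τ, S.Codes τ (wordMap S.map w x) ∧ ω = fun k => τ (k + w.length) := by
  induction w with
  | nil => exact ⟨ω, h, rfl⟩
  | cons i w ih =>
    obtain ⟨τ, hτ, hωτ⟩ := ih
    exact ⟨_, S.codes_cons hτ i, by rw [hωτ]; rfl⟩

/-- Both points lie in the same cell of every level, and the diameters tend to zero. -/
theorem eq_of_codes {ω : ℕ → Fin N} {x y : EuclideanSpace ℝ (Fin d)} (hx : S.Codes ω x)
    (hy : S.Codes ω y) : x = y := by
  obtain ⟨r, hr0, hr1, hr⟩ := S.exists_ratio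
  have h1 : ∀ n : ℕ, dist x y ≤ r ^ n * Metric.diam S.carrier := fun n => by
    obtain ⟨x', hx', rfl⟩ := hx n
    obtain ⟨y', hy', h2⟩ := hy n
    rw [← h2]
    refine (dist_wordMap_le hr0 hr _ _ _).trans ?_
    rw [List.length_ofFn]
    gcongr
    exact Metric.dist_le_diam_of_mem S.isCompact.isBounded hx' hy'
  have h2 : Tendsto (fun n : ℕ => r ^ n * Metric.diam S.carrier) atTop (𝓝 0) := by
    simpa using (tendsto_pow_atTop_nhds_zero_of_lt_one hr0 hr1).mul_const (Metric.diam S.carrier)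
  exact dist_le_zero.1 (ge_of_tendsto' h2 h1)

/-- Choosing an address for each post critical point injects the set into the symbolic post critical
set, because an address determines its point. -/
theorem finite_postCrit (hS : S.Stretchable) : S.postCrit.Finite := by
  have h1 : ∀ p : S.postCrit, ∃ ω, S.Codes ω p := fun p => S.exists_codes p.2.1
  choose ω hω using h1
  have h2 : ∀ p, ω p ∈ S.symbolicPostCrit := fun p => by
    obtain ⟨-, w, hw, hc⟩ := p.2
    obtain ⟨τ, hτ, h3⟩ := S.codes_wordMap (hω p) w
    exact ⟨τ, _, hc, hτ, w.length, List.length_pos_iff.2 hw, h3⟩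
  have := hS.pcf.to_subtype
  have h3 : Function.Injective fun p => (⟨ω p, h2 p⟩ : S.symbolicPostCrit) := fun p p' hpp' => by
    have h4 : ω p = ω p' := congrArg Subtype.val hpp'
    exact Subtype.ext (S.eq_of_codes (hω p) (h4 ▸ hω p'))
  exact finite_coe_iff.1 (Finite.of_injective _ h3)

theorem snd_mem_postCrit {l : Fin N × EuclideanSpace ℝ (Fin d)} (hl : l ∈ S.lines) :
    l.2 ∈ S.postCrit := ⟨hl.1, [l.1], by simp, hl.2⟩

theorem finite_lines (hS : S.Stretchable) : S.lines.Finite :=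
  (finite_univ.prod (S.finite_postCrit hS)).subset fun _ hl => ⟨mem_univ _, S.snd_mem_postCrit hl⟩

variable {S}

theorem lineCurve_zero (α : ℝ) (b : EuclideanSpace ℝ (Fin d) → EuclideanSpace ℝ (Fin d))
    (l : Fin N × EuclideanSpace ℝ (Fin d)) : S.lineCurve α b l 0 = S.cellEnd α b l := by
  simp [lineCurve]

theorem lineCurve_one (α : ℝ) (b : EuclideanSpace ℝ (Fin d) → EuclideanSpace ℝ (Fin d))
    (l : Fin N × EuclideanSpace ℝ (Fin d)) : S.lineCurve α b l 1 = S.critEnd l := by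
  simp [lineCurve]

theorem continuous_lineCurve (α : ℝ) (b : EuclideanSpace ℝ (Fin d) → EuclideanSpace ℝ (Fin d))
    (l : Fin N × EuclideanSpace ℝ (Fin d)) : Continuous (S.lineCurve α b l) := by
  unfold lineCurve
  fun_prop

theorem dist_stretch_le {α : ℝ} (hα : 0 ≤ α) (i : Fin N) (x y : EuclideanSpace ℝ (Fin d)) :
    dist (S.stretch α i x) (S.stretch α i y) ≤ α * dist x y := by
  obtain ⟨r, hr, hr1, h⟩ := S.similitude i
  rw [stretch, stretch, dist_add_right, dist_smul₀, dist_sub_right, h, Real.norm_eq_abs,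
    abs_of_nonneg hα]
  have := mul_le_of_le_one_left (dist_nonneg (x := x) (y := y)) hr1.le
  gcongr

theorem continuous_stretch (α : ℝ) (i : Fin N) : Continuous (S.stretch α i) := by
  have := S.continuous_map i
  unfold stretch
  fun_prop

theorem stretch_injective {α : ℝ} (hα : 0 < α) (i : Fin N) :
    Function.Injective (S.stretch α i) := by
  intro x y hxy
  refine S.map_injective i ?_
  rw [stretch, stretch, add_left_inj] at hxy
  exact sub_left_injective (smul_right_injective _ hα.ne' hxy)

theorem stretch_fix (α : ℝ) (i : Fin N) : S.stretch α i (S.fix i) = S.fix i := by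
  rw [stretch, S.map_fix, sub_self, smul_zero, zero_add]

end Basic

/-- The standing assumptions on a stretched fractal. -/
structure Admissible (S : SelfSimilarSet d N) (α : ℝ)
    (b : EuclideanSpace ℝ (Fin d) → EuclideanSpace ℝ (Fin d))
    (K : Set (EuclideanSpace ℝ (Fin d))) : Prop where
  stretchable : S.Stretchable
  α_pos : 0 < α
  α_lt_one : α < 1
  choice : S.IsBoundaryChoice α b
  fractal : S.IsStretchedFractal α b K
  separated : S.IsSeparated α b K
  lines_nonempty : S.lines.Nonempty

namespace Admissible

variable {S : SelfSimilarSet d N} {α : ℝ}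
  {b : EuclideanSpace ℝ (Fin d) → EuclideanSpace ℝ (Fin d)} {K : Set (EuclideanSpace ℝ (Fin d))}

theorem finite_lines (h : S.Admissible α b K) : Finite S.lines :=
  (S.finite_lines h.stretchable).to_subtype

theorem finite_vertices (h : S.Admissible α b K) : (S.vertices b).Finite :=
  (S.finite_postCrit h.stretchable).image b

theorem stretch_mem (h : S.Admissible α b K) (i : Fin N) :
    ∀ x ∈ K, S.stretch α i x ∈ K := fun x hx => by
  rw [h.fractal.eq]
  exact Or.inl (mem_iUnion.2 ⟨i, x, hx, rfl⟩)

theorem lineCurve_mem (h : S.Admissible α b K) {l : Fin N × EuclideanSpace ℝ (Fin d)}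
    (hl : l ∈ S.lines) {t : ℝ} (ht : t ∈ Icc (0 : ℝ) 1) : S.lineCurve α b l t ∈ K := by
  rw [h.fractal.eq]
  exact Or.inr (mem_iUnion₂.2 ⟨l, hl, t, ht, rfl⟩)

theorem word_mem (h : S.Admissible α b K) (w : List (Fin N)) :
    ∀ x ∈ K, wordMap (S.stretch α) w x ∈ K :=
  wordMap_mem h.stretch_mem w

/-- A point of `K` lies in a `1`-cell or on a connecting line. -/
theorem mem_cases (h : S.Admissible α b K) {x : EuclideanSpace ℝ (Fin d)} (hx : x ∈ K) :
    (∃ i, ∃ y ∈ K, x = S.stretch α i y) ∨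
      ∃ l ∈ S.lines, ∃ t ∈ Icc (0 : ℝ) 1, x = S.lineCurve α b l t := by
  rw [h.fractal.eq] at hx
  rcases hx with hx | hx
  · obtain ⟨i, y, hy, hxy⟩ := mem_iUnion.1 hx
    exact Or.inl ⟨i, y, hy, hxy.symm⟩
  · obtain ⟨l, hl, t, ht, hxt⟩ := mem_iUnion₂.1 hx
    exact Or.inr ⟨l, hl, t, ht, hxt.symm⟩

theorem dist_word_le (h : S.Admissible α b K) (w : List (Fin N))
    (x y : EuclideanSpace ℝ (Fin d)) :
    dist (wordMap (S.stretch α) w x) (wordMap (S.stretch α) w y) ≤ α ^ w.length * dist x y :=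
  dist_wordMap_le h.α_pos.le (dist_stretch_le h.α_pos.le) w x y

theorem tendsto_diam (h : S.Admissible α b K) :
    Tendsto (fun n : ℕ => α ^ n * Metric.diam K) atTop (𝓝 0) := by
  simpa using (tendsto_pow_atTop_nhds_zero_of_lt_one h.α_pos.le h.α_lt_one).mul_const
    (Metric.diam K)

/-- The iterates under `G_i` of any point of `K` stay in the closed set `K` and converge to the
fixed point. -/
theorem fix_mem (h : S.Admissible α b K) (i : Fin N) : S.fix i ∈ K := by
  obtain ⟨x, hx⟩ := h.fractal.nonempty
  have h1 : ∀ n, wordMap (S.stretch α) (List.replicate n i) (S.fix i) = S.fix i := fun n => by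
    induction n with
    | zero => rfl
    | succ n ih => rw [List.replicate_succ, wordMap_cons, ih, stretch_fix]
  have h2 : Tendsto (fun n => wordMap (S.stretch α) (List.replicate n i) x) atTop
      (𝓝 (S.fix i)) := by
    rw [tendsto_iff_dist_tendsto_zero]
    have h3 : Tendsto (fun n : ℕ => α ^ n * dist x (S.fix i)) atTop (𝓝 0) := by
      simpa using (tendsto_pow_atTop_nhds_zero_of_lt_one h.α_pos.le h.α_lt_one).mul_const
        (dist x (S.fix i))
    refine squeeze_zero (fun _ => dist_nonneg) (fun n => ?_) h3
    have h4 := h.dist_word_le (List.replicate n i) x (S.fix i)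
    rwa [h1, List.length_replicate] at h4
  exact h.fractal.isCompact.isClosed.mem_of_tendsto h2
    (Eventually.of_forall fun n => h.word_mem _ x hx)

theorem vertices_subset (h : S.Admissible α b K) : S.vertices b ⊆ K := by
  rintro _ ⟨p, hp, rfl⟩
  obtain ⟨⟨w, i, -, -, hb⟩, -⟩ := h.choice p hp
  rw [hb]
  exact h.word_mem w _ (h.fix_mem i)

theorem vertices_nonempty (h : S.Admissible α b K) : (S.vertices b).Nonempty := by
  obtain ⟨l, hl⟩ := h.lines_nonempty
  exact ⟨_, mem_image_of_mem b (S.snd_mem_postCrit hl)⟩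

/-- The compatibility of the boundary choices enters here: it places `V₀` among the cell vertices of
the first network, so that resistances between the two vertex sets make sense. -/
theorem exists_stretch_eq_vertex (h : S.Admissible α b K) {v : EuclideanSpace ℝ (Fin d)}
    (hv : v ∈ S.vertices b) : ∃ j, ∃ v' ∈ S.vertices b, v = S.stretch α j v' := by
  obtain ⟨p, hp, rfl⟩ := hv
  obtain ⟨-, j, p', hp', -, hb⟩ := h.choice p hp
  exact ⟨j, b p', ⟨p', hp', rfl⟩, hb⟩

theorem snd_vertex {l : Fin N × EuclideanSpace ℝ (Fin d)}
    (hl : l ∈ S.lines) : b l.2 ∈ S.vertices b := ⟨_, S.snd_mem_postCrit hl, rfl⟩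

/-- The end points of a connecting line are different. -/
theorem critEnd_ne_cellEnd (h : S.Admissible α b K) {l : Fin N × EuclideanSpace ℝ (Fin d)}
    (hl : l ∈ S.lines) : S.critEnd l ≠ S.cellEnd α b l := by
  intro heq
  -- If the end points coincided, `c` would lie in the cell `l.1` of `K`. But `c` also ends a line
  -- from every cell of `F` containing it, and such a line may meet only its own cell; so only one
  -- cell would contain `c`, and `c` would not be critical.
  have key : ∀ j, S.critEnd l ∈ S.map j '' S.carrier → j = l.1 := by
    rintro j ⟨p, hp, hpc⟩
    have hl' : (j, p) ∈ S.lines := by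
      refine ⟨hp, ?_⟩
      change S.map j p ∈ S.crit
      rw [hpc]
      exact hl.2
    have h1 : S.critEnd l ∈ S.line α b (j, p) :=
      ⟨1, ⟨zero_le_one, le_rfl⟩, by rw [lineCurve_one]; exact hpc⟩
    have h2 : S.critEnd l ∈ S.stretch α l.1 '' K := by
      rw [heq]
      exact ⟨b l.2, h.vertices_subset (snd_vertex hl), rfl⟩
    exact (h.separated.line_cell _ hl' l.1 _ h1 h2).1.symm
  obtain ⟨i, j, hij, hi, hj⟩ := hl.2
  exact hij ((key i hi).trans (key j hj).symm)

theorem lineCurve_injective (h : S.Admissible α b K) {l : Fin N × EuclideanSpace ℝ (Fin d)}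
    (hl : l ∈ S.lines) : Function.Injective (S.lineCurve α b l) := by
  intro s t hst
  have h1 : (s - t) • (S.critEnd l - S.cellEnd α b l) = 0 := by
    rw [lineCurve, lineCurve] at hst
    rw [← sub_eq_zero] at hst
    rw [← hst]
    module
  rcases smul_eq_zero.1 h1 with h2 | h2
  · linarith
  · exact absurd (sub_eq_zero.1 h2) (h.critEnd_ne_cellEnd hl)

/-- Any two `1`-cells are connected through a chain of `1`-cells that meet in critical points. -/
theorem cells_connected (S : SelfSimilarSet d N) (i j : Fin N) :
    Relation.ReflTransGen
      (fun i j => ∃ x, x ∈ S.map i '' S.carrier ∧ x ∈ S.map j '' S.carrier) i j := by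
  by_contra hij
  set r : Fin N → Fin N → Prop :=
    fun i j => ∃ x, x ∈ S.map i '' S.carrier ∧ x ∈ S.map j '' S.carrier with hr
  have hclosed : ∀ k, IsClosed (S.map k '' S.carrier) := fun k =>
    (S.isCompact.image (S.continuous_map k)).isClosed
  -- The cells reachable from `i` and the remaining cells give two closed sets covering the
  -- connected set `F`; a common point links the two families, a contradiction.
  set A : Set (EuclideanSpace ℝ (Fin d)) :=
    ⋃ k ∈ {k | Relation.ReflTransGen r i k}, S.map k '' S.carrier with hA
  set B : Set (EuclideanSpace ℝ (Fin d)) :=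
    ⋃ k ∈ {k | ¬ Relation.ReflTransGen r i k}, S.map k '' S.carrier with hB
  have hAc : IsClosed A := (toFinite _).isClosed_biUnion fun k _ => hclosed k
  have hBc : IsClosed B := (toFinite _).isClosed_biUnion fun k _ => hclosed k
  obtain ⟨x₀, hx₀⟩ := S.isConnected.nonempty
  have hcov : S.carrier ⊆ A ∪ B := fun x hx => by
    rw [S.carrier_eq] at hx
    obtain ⟨k, hk⟩ := mem_iUnion.1 hx
    by_cases hrk : Relation.ReflTransGen r i k
    · exact Or.inl (mem_iUnion₂.2 ⟨k, hrk, hk⟩)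
    · exact Or.inr (mem_iUnion₂.2 ⟨k, hrk, hk⟩)
  obtain ⟨x, -, hxA, hxB⟩ := isPreconnected_closed_iff.1 S.isConnected.isPreconnected A B hAc hBc
    hcov ⟨S.map i x₀, S.map_mem i hx₀, mem_iUnion₂.2 ⟨i, Relation.ReflTransGen.refl, x₀, hx₀, rfl⟩⟩
    ⟨S.map j x₀, S.map_mem j hx₀, mem_iUnion₂.2 ⟨j, hij, x₀, hx₀, rfl⟩⟩
  obtain ⟨k, hk, hxk⟩ := mem_iUnion₂.1 hxA
  obtain ⟨k', hk', hxk'⟩ := mem_iUnion₂.1 hxB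
  exact hk' (Relation.ReflTransGen.tail hk ⟨x, hxk, hxk'⟩)

/-- A continuous function on `K` oscillates little on all `n`-cells if `n` is large. -/
theorem exists_osc_le (h : S.Admissible α b K) {u : EuclideanSpace ℝ (Fin d) → ℝ}
    (hu : ContinuousOn u K) {ε : ℝ} (hε : 0 < ε) :
    ∃ n : ℕ, ∀ w : List (Fin N), w.length = n → ∀ x ∈ K, ∀ y ∈ K,
      |u (wordMap (S.stretch α) w x) - u (wordMap (S.stretch α) w y)| ≤ ε := by
  have huc := h.fractal.isCompact.uniformContinuousOn_of_continuous hu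
  obtain ⟨δ, hδ, H⟩ := Metric.uniformContinuousOn_iff.1 huc ε hε
  obtain ⟨n, hn⟩ := (h.tendsto_diam.eventually (gt_mem_nhds hδ)).exists
  refine ⟨n, fun w hw x hx y hy => ?_⟩
  rw [← Real.dist_eq]
  refine (H _ (h.word_mem w x hx) _ (h.word_mem w y hy) ?_).le
  refine (h.dist_word_le w x y).trans_lt (lt_of_le_of_lt ?_ hn)
  rw [hw]
  have := Metric.dist_le_diam_of_mem h.fractal.isCompact.isBounded hx hy
  have := h.α_pos
  gcongr

end Admissible

/-! ### Gluing of functions along the pieces -/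

/-- A continuous map from a compact set to a Hausdorff space is closed, so continuity descends along
it. -/
theorem continuousOn_image_of_comp {X Y Z : Type*} [TopologicalSpace X] [TopologicalSpace Y]
    [T2Space Y] [TopologicalSpace Z] {A : Set X} (hA : IsCompact A) {γ : X → Y}
    (hγ : ContinuousOn γ A) {u : Y → Z} (hu : ContinuousOn (u ∘ γ) A) :
    ContinuousOn u (γ '' A) := by
  rw [continuousOn_iff_isClosed]
  intro C hC
  refine ⟨γ '' (A ∩ (u ∘ γ) ⁻¹' C), ?_, ?_⟩
  · obtain ⟨C', hC', h⟩ := continuousOn_iff_isClosed.1 hu C hC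
    have h1 : IsCompact (A ∩ (u ∘ γ) ⁻¹' C) := by
      rw [inter_comm, h, inter_comm]
      exact hA.inter_right hC'
    exact (h1.image_of_continuousOn (hγ.mono inter_subset_left)).isClosed
  · ext y
    constructor
    · rintro ⟨h1, x, hx, rfl⟩
      exact ⟨⟨x, ⟨hx, h1⟩, rfl⟩, x, hx, rfl⟩
    · rintro ⟨⟨x, ⟨hx, h1⟩, rfl⟩, -⟩
      exact ⟨h1, x, hx, rfl⟩

/-- By separation, distinct pieces meet only at a line's end in its own cell (parameter 0) or at a
shared critical point (parameter 1), where `hf0` and `hf1` match the data. Continuity then follows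
from the finite closed cover. -/
theorem Admissible.exists_glue {S : SelfSimilarSet d N} {α : ℝ}
    {b : EuclideanSpace ℝ (Fin d) → EuclideanSpace ℝ (Fin d)} {K : Set (EuclideanSpace ℝ (Fin d))}
    (h : S.Admissible α b K) (u : Fin N → EuclideanSpace ℝ (Fin d) → ℝ)
    (hu : ∀ i, ContinuousOn (u i) K) (f : Fin N × EuclideanSpace ℝ (Fin d) → ℝ → ℝ)
    (hf : ∀ l ∈ S.lines, ContinuousOn (f l) (Icc 0 1)) (κ : EuclideanSpace ℝ (Fin d) → ℝ)
    (hf0 : ∀ l ∈ S.lines, f l 0 = u l.1 (b l.2)) (hf1 : ∀ l ∈ S.lines, f l 1 = κ (S.critEnd l)) :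
    ∃ v : EuclideanSpace ℝ (Fin d) → ℝ, ContinuousOn v K ∧
      (∀ i, ∀ x ∈ K, v (S.stretch α i x) = u i x) ∧
      ∀ l ∈ S.lines, ∀ t ∈ Icc (0 : ℝ) 1, v (S.lineCurve α b l t) = f l t := by
  classical
  -- The graph of the function to be built; the work lies in its single-valuedness.
  let P : EuclideanSpace ℝ (Fin d) → ℝ → Prop := fun y c =>
    (∃ i, ∃ x ∈ K, S.stretch α i x = y ∧ c = u i x) ∨
      ∃ l ∈ S.lines, ∃ t ∈ Icc (0 : ℝ) 1, S.lineCurve α b l t = y ∧ c = f l t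
  have hcl : ∀ i, ∀ x ∈ K, ∀ l ∈ S.lines, ∀ t ∈ Icc (0 : ℝ) 1,
      S.stretch α i x = S.lineCurve α b l t → u i x = f l t := by
    intro i x hx l hl t ht hxt
    obtain ⟨h1, h2⟩ := h.separated.line_cell l hl i _ ⟨t, ht, rfl⟩ ⟨x, hx, hxt⟩
    have h3 : t = 0 := h.lineCurve_injective hl (h2.trans (lineCurve_zero α b l).symm)
    subst h1
    subst h3
    rw [lineCurve_zero] at hxt
    rw [hf0 l hl, stretch_injective h.α_pos _ hxt]
  have huniq : ∀ y c c', P y c → P y c' → c = c' := by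
    rintro y c c' (⟨i, x, hx, rfl, rfl⟩ | ⟨l, hl, t, ht, rfl, rfl⟩)
      (⟨j, x', hx', h1, rfl⟩ | ⟨l', hl', t', ht', h1, rfl⟩)
    · by_cases hij : i = j
      · subst hij
        rw [stretch_injective h.α_pos _ h1]
      · exact absurd rfl ((h.separated.cell_cell i j hij).ne_of_mem ⟨x, hx, rfl⟩ ⟨x', hx', h1⟩)
    · exact hcl i x hx l' hl' t' ht' h1.symm
    · exact (hcl j x' hx' l hl t ht h1).symm
    · by_cases hll : l = l'
      · subst hll
        rw [h.lineCurve_injective hl h1]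
      · obtain ⟨h2, h3⟩ := h.separated.line_line l hl l' hl' hll _ ⟨t, ht, rfl⟩ ⟨t', ht', h1⟩
        have h4 : t = 1 := h.lineCurve_injective hl (h2.trans (lineCurve_one α b l).symm)
        have h5 : t' = 1 :=
          h.lineCurve_injective hl' ((h1.trans h3).trans (lineCurve_one α b l').symm)
        rw [h4, h5, hf1 l hl, hf1 l' hl', ← h2, ← h3]
  have hex : ∃ v : EuclideanSpace ℝ (Fin d) → ℝ, ∀ y c, P y c → v y = c := by
    refine ⟨fun y => if hy : ∃ c, P y c then hy.choose else 0, fun y c hc => ?_⟩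
    have hy : ∃ c, P y c := ⟨c, hc⟩
    simp only [dif_pos hy]
    exact huniq y _ _ hy.choose_spec hc
  obtain ⟨v, hv⟩ := hex
  have hv1 : ∀ i, ∀ x ∈ K, v (S.stretch α i x) = u i x := fun i x hx =>
    hv _ _ (Or.inl ⟨i, x, hx, rfl, rfl⟩)
  have hv2 : ∀ l ∈ S.lines, ∀ t ∈ Icc (0 : ℝ) 1, v (S.lineCurve α b l t) = f l t :=
    fun l hl t ht => hv _ _ (Or.inr ⟨l, hl, t, ht, rfl, rfl⟩)
  refine ⟨v, ?_, hv1, hv2⟩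
  have := h.finite_lines
  let A : Fin N ⊕ S.lines → Set (EuclideanSpace ℝ (Fin d)) := fun k =>
    Sum.elim (fun i => S.stretch α i '' K) (fun l => S.line α b l) k
  have hA : K = ⋃ k, A k := by
    rw [iUnion_sum]
    conv_lhs => rw [h.fractal.eq]
    rw [biUnion_eq_iUnion]
    rfl
  have hAc : ∀ k, IsClosed (A k) ∧ ContinuousOn v (A k) := by
    rintro (i | ⟨l, hl⟩)
    · refine ⟨(h.fractal.isCompact.image (continuous_stretch α i)).isClosed, ?_⟩
      exact continuousOn_image_of_comp h.fractal.isCompact (continuous_stretch α i).continuousOn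
        ((hu i).congr fun x hx => hv1 i x hx)
    · refine ⟨(isCompact_Icc.image (continuous_lineCurve α b l)).isClosed, ?_⟩
      exact continuousOn_image_of_comp isCompact_Icc (continuous_lineCurve α b l).continuousOn
        ((hf l hl).congr fun x hx => hv2 l hl x hx)
  rw [hA]
  exact (locallyFinite_of_finite A).continuousOn_iUnion (fun k => (hAc k).1) fun k => (hAc k).2

end SelfSimilarSet

namespace SelfSimilarSet

/-! ### The approximating energies -/

variable {d N : ℕ}

section Recursion

variable (S : SelfSimilarSet d N) (α : ℝ)
  (b : EuclideanSpace ℝ (Fin d) → EuclideanSpace ℝ (Fin d))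
  (r₀ : Sym2 (EuclideanSpace ℝ (Fin d)) → ℝ≥0∞)

theorem cellSum_zero (Φ : (EuclideanSpace ℝ (Fin d) → ℝ) → ℝ≥0∞)
    (u : EuclideanSpace ℝ (Fin d) → ℝ) : S.cellSum α 0 Φ u = Φ u := by
  rw [cellSum, Fintype.sum_unique, List.ofFn_zero]
  rfl

theorem cellSum_succ (n : ℕ) (Φ : (EuclideanSpace ℝ (Fin d) → ℝ) → ℝ≥0∞)
    (u : EuclideanSpace ℝ (Fin d) → ℝ) :
    S.cellSum α (n + 1) Φ u = ∑ i, S.cellSum α n Φ (u ∘ S.stretch α i) := by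
  simp only [cellSum]
  rw [← Fintype.sum_prod_type' (f := fun i (w : Fin n → Fin N) =>
    Φ ((u ∘ S.stretch α i) ∘ wordMap (S.stretch α) (List.ofFn w)))]
  refine (Fintype.sum_equiv (Fin.consEquiv fun _ => Fin N) _ _ fun p => ?_).symm
  rw [List.ofFn_succ]
  rfl

theorem scale_succ (lam : ℕ → ℝ) (n : ℕ) :
    scale lam (n + 1) = lam 0 * scale (fun k => lam (k + 1)) n := by
  rw [scale, Finset.prod_range_succ', mul_comm]
  rfl

variable {lam : ℕ → ℝ} {ρ : ℕ → Fin N × EuclideanSpace ℝ (Fin d) → ℝ}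

theorem approxEnergy_zero (u : EuclideanSpace ℝ (Fin d) → ℝ) :
    S.approxEnergy α b r₀ lam ρ 0 u = S.cellForm b r₀ u := by
  simp [approxEnergy, scale, cellSum_zero]

/-- Words are split at their first letter, so the cells carry the energy of the shifted sequence.
The inductions on the level that use this therefore generalize over the sequence. -/
theorem approxEnergy_succ (hlam : ∀ k, 0 < lam k) (n : ℕ) (u : EuclideanSpace ℝ (Fin d) → ℝ) :
    S.approxEnergy α b r₀ lam ρ (n + 1) u =
      (ENNReal.ofReal (lam 0))⁻¹ * ∑ i, S.approxEnergy α b r₀ (fun k => lam (k + 1))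
        (fun k => ρ (k + 1)) n (u ∘ S.stretch α i) + S.lineForm α b (ρ 0) u := by
  have h0 : ENNReal.ofReal (lam 0) ≠ 0 := (ENNReal.ofReal_pos.2 (hlam 0)).ne'
  have hinv : ∀ k, (ENNReal.ofReal (scale lam (k + 1)))⁻¹ =
      (ENNReal.ofReal (lam 0))⁻¹ * (ENNReal.ofReal (scale (fun k => lam (k + 1)) k))⁻¹ :=
    fun k => by
      rw [scale_succ, ENNReal.ofReal_mul (hlam 0).le,
        ENNReal.mul_inv (Or.inl h0) (Or.inl ENNReal.ofReal_ne_top)]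
  rw [approxEnergy, Finset.sum_range_succ', hinv, cellSum_succ, cellSum_zero]
  have hs0 : scale lam 0 = 1 := by simp [scale]
  simp only [hinv, cellSum_succ, hs0, approxEnergy, ENNReal.ofReal_one, inv_one, one_mul]
  rw [Finset.sum_add_distrib, mul_add, ← Finset.mul_sum, Finset.sum_comm, ← add_assoc]
  simp only [Finset.mul_sum, mul_assoc]

end Recursion

/-- The continuous functions on `K` that belong to `H¹` on each line. -/
def pathSpace (S : SelfSimilarSet d N) (α : ℝ)
    (b : EuclideanSpace ℝ (Fin d) → EuclideanSpace ℝ (Fin d))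
    (K : Set (EuclideanSpace ℝ (Fin d))) : Submodule ℝ (EuclideanSpace ℝ (Fin d) → ℝ) where
  carrier := {u | ContinuousOn u K ∧ ∀ l ∈ S.lines, ∀ w : List (Fin N),
    IsH1 (u ∘ wordMap (S.stretch α) w ∘ S.lineCurve α b l)}
  add_mem' := fun ⟨h1, h2⟩ ⟨h3, h4⟩ => ⟨h1.add h3, fun l hl w => (h2 l hl w).add (h4 l hl w)⟩
  zero_mem' := ⟨continuousOn_const, fun _ _ _ => h1Space.zero_mem⟩
  smul_mem' c _ := fun ⟨h1, h2⟩ => ⟨h1.const_smul c, fun l hl w => (h2 l hl w).smul c⟩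

/-- A sequence of harmonic structures with uniform bounds. -/
structure IsBoundedSequence (S : SelfSimilarSet d N) (α : ℝ)
    (b : EuclideanSpace ℝ (Fin d) → EuclideanSpace ℝ (Fin d))
    (r₀ : Sym2 (EuclideanSpace ℝ (Fin d)) → ℝ≥0∞) (lamStar ρStar : ℝ) (lam : ℕ → ℝ)
    (ρ : ℕ → Fin N × EuclideanSpace ℝ (Fin d) → ℝ) : Prop where
  harmonic : ∀ k, S.IsHarmonicStructure α b r₀ (lam k) (ρ k)
  lam_le : ∀ k, lam k ≤ lamStar
  ρ_le : ∀ k, ∀ l ∈ S.lines, ρ k l ≤ ρStar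

section

variable {S : SelfSimilarSet d N} {α : ℝ}
  {b : EuclideanSpace ℝ (Fin d) → EuclideanSpace ℝ (Fin d)}
  {r₀ : Sym2 (EuclideanSpace ℝ (Fin d)) → ℝ≥0∞} {lamStar ρStar : ℝ} {lam : ℕ → ℝ}
  {ρ : ℕ → Fin N × EuclideanSpace ℝ (Fin d) → ℝ} {K : Set (EuclideanSpace ℝ (Fin d))}
  {u v : EuclideanSpace ℝ (Fin d) → ℝ}

theorem IsBoundedSequence.shift (h : S.IsBoundedSequence α b r₀ lamStar ρStar lam ρ) :
    S.IsBoundedSequence α b r₀ lamStar ρStar (fun k => lam (k + 1)) fun k => ρ (k + 1) :=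
  ⟨fun _ => h.harmonic _, fun _ => h.lam_le _, fun _ => h.ρ_le _⟩

theorem IsBoundedSequence.succ (h : S.IsBoundedSequence α b r₀ lamStar ρStar lam ρ) (n : ℕ)
    (u : EuclideanSpace ℝ (Fin d) → ℝ) :
    S.approxEnergy α b r₀ lam ρ (n + 1) u =
      (ENNReal.ofReal (lam 0))⁻¹ * ∑ i, S.approxEnergy α b r₀ (fun k => lam (k + 1))
        (fun k => ρ (k + 1)) n (u ∘ S.stretch α i) + S.lineForm α b (ρ 0) u :=
  S.approxEnergy_succ α b r₀ (fun k => (h.harmonic k).lam_pos) n u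

theorem inv_ofReal_ne_top {c : ℝ} (hc : 0 < c) : (ENNReal.ofReal c)⁻¹ ≠ ⊤ :=
  ENNReal.inv_ne_top.2 (ENNReal.ofReal_pos.2 hc).ne'

namespace pathSpace

theorem comp_stretch (hK : ∀ i, ∀ x ∈ K, S.stretch α i x ∈ K) (i : Fin N)
    (hu : u ∈ S.pathSpace α b K) : u ∘ S.stretch α i ∈ S.pathSpace α b K :=
  ⟨hu.1.comp (continuous_stretch α i).continuousOn (hK i), fun l hl w => hu.2 l hl (i :: w)⟩

theorem contraction {φ : ℝ → ℝ} (hφ : IsMonotoneContraction φ) (hu : u ∈ S.pathSpace α b K) :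
    φ ∘ u ∈ S.pathSpace α b K :=
  ⟨hφ.continuous.comp_continuousOn hu.1, fun l hl w => hφ.isH1 (hu.2 l hl w)⟩

theorem isH1_line (hu : u ∈ S.pathSpace α b K) {l : Fin N × EuclideanSpace ℝ (Fin d)}
    (hl : l ∈ S.lines) : IsH1 (u ∘ S.lineCurve α b l) := hu.2 l hl []

end pathSpace

namespace Admissible

theorem finite_edges (h : S.Admissible α b K) : Finite (S.edges b) := by
  have h1 : S.edges b ⊆ (fun p : _ × _ => s(p.1, p.2)) '' (S.vertices b ×ˢ S.vertices b) := by
    intro e he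
    induction e using Sym2.ind with
    | _ x y => exact ⟨(x, y), ⟨he.2 x (Sym2.mem_mk_left x y), he.2 y (Sym2.mem_mk_right x y)⟩, rfl⟩
  exact (((h.finite_vertices.prod h.finite_vertices).image _).subset h1).to_subtype

theorem edgeSq_ne_top {X : Type*} (u : X → ℝ) (e : Sym2 X) : edgeSq u e ≠ ⊤ := by
  induction e using Sym2.ind with
  | _ x y => exact ENNReal.ofReal_ne_top

theorem tsum_ne_top {ι : Type*} [Finite ι] {f : ι → ℝ≥0∞} (hf : ∀ i, f i ≠ ⊤) :
    ∑' i, f i ≠ ⊤ := by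
  have := Fintype.ofFinite ι
  rw [tsum_fintype]
  exact ENNReal.sum_ne_top.2 fun i _ => hf i

theorem isQuadOn_tsum {E ι : Type*} [AddCommGroup E] [Module ℝ E] [Finite ι] {V : Submodule ℝ E}
    {f : ι → E → ℝ≥0∞} (hf : ∀ i, ∀ u ∈ V, f i u ≠ ⊤)
    (hq : ∀ i, IsQuadOn V fun u => (f i u).toReal) :
    IsQuadOn V fun u => (∑' i, f i u).toReal := by
  have := Fintype.ofFinite ι
  refine (IsQuadOn.finset_sum Finset.univ fun i _ => hq i).congr fun u hu => ?_
  rw [tsum_fintype, ENNReal.toReal_sum fun i _ => hf i u hu]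

theorem cellForm_ne_top (h : S.Admissible α b K) {c : ℝ}
    {ρ : Fin N × EuclideanSpace ℝ (Fin d) → ℝ} (hr : S.IsHarmonicStructure α b r₀ c ρ)
    (u : EuclideanSpace ℝ (Fin d) → ℝ) : S.cellForm b r₀ u ≠ ⊤ := by
  have := h.finite_edges
  exact tsum_ne_top fun e => ENNReal.mul_ne_top (ENNReal.inv_ne_top.2 (hr.r₀_pos e e.2).ne')
    (edgeSq_ne_top u _)

theorem lineForm_ne_top (h : S.Admissible α b K) {ρ : Fin N × EuclideanSpace ℝ (Fin d) → ℝ}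
    (hρ : ∀ l ∈ S.lines, 0 < ρ l) (hu : u ∈ S.pathSpace α b K) : S.lineForm α b ρ u ≠ ⊤ := by
  have := h.finite_lines
  exact tsum_ne_top fun l => ENNReal.mul_ne_top (inv_ofReal_ne_top (hρ l l.2))
    (pathSpace.isH1_line hu l.2).2.ne

theorem isQuadOn_edgeSq {X : Type*} (V : Submodule ℝ (X → ℝ)) (e : Sym2 X) :
    IsQuadOn V fun u => (edgeSq u e).toReal := by
  induction e using Sym2.ind with
  | _ x y =>
    refine (IsQuadOn.of_sq (LinearMap.proj (R := ℝ) (φ := fun _ : X => ℝ) x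
      - LinearMap.proj y)).congr fun u _ => ?_
    exact ENNReal.toReal_ofReal (sq_nonneg _)

theorem isQuadOn_cellForm (h : S.Admissible α b K) {c : ℝ}
    {ρ : Fin N × EuclideanSpace ℝ (Fin d) → ℝ} (hr : S.IsHarmonicStructure α b r₀ c ρ)
    (V : Submodule ℝ (EuclideanSpace ℝ (Fin d) → ℝ)) :
    IsQuadOn V fun u => (S.cellForm b r₀ u).toReal := by
  have := h.finite_edges
  refine isQuadOn_tsum (fun e u _ => ENNReal.mul_ne_top
    (ENNReal.inv_ne_top.2 (hr.r₀_pos e e.2).ne') (edgeSq_ne_top u _)) fun e => ?_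
  simp only [ENNReal.toReal_mul]
  exact (isQuadOn_edgeSq V e).const_mul _

/-- Composition with a fixed map as a linear map. -/
def precomp {X Y : Type*} (f : X → Y) : (Y → ℝ) →ₗ[ℝ] (X → ℝ) := LinearMap.funLeft ℝ ℝ f

theorem isQuadOn_lineForm (h : S.Admissible α b K) {ρ : Fin N × EuclideanSpace ℝ (Fin d) → ℝ}
    (hρ : ∀ l ∈ S.lines, 0 < ρ l) :
    IsQuadOn (S.pathSpace α b K) fun u => (S.lineForm α b ρ u).toReal := by
  have := h.finite_lines
  refine isQuadOn_tsum (fun l u hu => ENNReal.mul_ne_top (inv_ofReal_ne_top (hρ l l.2))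
    (pathSpace.isH1_line hu l.2).2.ne) fun l => ?_
  simp only [ENNReal.toReal_mul]
  exact (isQuadOn_dirichletEnergy.comp (V := S.pathSpace α b K) (precomp (S.lineCurve α b l))
    fun u hu => pathSpace.isH1_line hu l.2).const_mul _

theorem approxEnergy_ne_top (h : S.Admissible α b K)
    (hR : S.IsBoundedSequence α b r₀ lamStar ρStar lam ρ) (n : ℕ)
    (hu : u ∈ S.pathSpace α b K) : S.approxEnergy α b r₀ lam ρ n u ≠ ⊤ := by
  induction n generalizing lam ρ u with
  | zero =>
    rw [approxEnergy_zero]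
    exact h.cellForm_ne_top (hR.harmonic 0) u
  | succ n ih =>
    rw [hR.succ]
    exact ENNReal.add_ne_top.2 ⟨ENNReal.mul_ne_top (inv_ofReal_ne_top (hR.harmonic 0).lam_pos)
      (ENNReal.sum_ne_top.2 fun i _ => ih hR.shift (pathSpace.comp_stretch h.stretch_mem i hu)),
      h.lineForm_ne_top (hR.harmonic 0).ρ_pos hu⟩

theorem isQuadOn_approxEnergy (h : S.Admissible α b K)
    (hR : S.IsBoundedSequence α b r₀ lamStar ρStar lam ρ) (n : ℕ) :
    IsQuadOn (S.pathSpace α b K) fun u => (S.approxEnergy α b r₀ lam ρ n u).toReal := by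
  induction n generalizing lam ρ with
  | zero =>
    simp only [approxEnergy_zero]
    exact h.isQuadOn_cellForm (hR.harmonic 0) _
  | succ n ih =>
    refine (((IsQuadOn.finset_sum Finset.univ fun i _ => (ih hR.shift).comp
      (V := S.pathSpace α b K) (precomp (S.stretch α i))
      fun u hu => pathSpace.comp_stretch h.stretch_mem i hu).const_mul
        (ENNReal.ofReal (lam 0))⁻¹.toReal).sum_add
      (h.isQuadOn_lineForm (hR.harmonic 0).ρ_pos)).congr fun u hu => ?_
    have hfin : ∀ i, S.approxEnergy α b r₀ (fun k => lam (k + 1)) (fun k => ρ (k + 1)) n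
        (u ∘ S.stretch α i) ≠ ⊤ := fun i =>
      h.approxEnergy_ne_top hR.shift n (pathSpace.comp_stretch h.stretch_mem i hu)
    rw [hR.succ, ENNReal.toReal_add (ENNReal.mul_ne_top
      (inv_ofReal_ne_top (hR.harmonic 0).lam_pos) (ENNReal.sum_ne_top.2 fun i _ => hfin i))
      (h.lineForm_ne_top (hR.harmonic 0).ρ_pos hu), ENNReal.toReal_mul,
      ENNReal.toReal_sum fun i _ => hfin i]
    rfl

/-- On the interpolating networks the energy increases, by the trace condition. -/
theorem approxEnergy_le_succ (h : S.Admissible α b K)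
    (hR : S.IsBoundedSequence α b r₀ lamStar ρStar lam ρ) (n : ℕ)
    (hu : u ∈ S.pathSpace α b K) :
    S.approxEnergy α b r₀ lam ρ n u ≤ S.approxEnergy α b r₀ lam ρ (n + 1) u := by
  induction n generalizing lam ρ u with
  | zero =>
    rw [approxEnergy_zero, hR.succ, ← (hR.harmonic 0).trace u]
    -- `u` itself competes in the infimum of the trace condition.
    refine (iInf₂_le u fun x _ => rfl).trans ?_
    rw [form₁, Finset.mul_sum]
    simp only [approxEnergy_zero]
    gcongr
    refine ENNReal.tsum_le_tsum fun l => ?_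
    gcongr
    have h1 := (pathSpace.isH1_line hu l.2).sq_sub_le (s := 0) (t := 1)
      ⟨le_rfl, zero_le_one⟩ ⟨zero_le_one, le_rfl⟩
    simpa only [Function.comp_apply, lineCurve_zero, lineCurve_one] using h1
  | succ n ih =>
    rw [hR.succ, hR.succ]
    gcongr with i
    exact ih hR.shift (pathSpace.comp_stretch h.stretch_mem i hu)

theorem monotone_approxEnergy (h : S.Admissible α b K)
    (hR : S.IsBoundedSequence α b r₀ lamStar ρStar lam ρ) (hu : u ∈ S.pathSpace α b K) :
    Monotone fun n => S.approxEnergy α b r₀ lam ρ n u :=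
  monotone_nat_of_le_succ fun n => h.approxEnergy_le_succ hR n hu

theorem edgeSq_contraction {X : Type*} {φ : ℝ → ℝ} (hφ : IsMonotoneContraction φ) (u : X → ℝ)
    (e : Sym2 X) : edgeSq (φ ∘ u) e + edgeSq (u - φ ∘ u) e ≤ edgeSq u e := by
  induction e using Sym2.ind with
  | _ x y =>
    change ENNReal.ofReal _ + ENNReal.ofReal _ ≤ ENNReal.ofReal _
    rw [← ENNReal.ofReal_add (sq_nonneg _) (sq_nonneg _)]
    exact ENNReal.ofReal_le_ofReal (hφ.sq_add_sq_le _ _)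

theorem approxEnergy_contraction (h : S.Admissible α b K)
    (hR : S.IsBoundedSequence α b r₀ lamStar ρStar lam ρ) (n : ℕ) {φ : ℝ → ℝ}
    (hφ : IsMonotoneContraction φ) (hu : u ∈ S.pathSpace α b K) :
    S.approxEnergy α b r₀ lam ρ n (φ ∘ u) + S.approxEnergy α b r₀ lam ρ n (u - φ ∘ u) ≤
      S.approxEnergy α b r₀ lam ρ n u := by
  induction n generalizing lam ρ u with
  | zero =>
    simp only [approxEnergy_zero, cellForm]
    rw [← ENNReal.tsum_add]
    refine ENNReal.tsum_le_tsum fun e => ?_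
    rw [← mul_add]
    gcongr
    exact edgeSq_contraction hφ u _
  | succ n ih =>
    rw [hR.succ, hR.succ, hR.succ, add_add_add_comm, ← mul_add, ← Finset.sum_add_distrib]
    gcongr with i
    · exact ih hR.shift (pathSpace.comp_stretch h.stretch_mem i hu)
    · simp only [lineForm]
      rw [← ENNReal.tsum_add]
      refine ENNReal.tsum_le_tsum fun l => ?_
      rw [← mul_add]
      gcongr
      exact hφ.dirichletEnergy_add_le (pathSpace.isH1_line hu l.2)

theorem edgeSq_congr {X : Type*} {A : Set X} {u v : X → ℝ} (huv : EqOn u v A) {e : Sym2 X}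
    (he : ∀ x ∈ e, x ∈ A) : edgeSq u e = edgeSq v e := by
  induction e using Sym2.ind with
  | _ x y =>
    change ENNReal.ofReal _ = ENNReal.ofReal _
    rw [huv (he x (Sym2.mem_mk_left x y)), huv (he y (Sym2.mem_mk_right x y))]

theorem approxEnergy_congr (h : S.Admissible α b K)
    (hR : S.IsBoundedSequence α b r₀ lamStar ρStar lam ρ) (n : ℕ) (huv : EqOn u v K) :
    S.approxEnergy α b r₀ lam ρ n u = S.approxEnergy α b r₀ lam ρ n v := by
  induction n generalizing lam ρ u v with
  | zero =>
    simp only [approxEnergy_zero, cellForm]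
    exact tsum_congr fun e => by
      rw [edgeSq_congr huv fun x hx => h.vertices_subset (e.2.2 x hx)]
  | succ n ih =>
    rw [hR.succ, hR.succ]
    congr 1
    · congr 1
      exact Finset.sum_congr rfl fun i _ => ih hR.shift fun x hx => huv (h.stretch_mem i x hx)
    · exact tsum_congr fun l => by
        rw [dirichletEnergy_congr (f := u ∘ S.lineCurve α b l) (g := v ∘ S.lineCurve α b l)
          fun t ht => huv (h.lineCurve_mem l.2 ht)]

theorem tendsto_tsum {ι : Type*} [Finite ι] {f : ℕ → ι → ℝ≥0∞} {g : ι → ℝ≥0∞}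
    (hf : ∀ i, Tendsto (fun m => f m i) atTop (𝓝 (g i))) :
    Tendsto (fun m => ∑' i, f m i) atTop (𝓝 (∑' i, g i)) := by
  have := Fintype.ofFinite ι
  simp only [tsum_fintype]
  exact tendsto_finsetSum _ fun i _ => hf i

theorem tendsto_edgeSq {X : Type*} {A : Set X} {v : ℕ → X → ℝ} {u : X → ℝ}
    (hv : ∀ x ∈ A, Tendsto (fun m => v m x) atTop (𝓝 (u x))) {e : Sym2 X}
    (he : ∀ x ∈ e, x ∈ A) : Tendsto (fun m => edgeSq (v m) e) atTop (𝓝 (edgeSq u e)) := by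
  induction e using Sym2.ind with
  | _ x y =>
    exact ENNReal.tendsto_ofReal (((hv x (he x (Sym2.mem_mk_left x y))).sub
      (hv y (he y (Sym2.mem_mk_right x y)))).pow 2)

/-- At a fixed level the energy is a finite combination of squared differences at points of `K` and
of line energies. -/
theorem tendsto_approxEnergy (h : S.Admissible α b K)
    (hR : S.IsBoundedSequence α b r₀ lamStar ρStar lam ρ) (n : ℕ)
    {v : ℕ → EuclideanSpace ℝ (Fin d) → ℝ}
    (hv : ∀ x ∈ K, Tendsto (fun m => v m x) atTop (𝓝 (u x)))
    (hl : ∀ l ∈ S.lines, ∀ w : List (Fin N), Tendsto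
      (fun m => dirichletEnergy (v m ∘ wordMap (S.stretch α) w ∘ S.lineCurve α b l)) atTop
      (𝓝 (dirichletEnergy (u ∘ wordMap (S.stretch α) w ∘ S.lineCurve α b l)))) :
    Tendsto (fun m => S.approxEnergy α b r₀ lam ρ n (v m)) atTop
      (𝓝 (S.approxEnergy α b r₀ lam ρ n u)) := by
  have := h.finite_edges
  have := h.finite_lines
  induction n generalizing lam ρ u v with
  | zero =>
    simp only [approxEnergy_zero]
    exact tendsto_tsum fun e => ENNReal.Tendsto.const_mul
      (tendsto_edgeSq hv fun x hx => h.vertices_subset (e.2.2 x hx))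
      (Or.inr (ENNReal.inv_ne_top.2 ((hR.harmonic 0).r₀_pos e e.2).ne'))
  | succ n ih =>
    simp only [hR.succ]
    refine Tendsto.add (ENNReal.Tendsto.const_mul (tendsto_finsetSum _ fun i _ => ?_)
      (Or.inr (inv_ofReal_ne_top (hR.harmonic 0).lam_pos))) (tendsto_tsum fun l => ?_)
    · exact ih hR.shift (fun x hx => hv _ (h.stretch_mem i x hx))
        fun l hl' w => hl l hl' (i :: w)
    · exact ENNReal.Tendsto.const_mul (hl l l.2 [])
        (Or.inr (inv_ofReal_ne_top ((hR.harmonic 0).ρ_pos l l.2)))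

/-- The energies of the `1`-cells are controlled by the energy. -/
theorem approxEnergy_comp_le (hR : S.IsBoundedSequence α b r₀ lamStar ρStar lam ρ) (n : ℕ)
    (i : Fin N) :
    S.approxEnergy α b r₀ (fun k => lam (k + 1)) (fun k => ρ (k + 1)) n (u ∘ S.stretch α i) ≤
      ENNReal.ofReal (lam 0) * S.approxEnergy α b r₀ lam ρ (n + 1) u := by
  have h0 : ENNReal.ofReal (lam 0) ≠ 0 := (ENNReal.ofReal_pos.2 (hR.harmonic 0).lam_pos).ne'
  have h1 : (ENNReal.ofReal (lam 0))⁻¹ * S.approxEnergy α b r₀ (fun k => lam (k + 1))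
      (fun k => ρ (k + 1)) n (u ∘ S.stretch α i) ≤ S.approxEnergy α b r₀ lam ρ (n + 1) u := by
    rw [hR.succ]
    refine le_add_right ?_
    gcongr
    exact Finset.single_le_sum (f := fun i => S.approxEnergy α b r₀ (fun k => lam (k + 1))
      (fun k => ρ (k + 1)) n (u ∘ S.stretch α i)) (fun _ _ => zero_le) (Finset.mem_univ i)
  calc _ = ENNReal.ofReal (lam 0) * ((ENNReal.ofReal (lam 0))⁻¹ * S.approxEnergy α b r₀
        (fun k => lam (k + 1)) (fun k => ρ (k + 1)) n (u ∘ S.stretch α i)) := by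
        rw [← mul_assoc, ENNReal.mul_inv_cancel h0 ENNReal.ofReal_ne_top, one_mul]
    _ ≤ _ := by gcongr

theorem dirichletEnergy_line_le (hR : S.IsBoundedSequence α b r₀ lamStar ρStar lam ρ) (n : ℕ)
    {l : Fin N × EuclideanSpace ℝ (Fin d)} (hl : l ∈ S.lines) :
    dirichletEnergy (u ∘ S.lineCurve α b l) ≤
      ENNReal.ofReal ρStar * S.approxEnergy α b r₀ lam ρ (n + 1) u := by
  have hρ := (hR.harmonic 0).ρ_pos l hl
  have h0 : ENNReal.ofReal (ρ 0 l) ≠ 0 := (ENNReal.ofReal_pos.2 hρ).ne'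
  have h1 : (ENNReal.ofReal (ρ 0 l))⁻¹ * dirichletEnergy (u ∘ S.lineCurve α b l) ≤
      S.approxEnergy α b r₀ lam ρ (n + 1) u := by
    rw [hR.succ]
    exact le_add_left (ENNReal.le_tsum (f := fun l : S.lines => (ENNReal.ofReal (ρ 0 l))⁻¹ *
      dirichletEnergy (u ∘ S.lineCurve α b l)) ⟨l, hl⟩)
  calc _ = ENNReal.ofReal (ρ 0 l) * ((ENNReal.ofReal (ρ 0 l))⁻¹ *
        dirichletEnergy (u ∘ S.lineCurve α b l)) := by
        rw [← mul_assoc, ENNReal.mul_inv_cancel h0 ENNReal.ofReal_ne_top, one_mul]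
    _ ≤ _ := by
        gcongr
        exact hR.ρ_le 0 l hl

/-- The line inside the cell `w` first appears at level `|w| + 1`. Passing to a cell costs factors
`λ < 1`, which are dropped. -/
theorem dirichletEnergy_word_le (hR : S.IsBoundedSequence α b r₀ lamStar ρStar lam ρ)
    (w : List (Fin N)) {l : Fin N × EuclideanSpace ℝ (Fin d)} (hl : l ∈ S.lines) :
    dirichletEnergy (u ∘ wordMap (S.stretch α) w ∘ S.lineCurve α b l) ≤
      ENNReal.ofReal ρStar * S.approxEnergy α b r₀ lam ρ (w.length + 1) u := by
  induction w generalizing lam ρ u with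
  | nil => exact dirichletEnergy_line_le hR 0 hl
  | cons i w ih =>
    refine (ih hR.shift (u := u ∘ S.stretch α i)).trans ?_
    gcongr
    refine (approxEnergy_comp_le hR _ i).trans ?_
    refine mul_le_of_le_one_left (zero_le) ?_
    rw [ENNReal.ofReal_le_one]
    exact (hR.harmonic 0).lam_lt_one.le

end Admissible

end

end SelfSimilarSet

namespace SelfSimilarSet

/-! ### The limit energy -/

variable {d N : ℕ} {S : SelfSimilarSet d N} {α : ℝ}
  {b : EuclideanSpace ℝ (Fin d) → EuclideanSpace ℝ (Fin d)}
  {r₀ : Sym2 (EuclideanSpace ℝ (Fin d)) → ℝ≥0∞} {lamStar ρStar : ℝ} {lam : ℕ → ℝ}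
  {ρ : ℕ → Fin N × EuclideanSpace ℝ (Fin d) → ℝ} {K : Set (EuclideanSpace ℝ (Fin d))}
  {u v : EuclideanSpace ℝ (Fin d) → ℝ}

namespace Admissible

/-- Monotonicity guarantees a limit in `[0, ∞]`, so `limUnder` takes its genuine value rather than
an arbitrary one. -/
theorem tendsto_energy (h : S.Admissible α b K)
    (hR : S.IsBoundedSequence α b r₀ lamStar ρStar lam ρ) (hu : u ∈ S.pathSpace α b K) :
    Tendsto (fun n => S.approxEnergy α b r₀ lam ρ n u) atTop
      (𝓝 (S.energy α b r₀ lam ρ u)) :=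
  tendsto_nhds_limUnder ⟨_, tendsto_atTop_iSup (h.monotone_approxEnergy hR hu)⟩

theorem approxEnergy_le_energy (h : S.Admissible α b K)
    (hR : S.IsBoundedSequence α b r₀ lamStar ρStar lam ρ) (hu : u ∈ S.pathSpace α b K) (n : ℕ) :
    S.approxEnergy α b r₀ lam ρ n u ≤ S.energy α b r₀ lam ρ u :=
  (h.monotone_approxEnergy hR hu).ge_of_tendsto (h.tendsto_energy hR hu) n

theorem mem_domain_iff (h : S.Admissible α b K)
    (hR : S.IsBoundedSequence α b r₀ lamStar ρStar lam ρ) :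
    u ∈ S.domain α b K r₀ lam ρ ↔ u ∈ S.pathSpace α b K ∧ S.energy α b r₀ lam ρ u < ⊤ := by
  constructor
  · rintro ⟨h1, h2, a, ha, h3⟩
    have hu : u ∈ S.pathSpace α b K := ⟨h1, h2⟩
    exact ⟨hu, by rwa [tendsto_nhds_unique (h.tendsto_energy hR hu) h3]⟩
  · rintro ⟨hu, h1⟩
    exact ⟨hu.1, hu.2, _, h1, h.tendsto_energy hR hu⟩

theorem energy_add_le (h : S.Admissible α b K)
    (hR : S.IsBoundedSequence α b r₀ lamStar ρStar lam ρ) (hu : u ∈ S.pathSpace α b K)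
    (hv : v ∈ S.pathSpace α b K) :
    S.energy α b r₀ lam ρ (u + v) ≤ 2 * S.energy α b r₀ lam ρ u + 2 * S.energy α b r₀ lam ρ v := by
  have huv := (S.pathSpace α b K).add_mem hu hv
  refine le_of_tendsto (h.tendsto_energy hR huv) (Eventually.of_forall fun n => ?_)
  have h1 := (h.isQuadOn_approxEnergy hR n).map_add_le (fun _ _ => ENNReal.toReal_nonneg) hu hv
  calc S.approxEnergy α b r₀ lam ρ n (u + v)
      ≤ 2 * S.approxEnergy α b r₀ lam ρ n u + 2 * S.approxEnergy α b r₀ lam ρ n v := by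
        have hu' := h.approxEnergy_ne_top hR n hu
        have hv' := h.approxEnergy_ne_top hR n hv
        rw [← ENNReal.toReal_le_toReal (h.approxEnergy_ne_top hR n huv) (by finiteness),
          ENNReal.toReal_add (by finiteness) (by finiteness), ENNReal.toReal_mul,
          ENNReal.toReal_mul]
        exact h1
    _ ≤ _ := by
        gcongr
        · exact h.approxEnergy_le_energy hR hu n
        · exact h.approxEnergy_le_energy hR hv n

theorem energy_smul (h : S.Admissible α b K)
    (hR : S.IsBoundedSequence α b r₀ lamStar ρStar lam ρ) (c : ℝ) (hu : u ∈ S.pathSpace α b K) :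
    S.energy α b r₀ lam ρ (c • u) = ENNReal.ofReal (c ^ 2) * S.energy α b r₀ lam ρ u := by
  have hcu := (S.pathSpace α b K).smul_mem c hu
  refine tendsto_nhds_unique (h.tendsto_energy hR hcu) ?_
  refine (ENNReal.Tendsto.const_mul (h.tendsto_energy hR hu)
    (Or.inr ENNReal.ofReal_ne_top)).congr fun n => ?_
  have h1 := (h.isQuadOn_approxEnergy hR n).map_smul_sq c hu
  rw [← ENNReal.toReal_eq_toReal_iff' (ENNReal.mul_ne_top ENNReal.ofReal_ne_top
    (h.approxEnergy_ne_top hR n hu)) (h.approxEnergy_ne_top hR n hcu), ENNReal.toReal_mul,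
    ENNReal.toReal_ofReal (sq_nonneg c)]
  exact h1.symm

/-- The domain of the limit energy as a subspace. -/
def domainSubmodule (h : S.Admissible α b K)
    (hR : S.IsBoundedSequence α b r₀ lamStar ρStar lam ρ) :
    Submodule ℝ (EuclideanSpace ℝ (Fin d) → ℝ) where
  carrier := S.domain α b K r₀ lam ρ
  add_mem' := by
    intro u v hu hv
    rw [h.mem_domain_iff hR] at hu hv ⊢
    refine ⟨(S.pathSpace α b K).add_mem hu.1 hv.1, (h.energy_add_le hR hu.1 hv.1).trans_lt ?_⟩
    have := hu.2.ne
    have := hv.2.ne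
    finiteness
  zero_mem' := by
    have h0 := (S.pathSpace α b K).zero_mem
    rw [h.mem_domain_iff hR]
    refine ⟨h0, ?_⟩
    have := h.energy_smul hR 0 h0
    rw [zero_smul, zero_pow two_ne_zero, ENNReal.ofReal_zero, zero_mul] at this
    rw [this]
    exact ENNReal.zero_lt_top
  smul_mem' := by
    intro c u hu
    rw [h.mem_domain_iff hR] at hu ⊢
    refine ⟨(S.pathSpace α b K).smul_mem c hu.1, ?_⟩
    rw [h.energy_smul hR c hu.1]
    exact ENNReal.mul_lt_top ENNReal.ofReal_lt_top hu.2

theorem mem_domainSubmodule (h : S.Admissible α b K)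
    (hR : S.IsBoundedSequence α b r₀ lamStar ρStar lam ρ) :
    u ∈ h.domainSubmodule hR ↔ u ∈ S.pathSpace α b K ∧ S.energy α b r₀ lam ρ u < ⊤ :=
  h.mem_domain_iff hR

theorem isQuadOn_energy (h : S.Admissible α b K)
    (hR : S.IsBoundedSequence α b r₀ lamStar ρStar lam ρ) :
    IsQuadOn (h.domainSubmodule hR) fun u => (S.energy α b r₀ lam ρ u).toReal := by
  refine IsQuadOn.of_tendsto (fun n => (h.isQuadOn_approxEnergy hR n).mono
    fun u hu => ((h.mem_domainSubmodule hR).1 hu).1) fun u hu => ?_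
  rw [h.mem_domainSubmodule hR] at hu
  exact (ENNReal.tendsto_toReal hu.2.ne).comp (h.tendsto_energy hR hu.1)

theorem energy_contraction (h : S.Admissible α b K)
    (hR : S.IsBoundedSequence α b r₀ lamStar ρStar lam ρ) {φ : ℝ → ℝ}
    (hφ : IsMonotoneContraction φ) (hu : u ∈ S.pathSpace α b K) :
    S.energy α b r₀ lam ρ (φ ∘ u) + S.energy α b r₀ lam ρ (u - φ ∘ u) ≤
      S.energy α b r₀ lam ρ u := by
  have h1 := pathSpace.contraction hφ hu
  exact le_of_tendsto_of_tendsto' ((h.tendsto_energy hR h1).add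
    (h.tendsto_energy hR ((S.pathSpace α b K).sub_mem hu h1))) (h.tendsto_energy hR hu)
    fun n => h.approxEnergy_contraction hR n hφ hu

theorem domain_contraction (h : S.Admissible α b K)
    (hR : S.IsBoundedSequence α b r₀ lamStar ρStar lam ρ) {φ : ℝ → ℝ}
    (hφ : IsMonotoneContraction φ) (hu : u ∈ h.domainSubmodule hR) :
    φ ∘ u ∈ h.domainSubmodule hR ∧ (S.energy α b r₀ lam ρ (φ ∘ u)).toReal +
      (S.energy α b r₀ lam ρ (u - φ ∘ u)).toReal ≤ (S.energy α b r₀ lam ρ u).toReal := by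
  rw [h.mem_domainSubmodule hR] at hu ⊢
  have h1 := h.energy_contraction hR hφ hu.1
  have h2 := (le_self_add.trans h1).trans_lt hu.2
  have h3 := (le_add_self.trans h1).trans_lt hu.2
  refine ⟨⟨pathSpace.contraction hφ hu.1, h2⟩, ?_⟩
  rw [← ENNReal.toReal_add h2.ne h3.ne]
  exact ENNReal.toReal_mono hu.2.ne h1

theorem pathSpace_congr (h : S.Admissible α b K) (hu : u ∈ S.pathSpace α b K) (huv : EqOn u v K) :
    v ∈ S.pathSpace α b K :=
  ⟨hu.1.congr huv.symm, fun l hl w => (hu.2 l hl w).congr fun _ ht =>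
    huv (h.word_mem w _ (h.lineCurve_mem hl ht))⟩

theorem energy_congr (h : S.Admissible α b K)
    (hR : S.IsBoundedSequence α b r₀ lamStar ρStar lam ρ) (huv : EqOn u v K) :
    S.energy α b r₀ lam ρ u = S.energy α b r₀ lam ρ v := by
  simp only [energy, fun n => h.approxEnergy_congr hR n huv]

theorem tendsto_energy_sub_clamp (h : S.Admissible α b K)
    (hR : S.IsBoundedSequence α b r₀ lamStar ρStar lam ρ) {ε : ℕ → ℝ} (hε : ∀ n, 0 < ε n)
    (hlim : Tendsto ε atTop (𝓝 0)) (hu : u ∈ S.pathSpace α b K) :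
    Tendsto (fun n => S.energy α b r₀ lam ρ (u - clamp (ε n) ∘ u)) atTop
      (𝓝 (S.energy α b r₀ lam ρ u)) := by
  have hφ := fun n => isMonotoneContraction_clamp_symm (ε n)
  have hmem : ∀ n, u - clamp (ε n) ∘ u ∈ S.pathSpace α b K := fun n =>
    (S.pathSpace α b K).sub_mem hu (pathSpace.contraction (hφ n) hu)
  have hle : ∀ n, S.energy α b r₀ lam ρ (u - clamp (ε n) ∘ u) ≤ S.energy α b r₀ lam ρ u :=
    fun n => le_add_self.trans (h.energy_contraction hR (hφ n) hu)
  have happ : ∀ k, Tendsto (fun n => S.approxEnergy α b r₀ lam ρ k (u - clamp (ε n) ∘ u)) atTop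
      (𝓝 (S.approxEnergy α b r₀ lam ρ k u)) := fun k => by
    refine h.tendsto_approxEnergy hR k (fun x _ => ?_) fun l hl w =>
      tendsto_dirichletEnergy_sub_clamp (hu.2 l hl w) hε hlim
    have h1 : Tendsto (fun n => clamp (ε n) (u x)) atTop (𝓝 0) :=
      squeeze_zero_norm (fun n => abs_clamp_le (hε n).le _) hlim
    simpa using h1.const_sub (u x)
  refine tendsto_order.2 ⟨fun a ha => ?_, fun a ha => Eventually.of_forall fun n =>
    (hle n).trans_lt ha⟩
  -- Lower semicontinuity: some finite level already exceeds `a`, and that level converges under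
  -- truncation. The upper bound is the contraction inequality.
  obtain ⟨k, hk⟩ := ((h.tendsto_energy hR hu).eventually (lt_mem_nhds ha)).exists
  filter_upwards [(happ k).eventually (lt_mem_nhds hk)] with n hn
  exact hn.trans_le (h.approxEnergy_le_energy hR (hmem n) k)

/-- A Fatou argument: at each fixed level the energy of `f m - f n` converges as `m → ∞`, the Cauchy
bound is kept, and then the level tends to infinity. -/
theorem domain_complete (h : S.Admissible α b K)
    (hR : S.IsBoundedSequence α b r₀ lamStar ρStar lam ρ) {f : ℕ → EuclideanSpace ℝ (Fin d) → ℝ}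
    (hf : ∀ n, f n ∈ h.domainSubmodule hR) (hfv : TendstoUniformlyOn f v atTop K)
    (hC : ∀ ε > (0 : ℝ), ∃ M, ∀ m ≥ M, ∀ n ≥ M,
      (S.energy α b r₀ lam ρ (f m - f n)).toReal < ε) :
    v ∈ h.domainSubmodule hR ∧
      Tendsto (fun n => (S.energy α b r₀ lam ρ (f n - v)).toReal) atTop (𝓝 0) := by
  have hfp : ∀ n, f n ∈ S.pathSpace α b K := fun n => ((h.mem_domainSubmodule hR).1 (hf n)).1
  have hsub : ∀ m n, f m - f n ∈ S.pathSpace α b K ∧ S.energy α b r₀ lam ρ (f m - f n) < ⊤ :=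
    fun m n => (h.mem_domainSubmodule hR).1 ((h.domainSubmodule hR).sub_mem (hf m) (hf n))
  have hC' : ∀ ε > (0 : ℝ), ∃ M, ∀ m ≥ M, ∀ n ≥ M,
      S.energy α b r₀ lam ρ (f m - f n) ≤ ENNReal.ofReal ε := fun ε hε => by
    obtain ⟨M, hM⟩ := hC ε hε
    exact ⟨M, fun m hm n hn => ENNReal.le_ofReal_iff_toReal_le (hsub m n).2.ne hε.le |>.2
      (hM m hm n hn).le⟩
  have hpt : ∀ x ∈ K, Tendsto (fun n => f n x) atTop (𝓝 (v x)) := fun x hx =>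
    hfv.tendsto_at hx
  have hline : ∀ l ∈ S.lines, ∀ w : List (Fin N),
      IsH1 (v ∘ wordMap (S.stretch α) w ∘ S.lineCurve α b l) ∧ ∀ k : ℝ → ℝ, IsH1 k →
      Tendsto (fun n => dirichletEnergy (f n ∘ wordMap (S.stretch α) w ∘ S.lineCurve α b l - k))
        atTop (𝓝 (dirichletEnergy (v ∘ wordMap (S.stretch α) w ∘ S.lineCurve α b l - k))) := by
    intro l hl w
    refine isH1_of_cauchy (fun n => (hfp n).2 l hl w)
      (fun t ht => hpt _ (h.word_mem w _ (h.lineCurve_mem hl ht))) fun ε hε => ?_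
    -- Line energies are at most `ρStar` times the energy; `|ρStar| + 1` is a positive bound for
    -- this factor.
    have hpos : 0 < ε / (|ρStar| + 1) := by positivity
    obtain ⟨M, hM⟩ := hC' _ hpos
    refine ⟨M, fun m hm n hn => ?_⟩
    refine (dirichletEnergy_word_le hR w hl (u := f m - f n)).trans ?_
    calc ENNReal.ofReal ρStar * S.approxEnergy α b r₀ lam ρ (w.length + 1) (f m - f n)
        ≤ ENNReal.ofReal (|ρStar| + 1) * ENNReal.ofReal (ε / (|ρStar| + 1)) := by
          gcongr
          · linarith [le_abs_self ρStar]
          · exact (h.approxEnergy_le_energy hR (hsub m n).1 _).trans (hM m hm n hn)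
      _ = ENNReal.ofReal ε := by
          rw [← ENNReal.ofReal_mul (by positivity)]
          congr 1
          field_simp
  have hvp : v ∈ S.pathSpace α b K :=
    ⟨hfv.continuousOn (Frequently.of_forall fun n => (hfp n).1), fun l hl w => (hline l hl w).1⟩
  have hle : ∀ ε > (0 : ℝ), ∃ M, ∀ n ≥ M,
      S.energy α b r₀ lam ρ (v - f n) ≤ ENNReal.ofReal ε := by
    intro ε hε
    obtain ⟨M, hM⟩ := hC' ε hε
    refine ⟨M, fun n hn => ?_⟩
    have hvn := (S.pathSpace α b K).sub_mem hvp (hfp n)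
    refine le_of_tendsto (h.tendsto_energy hR hvn) (Eventually.of_forall fun k => ?_)
    refine le_of_tendsto (h.tendsto_approxEnergy hR k (v := fun m => f m - f n)
      (fun x hx => (hpt x hx).sub_const _)
      fun l hl w => (hline l hl w).2 _ ((hfp n).2 l hl w)) ?_
    filter_upwards [eventually_ge_atTop M] with m hm
    exact (h.approxEnergy_le_energy hR (hsub m n).1 k).trans (hM m hm n hn)
  have hmem : ∀ n, S.energy α b r₀ lam ρ (v - f n) < ⊤ → v ∈ h.domainSubmodule hR := by
    intro n hn
    have h1 : v - f n ∈ h.domainSubmodule hR :=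
      (h.mem_domainSubmodule hR).2 ⟨(S.pathSpace α b K).sub_mem hvp (hfp n), hn⟩
    simpa using (h.domainSubmodule hR).add_mem h1 (hf n)
  obtain ⟨M, hM⟩ := hle 1 one_pos
  have hv := hmem M ((hM M le_rfl).trans_lt ENNReal.ofReal_lt_top)
  refine ⟨hv, Metric.tendsto_atTop.2 fun ε hε => ?_⟩
  obtain ⟨M, hM⟩ := hle (ε / 2) (half_pos hε)
  refine ⟨M, fun n hn => ?_⟩
  have h1 := ENNReal.toReal_mono ENNReal.ofReal_ne_top (hM n hn)
  rw [ENNReal.toReal_ofReal (half_pos hε).le] at h1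
  have h2 := (h.isQuadOn_energy hR).neg _ ((h.domainSubmodule hR).sub_mem hv (hf n))
  simp only [neg_sub] at h2
  rw [Real.dist_eq, sub_zero, abs_of_nonneg ENNReal.toReal_nonneg, h2]
  linarith

end Admissible

end SelfSimilarSet

namespace SelfSimilarSet

/-! ### Density of the domain in the continuous functions -/

variable {d N : ℕ} {S : SelfSimilarSet d N} {α : ℝ}
  {b : EuclideanSpace ℝ (Fin d) → EuclideanSpace ℝ (Fin d)}
  {r₀ : Sym2 (EuclideanSpace ℝ (Fin d)) → ℝ≥0∞} {lamStar ρStar : ℝ} {lam : ℕ → ℝ}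
  {ρ : ℕ → Fin N × EuclideanSpace ℝ (Fin d) → ℝ} {K : Set (EuclideanSpace ℝ (Fin d))}
  {u v : EuclideanSpace ℝ (Fin d) → ℝ}

theorem const_mem_pathSpace (c : ℝ) : (fun _ => c) ∈ S.pathSpace α b K :=
  ⟨continuousOn_const, fun _ _ _ => isH1_of_contDiff contDiff_const⟩

theorem approxEnergy_const (hR : S.IsBoundedSequence α b r₀ lamStar ρStar lam ρ) (n : ℕ) (c : ℝ) :
    S.approxEnergy α b r₀ lam ρ n (fun _ => c) = 0 := by
  induction n generalizing lam ρ with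
  | zero =>
    rw [approxEnergy_zero, cellForm, ENNReal.tsum_eq_zero]
    rintro ⟨e, -⟩
    induction e using Sym2.ind with
    | _ x y => simp [edgeSq]
  | succ n ih =>
    rw [hR.succ]
    have h1 : ∀ i, (fun _ => c) ∘ S.stretch α i = fun _ => c := fun _ => rfl
    have h2 : S.lineForm α b (ρ 0) (fun _ => c) = 0 := by
      rw [lineForm, ENNReal.tsum_eq_zero]
      intro l
      have h3 : (fun _ => c) ∘ S.lineCurve α b l = fun _ => c := rfl
      simp [h3, dirichletEnergy]
    simp only [h1, h2, ih hR.shift, Finset.sum_const_zero, mul_zero, add_zero]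

/-- `u` is constant on every `n`-cell. -/
def IsCellConstant (S : SelfSimilarSet d N) (α : ℝ) (K : Set (EuclideanSpace ℝ (Fin d))) (n : ℕ)
    (u : EuclideanSpace ℝ (Fin d) → ℝ) : Prop :=
  ∀ w : List (Fin N), w.length = n → ∃ c, ∀ x ∈ K, u (wordMap (S.stretch α) w x) = c

theorem IsCellConstant.comp_stretch {n : ℕ} (hu : S.IsCellConstant α K (n + 1) u) (i : Fin N) :
    S.IsCellConstant α K n (u ∘ S.stretch α i) := fun w hw =>
  hu (i :: w) (by rw [List.length_cons, hw])

namespace Admissible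

/-- Beyond level `n` only the interiors of the `n`-cells are refined, where the function is constant
and carries no energy. -/
theorem approxEnergy_add_of_isCellConstant (h : S.Admissible α b K)
    (hR : S.IsBoundedSequence α b r₀ lamStar ρStar lam ρ) {n : ℕ}
    (hu : S.IsCellConstant α K n u) (m : ℕ) :
    S.approxEnergy α b r₀ lam ρ (n + m) u = S.approxEnergy α b r₀ lam ρ n u := by
  induction n generalizing lam ρ u with
  | zero =>
    obtain ⟨c, hc⟩ := hu [] rfl
    have h1 : EqOn u (fun _ => c) K := hc
    rw [h.approxEnergy_congr hR _ h1, h.approxEnergy_congr hR _ h1, approxEnergy_const hR,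
      approxEnergy_const hR]
  | succ n ih =>
    rw [Nat.add_right_comm, hR.succ, hR.succ]
    simp only [fun i => ih hR.shift (hu.comp_stretch i)]

theorem mem_domainSubmodule_of_isCellConstant (h : S.Admissible α b K)
    (hR : S.IsBoundedSequence α b r₀ lamStar ρStar lam ρ) (hu : u ∈ S.pathSpace α b K) {n : ℕ}
    (hc : S.IsCellConstant α K n u) : u ∈ h.domainSubmodule hR := by
  rw [h.mem_domainSubmodule hR]
  refine ⟨hu, lt_of_le_of_lt (le_of_tendsto (h.tendsto_energy hR hu) ?_)
    (h.approxEnergy_ne_top hR n hu).lt_top⟩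
  filter_upwards [eventually_ge_atTop n] with k hk
  obtain ⟨m, rfl⟩ := Nat.exists_eq_add_of_le hk
  exact (h.approxEnergy_add_of_isCellConstant hR hc m).le

/-- A `C¹` function on the unit interval with prescribed end values that is close to a given
continuous function. -/
theorem exists_contDiff_near {g : ℝ → ℝ} (hg : ContinuousOn g (Icc 0 1)) {a c ε δ : ℝ}
    (hδ : 0 < δ) (ha : |a - g 0| ≤ ε) (hc : |c - g 1| ≤ ε) :
    ∃ f : ℝ → ℝ, ContDiff ℝ 1 f ∧ f 0 = a ∧ f 1 = c ∧
      ∀ t ∈ Icc (0 : ℝ) 1, |f t - g t| ≤ ε + δ := by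
  -- A Weierstrass approximation plus the affine function correcting its end values. The correction
  -- is at most `ε + δ / 2` at both ends, hence throughout.
  obtain ⟨p, hp⟩ := exists_polynomial_near_of_continuousOn 0 1 g hg (δ / 2) (half_pos hδ)
  refine ⟨fun t => p.eval t + ((1 - t) * (a - p.eval 0) + t * (c - p.eval 1)), ?_, by simp, by simp,
    fun t ht => ?_⟩
  · have : ContDiff ℝ 1 fun t => p.eval t := by
      simpa only [Polynomial.coe_aeval_eq_eval] using Polynomial.contDiff_aeval (R := ℝ) (𝕜 := ℝ) p 1
    fun_prop
  · have h0 := (abs_lt.1 (hp 0 ⟨le_rfl, zero_le_one⟩))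
    have h1 := (abs_lt.1 (hp 1 ⟨zero_le_one, le_rfl⟩))
    have h2 := (abs_lt.1 (hp t ht))
    rw [abs_le] at ha hc
    have e1 : |(1 - t) * (a - p.eval 0)| ≤ (1 - t) * (ε + δ / 2) := by
      rw [abs_mul, abs_of_nonneg (by linarith [ht.2])]
      have : |a - p.eval 0| ≤ ε + δ / 2 := abs_le.2 ⟨by linarith, by linarith⟩
      have := ht.2
      gcongr
    have e2 : |t * (c - p.eval 1)| ≤ t * (ε + δ / 2) := by
      rw [abs_mul, abs_of_nonneg ht.1]
      have : |c - p.eval 1| ≤ ε + δ / 2 := abs_le.2 ⟨by linarith, by linarith⟩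
      have := ht.1
      gcongr
    rw [abs_le] at e1 e2 ⊢
    constructor <;> nlinarith

/-- Each 1-cell is treated by induction. The connecting lines receive `C¹` functions that start at
the value already fixed in the cell and end at the value of `φ` at the critical point, which is the
same for all lines meeting there. -/
theorem exists_isCellConstant_near (h : S.Admissible α b K) (n : ℕ)
    {φ : EuclideanSpace ℝ (Fin d) → ℝ} (hφ : ContinuousOn φ K) {ε : ℝ} (hε : 0 ≤ ε)
    (hosc : ∀ w : List (Fin N), w.length = n → ∀ x ∈ K, ∀ y ∈ K,
      |φ (wordMap (S.stretch α) w x) - φ (wordMap (S.stretch α) w y)| ≤ ε) {ε' : ℝ}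
    (hε' : ε < ε') :
    ∃ u ∈ S.pathSpace α b K, S.IsCellConstant α K n u ∧ ∀ x ∈ K, |u x - φ x| ≤ ε' := by
  induction n generalizing φ ε' with
  | zero =>
    obtain ⟨x₀, hx₀⟩ := h.fractal.nonempty
    exact ⟨fun _ => φ x₀, const_mem_pathSpace _, fun _ _ => ⟨φ x₀, fun _ _ => rfl⟩,
      fun x hx => (hosc [] rfl x₀ hx₀ x hx).trans hε'.le⟩
  | succ n ih =>
    -- Half of the gap goes to the cells, the rest to the lines; the strict inequality `ε < ε'`
    -- leaves room at every level.
    set ε'' := (ε + ε') / 2 with hε''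
    have h1 : ∀ i : Fin N, ∃ u ∈ S.pathSpace α b K, S.IsCellConstant α K n u ∧
        ∀ x ∈ K, |u x - φ (S.stretch α i x)| ≤ ε'' := fun i =>
      ih (φ := φ ∘ S.stretch α i) (hφ.comp (continuous_stretch α i).continuousOn (h.stretch_mem i))
        (fun w hw => hosc (i :: w) (by rw [List.length_cons, hw])) (by linarith)
    choose u hu huc huφ using h1
    have h2 : ∀ l : Fin N × EuclideanSpace ℝ (Fin d), ∃ f : ℝ → ℝ, l ∈ S.lines →
        ContDiff ℝ 1 f ∧ f 0 = u l.1 (b l.2) ∧ f 1 = φ (S.critEnd l) ∧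
          ∀ t ∈ Icc (0 : ℝ) 1, |f t - φ (S.lineCurve α b l t)| ≤ ε' := by
      intro l
      by_cases hl : l ∈ S.lines
      · have hg : ContinuousOn (φ ∘ S.lineCurve α b l) (Icc 0 1) :=
          hφ.comp (continuous_lineCurve α b l).continuousOn fun t ht => h.lineCurve_mem hl ht
        obtain ⟨f, hf, hf0, hf1, hfg⟩ := exists_contDiff_near hg (a := u l.1 (b l.2))
          (c := φ (S.critEnd l)) (ε := ε'') (δ := ε' - ε'') (by linarith)
          (by
            rw [Function.comp_apply, lineCurve_zero]
            exact huφ l.1 _ (h.vertices_subset (snd_vertex hl)))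
          (by rw [Function.comp_apply, lineCurve_one, sub_self, abs_zero]; linarith)
        exact ⟨f, fun _ => ⟨hf, hf0, hf1, fun t ht => (hfg t ht).trans (by linarith)⟩⟩
      · exact ⟨0, fun h' => absurd h' hl⟩
    choose f hf using h2
    obtain ⟨v, hvc, hv1, hv2⟩ := h.exists_glue u (fun i => (hu i).1) f
      (fun l hl => (hf l hl).1.continuous.continuousOn) φ (fun l hl => (hf l hl).2.1)
      (fun l hl => (hf l hl).2.2.1)
    refine ⟨v, ⟨hvc, fun l hl w => ?_⟩, fun w hw => ?_, fun x hx => ?_⟩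
    · cases w with
      | nil => exact (isH1_of_contDiff (hf l hl).1).congr fun t ht => (hv2 l hl t ht).symm
      | cons i w =>
        exact ((hu i).2 l hl w).congr fun t ht =>
          (hv1 i _ (h.word_mem w _ (h.lineCurve_mem hl ht))).symm
    · cases w with
      | nil => simp at hw
      | cons i w =>
        obtain ⟨c, hc⟩ := huc i w (by simpa using hw)
        exact ⟨c, fun x hx => (hv1 i _ (h.word_mem w x hx)).trans (hc x hx)⟩
    · rcases h.mem_cases hx with ⟨i, y, hy, rfl⟩ | ⟨l, hl, t, ht, rfl⟩
      · rw [hv1 i y hy]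
        exact (huφ i y hy).trans (by linarith)
      · rw [hv2 l hl t ht]
        exact (hf l hl).2.2.2 t ht

theorem domain_dense (h : S.Admissible α b K)
    (hR : S.IsBoundedSequence α b r₀ lamStar ρStar lam ρ) {φ : EuclideanSpace ℝ (Fin d) → ℝ}
    (hφ : ContinuousOn φ K) {ε : ℝ} (hε : 0 < ε) :
    ∃ u ∈ h.domainSubmodule hR, ∀ x ∈ K, |u x - φ x| < ε := by
  obtain ⟨n, hn⟩ := h.exists_osc_le hφ (ε := ε / 4) (by positivity)
  obtain ⟨u, hu, huc, huφ⟩ := h.exists_isCellConstant_near n hφ (by positivity) hn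
    (show ε / 4 < ε / 2 by linarith)
  exact ⟨u, h.mem_domainSubmodule_of_isCellConstant hR hu huc,
    fun x hx => (huφ x hx).trans_lt (by linarith)⟩

end Admissible

end SelfSimilarSet

namespace SelfSimilarSet

/-! ### The resistance estimate -/

/-- The difference of the values of `u` at `x` and `y` is at most a constant times `e` whenever
`Φ u e` holds. -/
def Controlled {X : Type*} (Φ : (X → ℝ) → ℝ → Prop) (x y : X) : Prop :=
  ∃ C : ℝ, 0 ≤ C ∧ ∀ u e, 0 ≤ e → Φ u e → |u x - u y| ≤ C * e

namespace Controlled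

variable {X : Type*} {Φ : (X → ℝ) → ℝ → Prop} {x y z : X}

theorem refl (x : X) : Controlled Φ x x := ⟨0, le_rfl, fun u e _ _ => by simp⟩

theorem symm (h : Controlled Φ x y) : Controlled Φ y x := by
  obtain ⟨C, hC, H⟩ := h
  exact ⟨C, hC, fun u e he hu => by rw [abs_sub_comm]; exact H u e he hu⟩

theorem trans (h : Controlled Φ x y) (h' : Controlled Φ y z) : Controlled Φ x z := by
  obtain ⟨C, hC, H⟩ := h
  obtain ⟨C', hC', H'⟩ := h'
  refine ⟨C + C', add_nonneg hC hC', fun u e he hu => ?_⟩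
  calc |u x - u z| ≤ |u x - u y| + |u y - u z| := abs_sub_le _ _ _
    _ ≤ C * e + C' * e := add_le_add (H u e he hu) (H' u e he hu)
    _ = (C + C') * e := by ring

theorem exists_uniform {A : Set X} (hA : A.Finite) (h : ∀ x ∈ A, ∀ y ∈ A, Controlled Φ x y) :
    ∃ C : ℝ, 0 ≤ C ∧ ∀ u e, 0 ≤ e → Φ u e → ∀ x ∈ A, ∀ y ∈ A, |u x - u y| ≤ C * e := by
  have := hA.fintype
  have h' : ∀ p : A × A, ∃ C : ℝ, 0 ≤ C ∧ ∀ u e, 0 ≤ e → Φ u e → |u p.1 - u p.2| ≤ C * e :=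
    fun p => h p.1 p.1.2 p.2 p.2.2
  choose C hC H using h'
  refine ⟨∑ p, C p, Finset.sum_nonneg fun p _ => hC p, fun u e he hu x hx y hy => ?_⟩
  refine (H (⟨x, hx⟩, ⟨y, hy⟩) u e he hu).trans ?_
  gcongr
  exact Finset.single_le_sum (f := C) (fun p _ => hC p) (Finset.mem_univ _)

end Controlled

variable {d N : ℕ} {S : SelfSimilarSet d N} {α : ℝ}
  {b : EuclideanSpace ℝ (Fin d) → EuclideanSpace ℝ (Fin d)}
  {r₀ : Sym2 (EuclideanSpace ℝ (Fin d)) → ℝ≥0∞} {lamStar ρStar : ℝ} {lam : ℕ → ℝ}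
  {ρ : ℕ → Fin N × EuclideanSpace ℝ (Fin d) → ℝ} {K : Set (EuclideanSpace ℝ (Fin d))}
  {u v : EuclideanSpace ℝ (Fin d) → ℝ}

theorem abs_le_of_ofReal_sq_le {a c e : ℝ} (hc : 0 ≤ c) (he : 0 ≤ e)
    (h : ENNReal.ofReal (a ^ 2) ≤ ENNReal.ofReal c * ENNReal.ofReal (e ^ 2)) :
    |a| ≤ √c * e := by
  rw [← ENNReal.ofReal_mul hc, ENNReal.ofReal_le_ofReal_iff (by positivity)] at h
  refine abs_le_of_sq_le_sq ?_ (by positivity)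
  rwa [mul_pow, Real.sq_sqrt hc]

/-- The square roots of the resistances are added along a path of finite resistance. Only `r₀`
enters the constant, so it is common to all structures of a sequence. -/
theorem IsHarmonicStructure.controlled {c : ℝ} {ρ : Fin N × EuclideanSpace ℝ (Fin d) → ℝ}
    (hr : S.IsHarmonicStructure α b r₀ c ρ) {x y : EuclideanSpace ℝ (Fin d)}
    (hx : x ∈ S.vertices b) (hy : y ∈ S.vertices b) :
    Controlled (fun u e => S.cellForm b r₀ u ≤ ENNReal.ofReal (e ^ 2)) x y := by
  have h1 := hr.connected x hx y hy
  clear hx hy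
  induction h1 with
  | refl => exact .refl _
  | @tail p p' _ hpp' ih =>
    refine ih.trans ⟨√(r₀ s(p, p')).toReal, Real.sqrt_nonneg _, fun u e he hu => ?_⟩
    refine abs_le_of_ofReal_sq_le ENNReal.toReal_nonneg he ?_
    rw [ENNReal.ofReal_toReal hpp'.2.ne]
    have h2 : (r₀ s(p, p'))⁻¹ * ENNReal.ofReal ((u p - u p') ^ 2) ≤ ENNReal.ofReal (e ^ 2) :=
      le_trans (ENNReal.le_tsum (f := fun e : S.edges b => (r₀ e)⁻¹ * edgeSq u (e : Sym2 _))
        ⟨s(p, p'), hpp'.1⟩) hu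
    calc ENNReal.ofReal ((u p - u p') ^ 2)
        = r₀ s(p, p') * ((r₀ s(p, p'))⁻¹ * ENNReal.ofReal ((u p - u p') ^ 2)) := by
          rw [← mul_assoc, ENNReal.mul_inv_cancel (hr.r₀_pos _ hpp'.1).ne' hpp'.2.ne, one_mul]
      _ ≤ _ := by gcongr

/-- `u` is a function whose energy on the first network is at most `e²` for some sequence within
the given bounds. -/
def HasFirstEnergyLE (S : SelfSimilarSet d N) (α : ℝ)
    (b : EuclideanSpace ℝ (Fin d) → EuclideanSpace ℝ (Fin d))
    (K : Set (EuclideanSpace ℝ (Fin d))) (r₀ : Sym2 (EuclideanSpace ℝ (Fin d)) → ℝ≥0∞)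
    (lamStar ρStar : ℝ) (u : EuclideanSpace ℝ (Fin d) → ℝ) (e : ℝ) : Prop :=
  u ∈ S.pathSpace α b K ∧ ∃ lam ρ, S.IsBoundedSequence α b r₀ lamStar ρStar lam ρ ∧
    S.approxEnergy α b r₀ lam ρ 1 u ≤ ENNReal.ofReal (e ^ 2)

theorem HasFirstEnergyLE.line {e : ℝ} (hu : S.HasFirstEnergyLE α b K r₀ lamStar ρStar u e)
    (he : 0 ≤ e) {l : Fin N × EuclideanSpace ℝ (Fin d)} (hl : l ∈ S.lines) {s t : ℝ}
    (hs : s ∈ Icc (0 : ℝ) 1) (ht : t ∈ Icc (0 : ℝ) 1) :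
    |u (S.lineCurve α b l t) - u (S.lineCurve α b l s)| ≤ √|ρStar| * e := by
  obtain ⟨hup, lam, ρ, hR, hE⟩ := hu
  refine abs_le_of_ofReal_sq_le (abs_nonneg _) he ?_
  refine ((pathSpace.isH1_line hup hl).sq_sub_le hs ht).trans ?_
  refine (Admissible.dirichletEnergy_line_le hR 0 hl).trans ?_
  gcongr
  exact le_abs_self _

theorem HasFirstEnergyLE.comp_stretch {e : ℝ}
    (hu : S.HasFirstEnergyLE α b K r₀ lamStar ρStar u e) (i : Fin N) :
    S.cellForm b r₀ (u ∘ S.stretch α i) ≤ ENNReal.ofReal (e ^ 2) := by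
  obtain ⟨hup, lam, ρ, hR, hE⟩ := hu
  have h1 := Admissible.approxEnergy_comp_le hR 0 i (u := u)
  rw [approxEnergy_zero] at h1
  refine h1.trans (le_trans (mul_le_of_le_one_left zero_le ?_) hE)
  rw [ENNReal.ofReal_le_one]
  exact (hR.harmonic 0).lam_lt_one.le

namespace Admissible

theorem controlled_cell {c : ℝ} {ρ : Fin N × EuclideanSpace ℝ (Fin d) → ℝ}
    (hr : S.IsHarmonicStructure α b r₀ c ρ) (i : Fin N) {x y : EuclideanSpace ℝ (Fin d)}
    (hx : x ∈ S.vertices b) (hy : y ∈ S.vertices b) :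
    Controlled (S.HasFirstEnergyLE α b K r₀ lamStar ρStar) (S.stretch α i x)
      (S.stretch α i y) := by
  obtain ⟨C, hC, H⟩ := hr.controlled hx hy
  exact ⟨C, hC, fun u e he hu => H (u ∘ S.stretch α i) e he (hu.comp_stretch i)⟩

theorem controlled_line {l : Fin N × EuclideanSpace ℝ (Fin d)} (hl : l ∈ S.lines) :
    Controlled (S.HasFirstEnergyLE α b K r₀ lamStar ρStar) (S.critEnd l) (S.cellEnd α b l) := by
  refine ⟨√|ρStar|, Real.sqrt_nonneg _, fun u e he hu => ?_⟩
  have := hu.line he hl (s := 0) (t := 1) ⟨le_rfl, zero_le_one⟩ ⟨zero_le_one, le_rfl⟩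
  rwa [lineCurve_zero, lineCurve_one] at this

/-- Two different cells of `F` with a common point are joined in the stretched network by two lines
ending at that critical point. Chains of cells supplied by connectedness do the rest. -/
theorem controlled_cells {c : ℝ} {ρ : Fin N × EuclideanSpace ℝ (Fin d) → ℝ}
    (hr : S.IsHarmonicStructure α b r₀ c ρ) (i j : Fin N) {x : EuclideanSpace ℝ (Fin d)}
    (hx : x ∈ S.vertices b) : ∀ y ∈ S.vertices b,
    Controlled (S.HasFirstEnergyLE α b K r₀ lamStar ρStar) (S.stretch α i x)
      (S.stretch α j y) := by
  induction cells_connected S i j with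
  | refl => exact fun y hy => controlled_cell hr i hx hy
  | @tail k j _ hkj ih =>
    intro y hy
    -- A link from a cell to itself need not come from a critical point, but it is superfluous.
    by_cases hne : k = j
    · subst hne
      exact ih y hy
    obtain ⟨z, ⟨p, hp, hpz⟩, ⟨p', hp', hpz'⟩⟩ := hkj
    have hz : z ∈ S.crit := ⟨k, j, hne, ⟨p, hp, hpz⟩, ⟨p', hp', hpz'⟩⟩
    have hl : (k, p) ∈ S.lines := ⟨hp, by change S.map k p ∈ S.crit; rwa [hpz]⟩
    have hl' : (j, p') ∈ S.lines := ⟨hp', by change S.map j p' ∈ S.crit; rwa [hpz']⟩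
    have hcc : S.critEnd (k, p) = S.critEnd (j, p') := hpz.trans hpz'.symm
    have h1 := ih (b p) (snd_vertex hl)
    have h2 := (controlled_line (K := K) (r₀ := r₀) (lamStar := lamStar) (ρStar := ρStar)
      (b := b) (α := α) hl).symm
    rw [hcc] at h2
    exact (h1.trans (h2.trans (controlled_line hl'))).trans
      (controlled_cell hr j (snd_vertex hl') hy)

/-- The resistances between the boundary and all points of the first network are bounded. -/
theorem exists_first_level_bound (h : S.Admissible α b K) {c : ℝ}
    {ρ : Fin N × EuclideanSpace ℝ (Fin d) → ℝ} (hr : S.IsHarmonicStructure α b r₀ c ρ)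
    (lamStar ρStar : ℝ) :
    ∃ C : ℝ, 0 ≤ C ∧ ∀ u e, 0 ≤ e → S.HasFirstEnergyLE α b K r₀ lamStar ρStar u e →
      ∀ v ∈ S.vertices b, (∀ i, ∀ x ∈ S.vertices b, |u (S.stretch α i x) - u v| ≤ C * e) ∧
        ∀ l ∈ S.lines, ∀ t ∈ Icc (0 : ℝ) 1, |u (S.lineCurve α b l t) - u v| ≤ C * e := by
  set A : Set (EuclideanSpace ℝ (Fin d)) := ⋃ i, S.stretch α i '' S.vertices b with hA
  have hAf : A.Finite := finite_iUnion fun i => h.finite_vertices.image _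
  obtain ⟨C, hC, H⟩ := Controlled.exists_uniform hAf
    (Φ := S.HasFirstEnergyLE α b K r₀ lamStar ρStar) (by
      intro x hx y hy
      obtain ⟨i, x', hx', rfl⟩ := mem_iUnion.1 hx
      obtain ⟨j, y', hy', rfl⟩ := mem_iUnion.1 hy
      exact controlled_cells hr i j hx' y' hy')
  have hVA : ∀ v ∈ S.vertices b, v ∈ A := fun v hv => by
    obtain ⟨j, v', hv', rfl⟩ := h.exists_stretch_eq_vertex hv
    exact mem_iUnion.2 ⟨j, v', hv', rfl⟩
  refine ⟨C + √|ρStar|, by positivity, fun u e he hu v hv => ⟨fun i x hx => ?_,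
    fun l hl t ht => ?_⟩⟩
  · refine (H u e he hu _ (mem_iUnion.2 ⟨i, x, hx, rfl⟩) v (hVA v hv)).trans ?_
    gcongr
    exact le_add_of_nonneg_right (Real.sqrt_nonneg _)
  · have h1 := hu.line he hl (s := 0) ⟨le_rfl, zero_le_one⟩ ht
    rw [lineCurve_zero] at h1
    have h2 := H u e he hu (S.cellEnd α b l) (mem_iUnion.2 ⟨l.1, b l.2, snd_vertex hl, rfl⟩) v
      (hVA v hv)
    calc |u (S.lineCurve α b l t) - u v|
        ≤ |u (S.lineCurve α b l t) - u (S.cellEnd α b l)| + |u (S.cellEnd α b l) - u v| :=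
          abs_sub_le _ _ _
      _ ≤ √|ρStar| * e + C * e := add_le_add h1 h2
      _ = (C + √|ρStar|) * e := by ring

/-- Following a point into smaller and smaller cells, each level adds at most `C₁` times the square
root of the remaining energy, which shrinks by `√λ*` per level; the geometric series gives the
constant. -/
theorem exists_osc_bound (h : S.Admissible α b K)
    (hR : S.IsBoundedSequence α b r₀ lamStar ρStar lam ρ) (hlam : lamStar < 1) :
    ∃ C : ℝ, 0 ≤ C ∧ ∀ u ∈ h.domainSubmodule hR, ∀ x ∈ K, ∀ y ∈ K,
      (u x - u y) ^ 2 ≤ C * (S.energy α b r₀ lam ρ u).toReal := by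
  obtain ⟨C₁, hC₁, H⟩ := h.exists_first_level_bound (hR.harmonic 0) lamStar ρStar
  have hlam0 : 0 ≤ lamStar := ((hR.harmonic 0).lam_pos.trans_le (hR.lam_le 0)).le
  set s := √lamStar with hs
  have hs0 : 0 ≤ s := Real.sqrt_nonneg _
  have hs1 : s < 1 := by
    rw [hs, Real.sqrt_lt' one_pos]
    simpa using hlam
  -- The sum of the geometric series, the solution of `C s + C₁ = C` that closes the induction.
  set C := C₁ / (1 - s) with hCdef
  have hC0 : 0 ≤ C := div_nonneg hC₁ (by linarith)
  have hCeq : C * s + C₁ = C := by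
    rw [hCdef]
    have : 1 - s ≠ 0 := by linarith
    field_simp
    ring
  have hC₁C : C₁ ≤ C := by nlinarith
  -- The quantification over sequences lets the induction pass to the shift; `M` bounds the
  -- oscillation on `n`-cells and can later be made arbitrarily small by uniform continuity.
  have key : ∀ n : ℕ, ∀ {lam ρ}, S.IsBoundedSequence α b r₀ lamStar ρStar lam ρ →
      ∀ u ∈ S.pathSpace α b K, ∀ e : ℝ, 0 ≤ e →
      (∀ m, S.approxEnergy α b r₀ lam ρ m u ≤ ENNReal.ofReal (e ^ 2)) → ∀ M : ℝ, 0 ≤ M →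
      (∀ w : List (Fin N), w.length = n → ∀ x ∈ K, ∀ y ∈ K,
        |u (wordMap (S.stretch α) w x) - u (wordMap (S.stretch α) w y)| ≤ M) →
      ∀ x ∈ K, ∀ v ∈ S.vertices b, |u x - u v| ≤ C * e + M := by
    intro n
    induction n with
    | zero =>
      intro lam ρ hR u hu e he hE M hM hosc x hx v hv
      have := hosc [] rfl x hx v (h.vertices_subset hv)
      have h0 : 0 ≤ C * e := by positivity
      exact this.trans (by linarith)
    | succ n ih =>
      intro lam ρ hR u hu e he hE M hM hosc x hx v hv
      have hfirst := H u e he ⟨hu, lam, ρ, hR, hE 1⟩ v hv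
      rcases h.mem_cases hx with ⟨i, y, hy, rfl⟩ | ⟨l, hl, t, ht, rfl⟩
      · have h1 := ih hR.shift (u ∘ S.stretch α i) (pathSpace.comp_stretch h.stretch_mem i hu)
          (s * e) (by positivity) (fun m => by
            refine (approxEnergy_comp_le hR m i).trans ?_
            rw [mul_pow, hs, Real.sq_sqrt hlam0, ENNReal.ofReal_mul hlam0]
            gcongr
            · exact hR.lam_le 0
            · exact hE _) M hM
          (fun w hw => hosc (i :: w) (by rw [List.length_cons, hw])) y hy v hv
        -- The comparison goes through `G_i(v)`: the inductive bound acts inside the cell, the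
        -- first-level bound leads back to `v`.
        have h2 := hfirst.1 i v hv
        calc |u (S.stretch α i y) - u v|
            ≤ |u (S.stretch α i y) - u (S.stretch α i v)| + |u (S.stretch α i v) - u v| :=
              abs_sub_le _ _ _
          _ ≤ (C * (s * e) + M) + C₁ * e := add_le_add h1 h2
          _ = (C * s + C₁) * e + M := by ring
          _ = C * e + M := by rw [hCeq]
      · refine (hfirst.2 l hl t ht).trans ?_
        have : C₁ * e ≤ C * e := by gcongr
        linarith
  refine ⟨4 * C ^ 2, by positivity, fun u hu x hx y hy => ?_⟩
  rw [h.mem_domainSubmodule hR] at hu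
  set e := √(S.energy α b r₀ lam ρ u).toReal with he
  have he2 : e ^ 2 = (S.energy α b r₀ lam ρ u).toReal := Real.sq_sqrt ENNReal.toReal_nonneg
  have hE : ∀ m, S.approxEnergy α b r₀ lam ρ m u ≤ ENNReal.ofReal (e ^ 2) := fun m => by
    rw [he2, ENNReal.ofReal_toReal hu.2.ne]
    exact h.approxEnergy_le_energy hR hu.1 m
  obtain ⟨v, hv⟩ := h.vertices_nonempty
  have hbound : ∀ x ∈ K, |u x - u v| ≤ C * e := fun x hx => by
    refine le_of_forall_pos_le_add fun ε hε => ?_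
    obtain ⟨n, hn⟩ := h.exists_osc_le hu.1.1 hε
    exact key n hR u hu.1 e (Real.sqrt_nonneg _) hE ε hε.le hn x hx v hv
  have h1 := hbound x hx
  have h2 := hbound y hy
  have h3 : |u x - u y| ≤ 2 * C * e := by
    calc |u x - u y| ≤ |u x - u v| + |u v - u y| := abs_sub_le _ _ _
      _ ≤ C * e + C * e := add_le_add h1 (by rwa [abs_sub_comm])
      _ = 2 * C * e := by ring
  rw [← he2, ← sq_abs]
  calc |u x - u y| ^ 2 ≤ (2 * C * e) ^ 2 := by gcongr
    _ = 4 * C ^ 2 * e ^ 2 := by ring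

theorem isResistanceEnergy (h : S.Admissible α b K)
    (hR : S.IsBoundedSequence α b r₀ lamStar ρStar lam ρ) (hlam : lamStar < 1) :
    IsResistanceEnergy K (h.domainSubmodule hR) fun u => (S.energy α b r₀ lam ρ u).toReal where
  continuousOn _ hu := hu.1
  congr u hu v huv := by
    rw [h.mem_domainSubmodule hR] at hu ⊢
    rw [h.energy_congr hR huv] at hu ⊢
    exact ⟨⟨h.pathSpace_congr hu.1 huv, hu.2⟩, rfl⟩
  quad := h.isQuadOn_energy hR
  nonneg _ _ := ENNReal.toReal_nonneg
  contraction _ hφ _ hu := h.domain_contraction hR hφ hu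
  osc := h.exists_osc_bound hR hlam
  complete _ hf _ hfv hC := h.domain_complete hR hf hfv hC
  clamp u hu := by
    rw [h.mem_domainSubmodule hR] at hu
    exact (ENNReal.tendsto_toReal hu.2.ne).comp (h.tendsto_energy_sub_clamp hR
      (fun n => by positivity) tendsto_one_div_add_atTop_nhds_zero_nat hu.1)
  dense _ hφ _ hε := h.domain_dense hR hφ hε

end Admissible

end SelfSimilarSet

namespace SelfSimilarSet

/-! ### The measures -/

variable {d N : ℕ} {S : SelfSimilarSet d N} {α β η : ℝ}
  {b : EuclideanSpace ℝ (Fin d) → EuclideanSpace ℝ (Fin d)}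
  {a : Fin N × EuclideanSpace ℝ (Fin d) → ℝ} {K : Set (EuclideanSpace ℝ (Fin d))}
  {ν : Measure (EuclideanSpace ℝ (Fin d))}

theorem IsLineWeight.mul_lt_one (ha : S.IsLineWeight β a) : β * N < 1 := by
  have h1 := ha.β_pos
  have h2 := ha.β_lt
  have h3 : (0 : ℝ) < 1 / (N : ℝ) := h1.trans h2
  rw [lt_div_iff₀ (one_div_pos.1 h3)] at h2
  exact h2

/-- The weights sum to `1 - β N > 0`, so there is at least one line; this also makes `V₀` non-empty.
-/
theorem IsLineWeight.lines_nonempty (ha : S.IsLineWeight β a) : S.lines.Nonempty := by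
  by_contra h
  rw [not_nonempty_iff_eq_empty] at h
  have h1 := ha.sum_a
  have : IsEmpty S.lines := isEmpty_coe_sort.2 h
  rw [tsum_empty, eq_comm, ENNReal.ofReal_eq_zero] at h1
  linarith [ha.mul_lt_one]

/-- There are `N ^ n` words of length `n`, so the sum is geometric with ratio `N c`. -/
theorem tsum_pow_length_lt_top {c : ℝ≥0∞} (hc : N * c < 1) :
    ∑' w : List (Fin N), c ^ w.length < ⊤ := by
  have h1 : ∑' w : List (Fin N), c ^ w.length = ∑' n : ℕ, ((N : ℝ≥0∞) * c) ^ n := by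
    rw [← List.equivSigmaTuple.symm.tsum_eq, ENNReal.tsum_sigma']
    refine tsum_congr fun n => ?_
    have h2 : ∀ f : Fin n → Fin N,
        c ^ (List.equivSigmaTuple.symm (⟨n, f⟩ : Σ n, Fin n → Fin N)).length = c ^ n := fun f => by
      congr 1
      exact List.length_ofFn
    simp only [h2, tsum_fintype, Finset.sum_const, Finset.card_univ, Fintype.card_fun,
      Fintype.card_fin, nsmul_eq_mul, Nat.cast_pow, mul_pow]
  rw [h1, ENNReal.tsum_geometric]
  exact ENNReal.inv_lt_top.2 (tsub_pos_of_lt hc)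

theorem IsLineWeight.lineMeasure_univ_lt_top (ha : S.IsLineWeight β a) (α : ℝ)
    (b : EuclideanSpace ℝ (Fin d) → EuclideanSpace ℝ (Fin d)) :
    S.lineMeasure α b β a univ < ⊤ := by
  have hm : ∀ p : List (Fin N) × S.lines,
      Measurable (wordMap (S.stretch α) p.1 ∘ S.lineCurve α b p.2) := fun p =>
    ((continuous_wordMap (continuous_stretch α) p.1).comp (continuous_lineCurve α b _)).measurable
  rw [lineMeasure, Measure.sum_apply _ MeasurableSet.univ]
  have h1 : ∀ p : List (Fin N) × S.lines, (ENNReal.ofReal (β ^ p.1.length * a p.2) •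
      (volume.restrict (Icc (0 : ℝ) 1)).map (wordMap (S.stretch α) p.1 ∘ S.lineCurve α b p.2)) univ
      = ENNReal.ofReal β ^ p.1.length * ENNReal.ofReal (a p.2) := fun p => by
    rw [Measure.smul_apply, Measure.map_apply (hm p) MeasurableSet.univ, preimage_univ,
      Measure.restrict_apply_univ, Real.volume_Icc, sub_zero, ENNReal.ofReal_one, smul_eq_mul,
      mul_one, ENNReal.ofReal_mul (pow_nonneg ha.β_pos.le _), ENNReal.ofReal_pow ha.β_pos.le]
  simp only [h1]
  rw [ENNReal.tsum_prod' (f := fun p : List (Fin N) × S.lines =>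
    ENNReal.ofReal β ^ p.1.length * ENNReal.ofReal (a p.2))]
  simp only [ENNReal.tsum_mul_left, ENNReal.tsum_mul_right]
  refine ENNReal.mul_lt_top (tsum_pow_length_lt_top ?_) (by rw [ha.sum_a]; exact ENNReal.ofReal_lt_top)
  rw [← ENNReal.ofReal_natCast, ← ENNReal.ofReal_mul (Nat.cast_nonneg N), ENNReal.ofReal_lt_one,
    mul_comm]
  exact ha.mul_lt_one

theorem IsLineWeight.isFiniteMeasure_mixedMeasure (ha : S.IsLineWeight β a) [IsFiniteMeasure ν] :
    IsFiniteMeasure (S.mixedMeasure α b β a ν η) := by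
  refine ⟨?_⟩
  rw [mixedMeasure, Measure.add_apply, Measure.smul_apply, Measure.smul_apply, smul_eq_mul,
    smul_eq_mul]
  exact ENNReal.add_lt_top.2
    ⟨ENNReal.mul_lt_top ENNReal.ofReal_lt_top (ha.lineMeasure_univ_lt_top α b),
      ENNReal.mul_lt_top ENNReal.ofReal_lt_top (measure_lt_top _ _)⟩

namespace Admissible

/-- The lines are dense in `K`. -/
theorem exists_line_near (h : S.Admissible α b K) {x : EuclideanSpace ℝ (Fin d)} (hx : x ∈ K)
    {ε : ℝ} (hε : 0 < ε) :
    ∃ w : List (Fin N), ∃ l ∈ S.lines, ∃ t ∈ Icc (0 : ℝ) 1,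
      dist (wordMap (S.stretch α) w (S.lineCurve α b l t)) x < ε := by
  -- A point either reaches a line within `n` subdivisions or lies in an `n`-cell, which contains
  -- lines and is small.
  have key : ∀ n : ℕ, ∀ x ∈ K, ∃ w : List (Fin N), ∃ l ∈ S.lines, ∃ t ∈ Icc (0 : ℝ) 1,
      dist (wordMap (S.stretch α) w (S.lineCurve α b l t)) x ≤ α ^ n * Metric.diam K := by
    intro n
    induction n with
    | zero =>
      intro x hx
      obtain ⟨l, hl⟩ := h.lines_nonempty
      refine ⟨[], l, hl, 0, ⟨le_rfl, zero_le_one⟩, ?_⟩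
      rw [pow_zero, one_mul]
      exact Metric.dist_le_diam_of_mem h.fractal.isCompact.isBounded
        (h.lineCurve_mem hl ⟨le_rfl, zero_le_one⟩) hx
    | succ n ih =>
      intro x hx
      rcases h.mem_cases hx with ⟨i, y, hy, rfl⟩ | ⟨l, hl, t, ht, rfl⟩
      · obtain ⟨w, l, hl, t, ht, hd⟩ := ih y hy
        refine ⟨i :: w, l, hl, t, ht, (dist_stretch_le h.α_pos.le i _ _).trans ?_⟩
        rw [pow_succ', mul_assoc]
        exact mul_le_mul_of_nonneg_left hd h.α_pos.le
      · refine ⟨[], l, hl, t, ht, ?_⟩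
        change dist (S.lineCurve α b l t) (S.lineCurve α b l t) ≤ _
        rw [dist_self]
        exact mul_nonneg (pow_nonneg h.α_pos.le _) Metric.diam_nonneg
  obtain ⟨n, hn⟩ := (h.tendsto_diam.eventually (gt_mem_nhds hε)).exists
  obtain ⟨w, l, hl, t, ht, hd⟩ := key n x hx
  exact ⟨w, l, hl, t, ht, hd.trans_lt hn⟩

theorem lineMeasure_pos (h : S.Admissible α b K) (ha : S.IsLineWeight β a)
    {U : Set (EuclideanSpace ℝ (Fin d))} (hU : IsOpen U) (hUK : (U ∩ K).Nonempty) :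
    0 < S.lineMeasure α b β a (U ∩ K) := by
  obtain ⟨x, hxU, hxK⟩ := hUK
  obtain ⟨ε, hε, hball⟩ := Metric.isOpen_iff.1 hU x hxU
  obtain ⟨w, l, hl, t, ht, hd⟩ := h.exists_line_near hxK hε
  set f : ℝ → EuclideanSpace ℝ (Fin d) := wordMap (S.stretch α) w ∘ S.lineCurve α b l with hf
  have hfc : Continuous f :=
    (continuous_wordMap (continuous_stretch α) w).comp (continuous_lineCurve α b l)
  -- The parameter found may be an end point; since the preimage is open, it also contains interior
  -- parameters and so has positive length.
  have hne : (f ⁻¹' U ∩ Ioo 0 1).Nonempty := by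
    have htc : t ∈ closure (Ioo (0 : ℝ) 1) := by rwa [closure_Ioo zero_ne_one]
    exact mem_closure_iff.1 htc _ (hU.preimage hfc) (hball hd)
  have hpos : 0 < volume (f ⁻¹' U ∩ Ioo 0 1) :=
    ((hU.preimage hfc).inter isOpen_Ioo).measure_pos volume hne
  have hsub : f ⁻¹' U ∩ Ioo 0 1 ⊆ f ⁻¹' (U ∩ K) ∩ Icc 0 1 := fun s hs =>
    ⟨⟨hs.1, h.word_mem w _ (h.lineCurve_mem hl (Ioo_subset_Icc_self hs.2))⟩,
      Ioo_subset_Icc_self hs.2⟩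
  have hmeas : MeasurableSet (U ∩ K) := hU.measurableSet.inter h.fractal.isCompact.measurableSet
  have hle : ENNReal.ofReal (β ^ w.length * a l) * ((volume.restrict (Icc (0 : ℝ) 1)).map f) (U ∩ K)
      ≤ S.lineMeasure α b β a (U ∩ K) :=
    Measure.le_sum (fun p : List (Fin N) × S.lines => ENNReal.ofReal (β ^ p.1.length * a p.2) •
      (volume.restrict (Icc (0 : ℝ) 1)).map (wordMap (S.stretch α) p.1 ∘ S.lineCurve α b p.2))
      (w, ⟨l, hl⟩) (U ∩ K)
  refine lt_of_lt_of_le (ENNReal.mul_pos ?_ ?_) hle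
  · exact (ENNReal.ofReal_pos.2 (mul_pos (pow_pos ha.β_pos _) (ha.a_pos l hl))).ne'
  · rw [Measure.map_apply hfc.measurable hmeas,
      Measure.restrict_apply (hfc.measurable hmeas)]
    exact (hpos.trans_le (measure_mono hsub)).ne'

theorem mixedMeasure_pos (h : S.Admissible α b K) (ha : S.IsLineWeight β a) (hη : 0 < η)
    {U : Set (EuclideanSpace ℝ (Fin d))} (hU : IsOpen U) (hUK : (U ∩ K).Nonempty) :
    0 < S.mixedMeasure α b β a ν η (U ∩ K) := by
  rw [mixedMeasure, Measure.add_apply, Measure.smul_apply, smul_eq_mul]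
  exact lt_of_lt_of_le (ENNReal.mul_pos (ENNReal.ofReal_pos.2 hη).ne'
    (h.lineMeasure_pos ha hU hUK).ne') le_self_add

end Admissible

end SelfSimilarSet

end StretchedFractal

end

theorem lemma5p1 {d N : ℕ} (S : StretchedFractal.SelfSimilarSet d N) (hS : S.Stretchable)
    (α : ℝ) (hα₀ : 0 < α) (hα₁ : α < 1)
    (b : EuclideanSpace ℝ (Fin d) → EuclideanSpace ℝ (Fin d)) (hb : S.IsBoundaryChoice α b)
    (K : Set (EuclideanSpace ℝ (Fin d))) (hK : S.IsStretchedFractal α b K)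
    (hsep : S.IsSeparated α b K)
    (r₀ : Sym2 (EuclideanSpace ℝ (Fin d)) → ℝ≥0∞) (lam : ℕ → ℝ)
    (ρ : ℕ → Fin N × EuclideanSpace ℝ (Fin d) → ℝ)
    (hR : S.IsRegularSequence α b r₀ lam ρ)
    (β : ℝ) (a : Fin N × EuclideanSpace ℝ (Fin d) → ℝ) (ha : S.IsLineWeight β a)
    (ν : Measure (EuclideanSpace ℝ (Fin d))) (hν : S.IsFractalMeasure α ν)
    (η : ℝ) (hη₀ : 0 < η) (hη₁ : η ≤ 1) :
    StretchedFractal.IsRegularDirichletFormOn K (S.mixedMeasure α b β a ν η)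
        (S.domain α b K r₀ lam ρ) (S.energyForm α b r₀ lam ρ) ∧
      StretchedFractal.IsRegularDirichletFormOn (K \ S.vertices b) (S.mixedMeasure α b β a ν η)
        (S.domain₀ α b K r₀ lam ρ) (S.energyForm α b r₀ lam ρ) := by
  have h : S.Admissible α b K := ⟨hS, hα₀, hα₁, hb, hK, hsep, ha.lines_nonempty⟩
  obtain ⟨lamStar, hlam, hlam_le⟩ := hR.lam_bound
  obtain ⟨ρStar, hρ⟩ := hR.ρ_bound
  have hB : S.IsBoundedSequence α b r₀ lamStar ρStar lam ρ := ⟨hR.harmonic, hlam_le, hρ⟩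
  have := hν.prob
  have : IsFiniteMeasure (S.mixedMeasure α b β a ν η) := ha.isFiniteMeasure_mixedMeasure
  have hE := h.isResistanceEnergy hB hlam
  refine ⟨?_, hE.isRegularDirichletFormOn hK.isCompact h.finite_vertices.isClosed
    h.vertices_subset fun U hU hne => h.mixedMeasure_pos ha hη₀ hU hne⟩
  have h1 := hE.isRegularDirichletFormOn hK.isCompact isClosed_empty (empty_subset K)
    (μ := S.mixedMeasure α b β a ν η) fun U hU hne => h.mixedMeasure_pos ha hη₀ hU hne
  -- For the first assertion the set of prescribed zeros is empty.
  have h2 : {u | u ∈ h.domainSubmodule hB ∧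
      ∀ x ∈ (∅ : Set (EuclideanSpace ℝ (Fin d))), u x = 0} = S.domain α b K r₀ lam ρ := by
    ext u
    exact ⟨fun hu => hu.1, fun hu => ⟨hu, fun x hx => absurd hx (notMem_empty x)⟩⟩
  rw [h2, sdiff_empty] at h1
  exact h1
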